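/- Let $(M,g)$ be a complete Riemannian manifold with non-positive sectional curvature, fix $x\in M$, $r>0$ and an integer $n\ge 1$, and let $T^1_xM$ be the unit tangent sphere at $x$. For $v=(v_1,\dots,v_n)\in (T^1_xM)^n$ let $\alpha_v:[0,nr]\to M$ be the broken geodesic with $\alpha_v(0)=x$ and $$\alpha_v(kr+t)=\exp_{\alpha_v(kr)}\bigl(t\,v_{k+1}(kr)\bigr),\qquad 0\le t\le r,\quad k=0,\dots,n-1,$$ where $v_i(s)\in T_{\alpha_v(s)}M$ is the parallel transport of $v_i$ along $\alpha_v$. Let $\varphi:(T^1_xM)^n\to M$, $\varphi(v)=\alpha_v(nr)$ (Sunada's mapping). Let $S(\varphi)$ be the set of $v\in (T^1_xM)^n$ at which the tangent map $D_v\varphi$ is not surjective, and $S_k(\varphi)$ the set of those at which $D_v\varphi$ has corank $k$, i.e. $\dim M-\operatorname{rank} D_v\varphi=k$. Then $\varphi$ is smooth (indeed, the same formula defines a smooth map on all of $(T_xM)^n$), and: 1. At every singular point the tangent map has corank one, i.e. $S(\varphi)=S_1(\varphi)$. 2. $S(\varphi)=\{(v_1,\dots,v_n)\in (T^1_xM)^n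 : v_i=\pm v_1 \text{ for all } i=2,\dots,n\}$, where the signs may depend on $i$. 3. If $(v_1,\dots,v_n)\in S(\varphi)$ satisfies $\sum_{i=1}^n v_i\ne 0$, then the restriction of $\varphi$ to the connected component of $S(\varphi)$ containing $v$ is an immersion. -/

import Mathlib

open Bundle Manifold Set
open scoped ContDiff Topology

noncomputable section

/-! Throughout, `E` is a finite-dimensional real vector space and `M` is a smooth manifold without
boundary modelled on `E`. In Mathlib the tangent space `TangentSpace 𝓘(ℝ, E) p` is, by definition,
the vector space `E` (a tangent vector is recorded by its coordinates in the preferred chart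
`extChartAt 𝓘(ℝ, E) p` at `p`), so that tangent vectors are written as elements of `E`, next to
their base point. -/

/-- A smooth Riemannian metric on the manifold `M`. -/
abbrev SmoothMetric (E : Type*) [NormedAddCommGroup E] [NormedSpace ℝ E]
    (M : Type*) [TopologicalSpace M] [ChartedSpace E M] [IsManifold 𝓘(ℝ, E) ∞ M] :=
  ContMDiffRiemannianMetric 𝓘(ℝ, E) ∞ E (fun p : M ↦ TangentSpace 𝓘(ℝ, E) p)

section Riemannian

variable {E : Type*} [NormedAddCommGroup E] [NormedSpace ℝ E]
  {M : Type*} [TopologicalSpace M] [ChartedSpace E M]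

/-! ### Curves and vector fields along them, in charts -/

/-- The velocity `γ'(t) ∈ T_{γ(t)} M` of a curve. -/
def velocity (γ : ℝ → M) (t : ℝ) : E := mfderiv 𝓘(ℝ, ℝ) 𝓘(ℝ, E) γ t (1 : ℝ)

/-- The coordinates in the chart around `p` of a curve `γ`. -/
def chartCurve (p : M) (γ : ℝ → M) (t : ℝ) : E := extChartAt 𝓘(ℝ, E) p (γ t)

/-- The coordinates in the chart around `p` of a vector field `W` along a curve `γ`, where
`W t ∈ T_{γ(t)} M`. -/
def chartField (p : M) (γ : ℝ → M) (W : ℝ → E) (t : ℝ) : E :=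
  mfderiv 𝓘(ℝ, E) 𝓘(ℝ, E) (extChartAt 𝓘(ℝ, E) p) (γ t) (W t)

variable [IsManifold 𝓘(ℝ, E) ∞ M] (g : SmoothMetric E M)

/-! ### Metric, Christoffel symbols and curvature in charts -/

/-- The inner product of two tangent vectors at `p`. -/
def metricInner (p : M) (a b : E) : ℝ := g.inner p a b

/-- The matrix of the metric in the chart around `p`, as a function of the coordinates `u`: the
bilinear form `(a, b) ↦ g(∂_a, ∂_b)`, where `∂_a` is the coordinate vector field with constant
coordinates `a`. -/
def chartMetric (p : M) (u : E) : E →L[ℝ] E →L[ℝ] ℝ :=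
  let A : E →L[ℝ] E := mfderiv 𝓘(ℝ, E) 𝓘(ℝ, E) (extChartAt 𝓘(ℝ, E) p).symm u
  let B : E →L[ℝ] E →L[ℝ] ℝ := g.inner ((extChartAt 𝓘(ℝ, E) p).symm u)
  B.bilinearComp A A

/-- The Christoffel symbols of the first kind in the chart around `p`: the linear form
`c ↦ (∂_a g(b, c) + ∂_b g(a, c) - ∂_c g(a, b)) / 2`. -/
def christoffelLower (p : M) (u a b : E) : E →L[ℝ] ℝ :=
  (1 / 2 : ℝ) • (fderiv ℝ (chartMetric g p) u a b + fderiv ℝ (chartMetric g p) u b a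
    - ((fderiv ℝ (chartMetric g p) u).flip a).flip b)

/-- The Christoffel symbols `Γ(a, b) = ∇_{∂_a} ∂_b` of the Levi-Civita connection in the chart
around `p`: the vector with `g(Γ(a, b), c) = (∂_a g(b, c) + ∂_b g(a, c) - ∂_c g(a, b)) / 2` for
all `c`. -/
def christoffel (p : M) (u a b : E) : E :=
  (chartMetric g p u).inverse (christoffelLower g p u a b)

/-- The Riemann curvature tensor `R(a, b)c = ∇_a ∇_b c - ∇_b ∇_a c - ∇_{[a, b]} c` in the chart
around `p`, at the point with coordinates `u`. -/
def riemannCurvature (p : M) (u a b c : E) : E :=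
  fderiv ℝ (fun y ↦ christoffel g p y b c) u a - fderiv ℝ (fun y ↦ christoffel g p y a c) u b
    + christoffel g p u a (christoffel g p u b c) - christoffel g p u b (christoffel g p u a c)

/-- The sectional curvature of the plane spanned by `a` and `b`, at the point with coordinates `u`
in the chart around `p`. -/
def sectionalCurvature (p : M) (u a b : E) : ℝ :=
  chartMetric g p u (riemannCurvature g p u a b b) a /
    (chartMetric g p u a a * chartMetric g p u b b - chartMetric g p u a b ^ 2)

/-- All sectional curvatures are non-positive. -/
def NonposCurvature : Prop :=
  ∀ p : M, ∀ u ∈ (extChartAt 𝓘(ℝ, E) p).target, ∀ a b : E,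
    LinearIndependent ℝ ![a, b] → sectionalCurvature g p u a b ≤ 0

/-! ### Geodesics, completeness and parallel transport -/

/-- `γ : ℝ → M` is a geodesic: a smooth curve with `∇_{γ'} γ' = 0`, that is, in every chart
`c'' = - Γ(c', c')` for the coordinates `c` of `γ`. -/
def IsGeodesic (γ : ℝ → M) : Prop :=
  ContMDiff 𝓘(ℝ, ℝ) 𝓘(ℝ, E) ∞ γ ∧
  ∀ (p : M) (t : ℝ), γ t ∈ (extChartAt 𝓘(ℝ, E) p).source →
    deriv (deriv (chartCurve p γ)) t =
      - christoffel g p (chartCurve p γ t) (deriv (chartCurve p γ) t) (deriv (chartCurve p γ) t)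

/-- `γ` is the geodesic `t ↦ exp_p(t v)`. -/
def IsGeodesicFrom (p : M) (v : E) (γ : ℝ → M) : Prop :=
  IsGeodesic g γ ∧ γ 0 = p ∧ velocity γ 0 = v

/-- `(M, g)` is (geodesically) complete: for every `p` and every `v ∈ T_p M` the geodesic
`t ↦ exp_p(t v)` is defined for all times. -/
def IsCompleteMetric : Prop := ∀ (p : M) (v : E), ∃ γ : ℝ → M, IsGeodesicFrom g p v γ

open Classical in
/-- `geodesic g p v t = exp_p(t v)`. -/
def geodesic (p : M) (v : E) : ℝ → M :=
  if h : ∃ γ : ℝ → M, IsGeodesicFrom g p v γ then h.choose else fun _ ↦ p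

/-- The vector field `W` along the curve `γ` is parallel: `∇_{γ'} W = 0`, that is, in every chart
`w' = - Γ(c', w)` for the coordinates `c` of `γ` and `w` of `W`. -/
def IsParallelAlong (γ : ℝ → M) (W : ℝ → E) : Prop :=
  ∀ (p : M) (t : ℝ), γ t ∈ (extChartAt 𝓘(ℝ, E) p).source →
    HasDerivAt (chartField p γ W)
      (- christoffel g p (chartCurve p γ t) (deriv (chartCurve p γ) t) (chartField p γ W t)) t

open Classical in
/-- The parallel transport of `w ∈ T_{γ(0)} M` along `γ` to `T_{γ(t)} M`. -/
def parallelTransport (γ : ℝ → M) (w : E) (t : ℝ) : E :=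
  if h : ∃ W : ℝ → E, IsParallelAlong g γ W ∧ W 0 = w then h.choose t else 0

/-! ### Sunada's mapping -/

/-- The corners of the broken geodesic `α_v` that starts at `x` with the tangent vectors
`v = (v_1, …, v_n)` at `x`: the point `α_v(k r)`, together with the parallel transports
`v_1(k r), …, v_n(k r)` of all the `v_i` along `α_v` to that point. The segment number `k + 1` is
`t ↦ exp_{α_v(k r)}(t v_{k+1}(k r))`, `0 ≤ t ≤ r` (the entry `v_{k+1}` has index `k` in `Fin n`). -/
def brokenGeodesic (x : M) (r : ℝ) {n : ℕ} (v : Fin n → E) : ℕ → M × (Fin n → E)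
  | 0 => (x, v)
  | k + 1 =>
    let s := brokenGeodesic x r v k
    if h : k < n then
      let γ := geodesic g s.1 (s.2 ⟨k, h⟩)
      (γ r, fun i ↦ parallelTransport g γ (s.2 i) r)
    else s

/-- Sunada's mapping `φ(v) = α_v(n r)`. The formula makes sense for all tuples `v ∈ (T_x M)^n`;
the mapping of interest is its restriction to the submanifold `unitTuples g x n = (T_x^1 M)^n`. -/
def sunadaMap (x : M) (r : ℝ) (n : ℕ) (v : Fin n → E) : M := (brokenGeodesic g x r v n).1

/-- The `n`-th power `(T_x^1 M)^n` of the unit tangent sphere at `x`. -/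
def unitTuples (x : M) (n : ℕ) : Set (Fin n → E) := {v | ∀ i, metricInner g x (v i) (v i) = 1}

/-- The tangent space of the submanifold `(T_x^1 M)^n ⊆ (T_x M)^n` at `v`, namely
`{w | w_i ⊥ v_i for all i}`. -/
def unitTuplesTangent (x : M) {n : ℕ} (v : Fin n → E) : Submodule ℝ (Fin n → E) where
  carrier := {w | ∀ i, metricInner g x (v i) (w i) = 0}
  zero_mem' := fun i ↦ (g.inner x (v i)).map_zero
  add_mem' := fun {a b} ha hb i ↦ by
    have h := (g.inner x (v i)).map_add (a i) (b i)
    have h1 : g.inner x (v i) (a i) = 0 := ha i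
    have h2 : g.inner x (v i) (b i) = 0 := hb i
    rw [h1, h2, add_zero] at h
    exact h
  smul_mem' := fun c a ha i ↦ by
    have h := (g.inner x (v i)).map_smul c (a i)
    have h1 : g.inner x (v i) (a i) = 0 := ha i
    rw [h1, smul_zero] at h
    exact h

/-- The tangent map at `v` of a map `f` on `(T_x M)^n`, as a map into `T_{f(v)} M`. -/
def ambientTangentMap {n : ℕ} (f : (Fin n → E) → M) (v : Fin n → E) : (Fin n → E) →ₗ[ℝ] E :=
  let L : (Fin n → E) →L[ℝ] E := mfderiv 𝓘(ℝ, Fin n → E) 𝓘(ℝ, E) f v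
  L.toLinearMap

/-- The tangent map `D_v φ : T_v (T_x^1 M)^n → T_{φ(v)} M` of Sunada's mapping
`φ : (T_x^1 M)^n → M`. -/
def sunadaTangentMap (x : M) (r : ℝ) (n : ℕ) (v : Fin n → E) :
    unitTuplesTangent g x v →ₗ[ℝ] E :=
  (ambientTangentMap (sunadaMap g x r n) v).domRestrict (unitTuplesTangent g x v)

/-- The singular set `S(φ)`: the points of `(T_x^1 M)^n` where `D_v φ` is not surjective. -/
def singularSet (x : M) (r : ℝ) (n : ℕ) : Set (Fin n → E) :=
  {v ∈ unitTuples g x n | ¬ Function.Surjective (sunadaTangentMap g x r n v)}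

/-- The set `S_k(φ)` of the points of `(T_x^1 M)^n` where `D_v φ` has corank `k`, the corank being
the dimension of `T_{φ(v)} M` minus the rank, i.e. the dimension of the cokernel. -/
def corankSet (x : M) (r : ℝ) (n k : ℕ) : Set (Fin n → E) :=
  {v ∈ unitTuples g x n |
    Module.finrank ℝ (E ⧸ LinearMap.range (sunadaTangentMap g x r n v)) = k}

/-- The restriction of the smooth map `f` to the submanifold `C` is an immersion: at every point
`w ∈ C` the tangent map of `f` is injective on the tangent space `T_w C`. The tangent space is
given here as the span of the tangent cone of the set `C` at `w` (limits of `c_k • (w_k - w)` with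
`w_k → w` in `C`), which is the usual one when `C` is a submanifold. -/
def IsImmersionOnSubset {n : ℕ} (f : (Fin n → E) → M) (C : Set (Fin n → E)) : Prop :=
  ∀ w ∈ C, Set.InjOn (ambientTangentMap f w) (Submodule.span ℝ (tangentConeAt ℝ C w) : Set (Fin n → E))

end Riemannian

end

set_option maxSynthPendingDepth 3
open scoped NNReal

noncomputable section

/-! ### Postcomposition with a smooth map is smooth on spaces of continuous maps -/

section Postcomp

variable {K : Type*} [TopologicalSpace K] [CompactSpace K]

/-! Let D_k be the derivative of the k-th corner of the broken geodesic, restricted to variations a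
with a_i orthogonal to v_i, and number the directions from 0, so that the segment from corner k to
corner k + 1 has direction w_k, the transport of v_k. Two facts about a single segment carry
everything.

First variation: since a_k is orthogonal to v_k, the speed of the segment is stationary, so ⟨D_{k+1}
a, w_k⟩ at the end of the segment equals ⟨D_k a, w_k⟩ at its beginning
(`metricInner_cornerTangentMap_succ`).

No conjugate points: the squared length of a Jacobi field is convex in non-positive curvature, so a
Jacobi field vanishing at two distinct times vanishes in between, and exp has injective differential
(`eq_zero_of_velocity_geodesic_eq_zero`). Varying v_k alone fixes corner k, and by a dimension count
it moves corner k + 1 in every direction orthogonal to w_k (`exists_cornerTangentMap_eq`).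

Hence the image of D_{k+1} contains the hyperplane orthogonal to w_k, and it is the whole tangent
space as soon as some D_k a is not orthogonal to w_k. As long as all directions are ±v_0, every D_k
a is orthogonal to the common line of directions, and the image is exactly a hyperplane. At the
first direction off that line the previous hyperplane is not orthogonal to w_k, so the map becomes
onto, and it remains onto along all later segments. This gives the description of the singular set
and corank one.

On a component of the singular set the signs e_i with v_i = e_i v_0 are constant. The broken
geodesic folds onto one geodesic, and the mapping becomes exp_x(r (∑ e_i) v_0), which is an
immersion when ∑ e_i ≠ 0, again by the absence of conjugate points.

The analytic basis is the smooth dependence of geodesics and parallel transport on initial data. A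
local flow is obtained by inverting the Picard integral equation on a space of continuous paths
(`exists_flow_of_lipschitzWith`), and `forall_of_locally_propagates` extends local statements to all
times. -/

/-- Pointwise application of a continuous bilinear map to two continuous families of vectors. -/
def ContinuousMap.bilinearMap (K : Type*) [TopologicalSpace K] [CompactSpace K]
    {A E F : Type*} [NormedAddCommGroup A] [NormedSpace ℝ A] [NormedAddCommGroup E]
    [NormedSpace ℝ E] [NormedAddCommGroup F] [NormedSpace ℝ F] (β : A →L[ℝ] E →L[ℝ] F) :
    C(K, A) →L[ℝ] C(K, E) →L[ℝ] C(K, F) :=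
  let m : C(K, A) → C(K, E) → C(K, F) := fun a y ↦
    ⟨fun k ↦ β (a k) (y k), (β.continuous.comp a.continuous).clm_apply y.continuous⟩
  let B : C(K, A) →ₗ[ℝ] C(K, E) →ₗ[ℝ] C(K, F) := LinearMap.mk₂ ℝ m
    (fun _ _ _ ↦ by ext; simp [m]) (fun _ _ _ ↦ by ext; simp [m])
    (fun _ _ _ ↦ by ext; simp [m]) (fun _ _ _ ↦ by ext; simp [m])
  B.mkContinuous₂ ‖β‖ (fun a y ↦ by
    refine (ContinuousMap.norm_le (B a y) (by positivity)).2 fun k ↦ ?_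
    exact (β (a k)).le_of_opNorm_le_of_le
      (β.le_of_opNorm_le_of_le le_rfl (a.norm_coe_le_norm k)) (y.norm_coe_le_norm k))

/-- Pointwise application of a family of operators to a family of vectors. -/
def ContinuousMap.clmApply (K : Type*) [TopologicalSpace K] [CompactSpace K]
    (E F : Type*) [NormedAddCommGroup E] [NormedSpace ℝ E] [NormedAddCommGroup F]
    [NormedSpace ℝ F] : C(K, E →L[ℝ] F) →L[ℝ] C(K, E) →L[ℝ] C(K, F) :=
  ContinuousMap.bilinearMap K (ContinuousLinearMap.id ℝ (E →L[ℝ] F))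

/-- Pointwise mean value inequality. The uniformity over `K` comes from continuity of
postcomposition with `G'` in the supremum norm. -/
theorem hasFDerivAt_continuousMap_comp
    {E F : Type*} [NormedAddCommGroup E] [NormedSpace ℝ E] [NormedAddCommGroup F]
    [NormedSpace ℝ F] {G : E → F} {G' : E → E →L[ℝ] F} (hG : ∀ u, HasFDerivAt G (G' u) u)
    (hG' : Continuous G') (y : C(K, E)) :
    HasFDerivAt (fun y : C(K, E) ↦
        (⟨G, continuous_iff_continuousAt.2 fun u ↦ (hG u).continuousAt⟩ : C(E, F)).comp y)
      (ContinuousMap.clmApply K E F ((⟨G', hG'⟩ : C(E, E →L[ℝ] F)).comp y)) y := by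
  rw [hasFDerivAt_iff_isLittleO_nhds_zero, Asymptotics.isLittleO_iff]
  intro ε hε
  have hc := (ContinuousMap.continuous_postcomp (X := K) (⟨G', hG'⟩ : C(E, E →L[ℝ] F))).tendsto y
  obtain ⟨δ, hδ, hb⟩ := (Metric.tendsto_nhds_nhds (α := C(K, E)) (β := C(K, E →L[ℝ] F))).1 hc ε hε
  filter_upwards [Metric.ball_mem_nhds (0 : C(K, E)) hδ] with h hh
  rw [mem_ball_zero_iff] at hh
  rw [ContinuousMap.norm_le _ (by positivity)]
  intro k
  have hconv : Convex ℝ (Metric.ball (y k) δ) := convex_ball _ _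
  have key := hconv.norm_image_sub_le_of_norm_hasFDerivWithin_le' (f := G) (f' := G')
    (φ := G' (y k)) (C := ε) (x := y k) (y := y k + h k)
    (fun u _ ↦ (hG u).hasFDerivWithinAt) (fun u hu ↦ by
      -- Translating `y` by a constant gives a nearby path with value `u` at `k`, so the supremum
      -- norm estimate controls `G' u - G' (y k)` without a separate compactness argument.
      have h1 : dist (y + ContinuousMap.const K (u - y k)) y < δ := by
        rw [dist_eq_norm, add_sub_cancel_left]
        refine lt_of_le_of_lt ((ContinuousMap.norm_le _ (norm_nonneg (u - y k))).2 fun _ ↦ le_rfl) ?_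
        rwa [← dist_eq_norm]
      have h2 := hb h1
      have h3 := (ContinuousMap.dist_apply_le_dist (f := (⟨G', hG'⟩ : C(E, E →L[ℝ] F)).comp
        (y + ContinuousMap.const K (u - y k)))
        (g := (⟨G', hG'⟩ : C(E, E →L[ℝ] F)).comp y) k).trans h2.le
      simpa [dist_eq_norm] using h3)
    (Metric.mem_ball_self hδ) (by
      rw [mem_ball_iff_norm, add_sub_cancel_left]
      exact (h.norm_coe_le_norm k).trans_lt hh)
  rw [add_sub_cancel_left] at key
  exact key.trans (mul_le_mul_of_nonneg_left (h.norm_coe_le_norm k) hε.le)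

universe u in
-- The derivative is postcomposition with `fderiv ℝ G` followed by a fixed bounded operator, so each
-- order reduces to the previous one. The target changes from `F` to `E →L[ℝ] F`, hence the
-- quantification over `F` inside the induction and the common universe.
theorem contDiff_continuousMap_comp_nat {E : Type u} [NormedAddCommGroup E] [NormedSpace ℝ E]
    (n : ℕ) : ∀ {F : Type u} [NormedAddCommGroup F] [NormedSpace ℝ F] (G : C(E, F)),
    ContDiff ℝ ∞ G → ContDiff ℝ n (fun y : C(K, E) ↦ G.comp y) := by
  induction n with
  | zero =>
    intro F _ _ G hG
    exact contDiff_zero.2 (ContinuousMap.continuous_postcomp G)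
  | succ n ih =>
    intro F _ _ G hG
    have hd := hasFDerivAt_continuousMap_comp (K := K) (G := G) (G' := fderiv ℝ G)
      (fun u ↦ (hG.differentiable (by simp)).differentiableAt.hasFDerivAt)
      (hG.continuous_fderiv (by simp))
    rw [Nat.cast_succ, contDiff_succ_iff_hasFDerivAt]
    refine ⟨_, ?_, hd⟩
    exact (ContinuousMap.clmApply K E F).contDiff.comp
      (ih ⟨fderiv ℝ G, hG.continuous_fderiv (by simp)⟩ (hG.fderiv_right (by simp)))

universe u in
theorem contDiff_continuousMap_comp {E F : Type u} [NormedAddCommGroup E] [NormedSpace ℝ E]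
    [NormedAddCommGroup F] [NormedSpace ℝ F] (G : C(E, F)) (hG : ContDiff ℝ ∞ G) :
    ContDiff ℝ ∞ (fun y : C(K, E) ↦ G.comp y) :=
  contDiff_infty.2 fun n ↦ contDiff_continuousMap_comp_nat n G hG

end Postcomp

/-! ### Local flows of smooth vector fields depend smoothly on the initial value -/

section Flow

variable {E : Type*} [NormedAddCommGroup E] [NormedSpace ℝ E] [CompleteSpace E]

/-- The primitive vanishing at `0`, as an operator on the continuous maps on `[-ε, ε]`. -/
def primitiveCLM (E : Type*) [NormedAddCommGroup E] [NormedSpace ℝ E] [CompleteSpace E]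
    {ε : ℝ} (hε : -ε ≤ ε) : C(Icc (-ε) ε, E) →L[ℝ] C(Icc (-ε) ε, E) :=
  LinearMap.mkContinuous
    { toFun := fun y ↦ ⟨fun t ↦ ∫ s in (0 : ℝ)..t, y (projIcc _ _ hε s),
        (intervalIntegral.continuous_primitive (fun a b ↦
          (y.continuous.comp continuous_projIcc).intervalIntegrable a b) 0).comp
            continuous_subtype_val⟩
      map_add' := fun y z ↦ by
        ext t
        exact intervalIntegral.integral_add
          ((y.continuous.comp continuous_projIcc).intervalIntegrable _ _)
          ((z.continuous.comp continuous_projIcc).intervalIntegrable _ _)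
      map_smul' := fun c y ↦ by
        ext t
        exact intervalIntegral.integral_smul c _ } ε
    (fun y ↦ by
      have h0 : 0 ≤ ε := by linarith
      rw [ContinuousMap.norm_le _ (by positivity)]
      intro t
      refine (intervalIntegral.norm_integral_le_of_norm_le_const (C := ‖y‖)
        fun s _ ↦ y.norm_coe_le_norm _).trans ?_
      rw [mul_comm, sub_zero]
      exact mul_le_mul_of_nonneg_right (abs_le.2 t.2) (norm_nonneg _))

theorem norm_primitiveCLM_le {ε : ℝ} (hε : -ε ≤ ε) : ‖primitiveCLM E hε‖ ≤ ε :=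
  LinearMap.mkContinuous_norm_le _ (by linarith) _

/-- A perturbation of the identity by a smooth contraction is a diffeomorphism. -/
theorem exists_contDiff_inverse_id_sub {X : Type*} [NormedAddCommGroup X] [NormedSpace ℝ X]
    [CompleteSpace X] {T : X → X} (hT : ContDiff ℝ ∞ T) {c : ℝ≥0} (hc : c < 1)
    (hL : LipschitzWith c T) :
    ∃ S : X → X, ContDiff ℝ ∞ S ∧ ∀ x, S x - T (S x) = x := by
  -- The identity has norm one only on a nontrivial space.
  rcases subsingleton_or_nontrivial X with hX | hX
  · exact ⟨id, contDiff_id, fun x ↦ Subsingleton.elim _ _⟩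
  have happ : ApproximatesLinearOn (fun x ↦ x - T x)
      ((ContinuousLinearEquiv.refl ℝ X : X ≃L[ℝ] X) : X →L[ℝ] X) univ c := by
    intro x _ y _
    have h1 : x - T x - (y - T y) - (ContinuousLinearEquiv.refl ℝ X : X →L[ℝ] X) (x - y)
        = T y - T x := by simp; abel
    rw [h1, ← dist_eq_norm, ← dist_eq_norm, dist_comm x y]
    exact hL.dist_le_mul y x
  have hc' : Subsingleton X ∨
      c < ‖((ContinuousLinearEquiv.refl ℝ X).symm : X →L[ℝ] X)‖₊⁻¹ := by
    right
    have : ‖((ContinuousLinearEquiv.refl ℝ X).symm : X →L[ℝ] X)‖₊ = 1 := by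
      apply NNReal.eq
      exact ContinuousLinearMap.norm_id
    rw [this, inv_one]
    exact hc
  let e := happ.toHomeomorph _ hc'
  have he : ∀ x, e x = x - T x := fun x ↦ rfl
  have hsmall : ∀ x, ‖fderiv ℝ T x‖ < 1 := fun x ↦
    (norm_fderiv_le_of_lipschitz ℝ hL).trans_lt (by exact_mod_cast hc)
  -- The derivative `1 - DT` is invertible by the Neumann series, which is what smoothness of the
  -- inverse requires.
  have hd : ∀ x, HasFDerivAt e
      ((ContinuousLinearEquiv.ofUnit (Units.oneSub (fderiv ℝ T x) (hsmall x)) : X ≃L[ℝ] X) :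
        X →L[ℝ] X) x := fun x ↦
    (hasFDerivAt_id x).sub ((hT.differentiable (by simp)).differentiableAt.hasFDerivAt)
  refine ⟨e.symm, e.contDiff_symm hd (contDiff_id.sub hT), fun x ↦ ?_⟩
  rw [← he, e.apply_symm_apply]

/-- The integral equation reads `y - T y = const`, where `T y` is the primitive of `G ∘ y`. For `ε *
K < 1` the map `T` is a smooth contraction, so the solution path is a smooth function of the
constant, that is, of the initial value. -/
theorem exists_flow_of_lipschitzWith {G : E → E} (hG : ContDiff ℝ ∞ G) {K : ℝ≥0}
    (hK : LipschitzWith K G) :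
    ∃ ε > 0, ∃ Φ : ℝ → E → E, (∀ τ, ContDiff ℝ ∞ (Φ τ)) ∧ (∀ y, Φ 0 y = y) ∧
      ∀ y, ∀ τ ∈ Ioo (-ε) ε, HasDerivAt (fun s ↦ Φ s y) (G (Φ τ y)) τ := by
  obtain ⟨ε, hε, hεK⟩ : ∃ ε : ℝ, 0 < ε ∧ ε * K < 1 :=
    ⟨1 / (K + 1), by positivity, by
      rw [one_div, inv_mul_lt_iff₀ (by positivity)]; linarith⟩
  have hε' : -ε ≤ ε := by linarith
  let GC : C(E, E) := ⟨G, hG.continuous⟩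
  let T : C(Icc (-ε) ε, E) → C(Icc (-ε) ε, E) := fun y ↦ primitiveCLM E hε' (GC.comp y)
  have hTs : ContDiff ℝ ∞ T :=
    (primitiveCLM E hε').contDiff.comp (contDiff_continuousMap_comp GC hG)
  have hTL : LipschitzWith (⟨ε, hε.le⟩ * K) T := by
    refine ((primitiveCLM E hε').lipschitz.weaken
      (show ‖primitiveCLM E hε'‖₊ ≤ ⟨ε, hε.le⟩ from norm_primitiveCLM_le hε')).comp ?_
    refine LipschitzWith.of_dist_le_mul fun y z ↦ ?_
    rw [ContinuousMap.dist_le (by positivity)]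
    intro k
    exact (hK.dist_le_mul _ _).trans
      (mul_le_mul_of_nonneg_left (ContinuousMap.dist_apply_le_dist k) K.2)
  obtain ⟨S, hS, hSe⟩ := exists_contDiff_inverse_id_sub hTs (c := ⟨ε, hε.le⟩ * K)
    (by exact_mod_cast hεK) hTL
  have hS2 : ∀ (z : C(Icc (-ε) ε, E)) (t : Icc (-ε) ε),
      S z t = z t + ∫ s in (0 : ℝ)..t, G (S z (projIcc _ _ hε' s)) := by
    intro z t
    have := congrArg (fun f : C(Icc (-ε) ε, E) ↦ f t) (hSe z)
    simp only [ContinuousMap.sub_apply] at this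
    rw [sub_eq_iff_eq_add] at this
    exact this
  refine ⟨ε, hε, fun τ y ↦ S (ContinuousMap.const _ y) (projIcc _ _ hε' τ), ?_, ?_, ?_⟩
  · intro τ
    have h1 : ContDiff ℝ ∞ (fun y : E ↦ S (ContinuousMap.const (Icc (-ε) ε) y)) :=
      hS.comp (LinearMap.mkContinuous (𝕜 := ℝ) (𝕜₂ := ℝ)
        { toFun := ContinuousMap.const (Icc (-ε) ε)
          map_add' := fun _ _ ↦ rfl
          map_smul' := fun _ _ ↦ rfl } 1 (fun u ↦ by
            rw [one_mul, ContinuousMap.norm_le _ (norm_nonneg u)]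
            exact fun _ ↦ le_rfl)).contDiff
    exact (ContinuousMap.evalCLM ℝ (projIcc _ _ hε' τ)).contDiff.comp h1
  · intro y
    have h0 : (projIcc _ _ hε' 0 : Icc (-ε) ε) = ⟨0, by constructor <;> linarith⟩ :=
      projIcc_of_mem _ _
    simp only
    rw [hS2, h0]
    simp
  · intro y τ hτ
    have hcont : Continuous fun s ↦ G (S (ContinuousMap.const _ y) (projIcc _ _ hε' s)) :=
      hG.continuous.comp ((S (ContinuousMap.const _ y)).continuous.comp continuous_projIcc)
    have hd : HasDerivAt (fun t ↦ y + ∫ s in (0 : ℝ)..t,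
        G (S (ContinuousMap.const _ y) (projIcc _ _ hε' s)))
        (G (S (ContinuousMap.const _ y) (projIcc _ _ hε' τ))) τ :=
      (hcont.integral_hasStrictDerivAt 0 τ).hasDerivAt.const_add y
    refine hd.congr_of_eventuallyEq ?_
    filter_upwards [isOpen_Ioo.mem_nhds hτ] with t ht
    rw [hS2, projIcc_of_mem hε' (Ioo_subset_Icc_self ht)]
    rfl

/-- A cutoff makes the field globally Lipschitz. On short time intervals trajectories that start
near `y₁` stay where the cutoff equals one, so they solve the original equation. -/
theorem exists_local_flow [FiniteDimensional ℝ E] {G : E → E} {U : Set E} (hU : IsOpen U)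
    (hG : ContDiffOn ℝ ∞ G U) {y₁ : E} (hy₁ : y₁ ∈ U) :
    ∃ ε > 0, ∃ B ∈ 𝓝 y₁, ∃ Φ : ℝ → E → E, (∀ τ, ContDiff ℝ ∞ (Φ τ)) ∧ (∀ y, Φ 0 y = y) ∧
      ∀ y ∈ B, ∀ τ ∈ Ioo (-ε) ε, Φ τ y ∈ U ∧ HasDerivAt (fun s ↦ Φ s y) (G (Φ τ y)) τ := by
  obtain ⟨δ, hδ, hδU⟩ := Metric.isOpen_iff.1 hU y₁ hy₁
  let ρ : ContDiffBump y₁ := ⟨δ / 3, δ / 2, by positivity, by linarith⟩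
  let G₁ : E → E := fun y ↦ ρ y • G y
  have hsupp : tsupport G₁ ⊆ Metric.closedBall y₁ (δ / 2) := by
    have h1 : tsupport G₁ ⊆ tsupport ρ := closure_mono (Function.support_smul_subset_left _ _)
    rwa [ρ.tsupport_eq] at h1
  have hcs : HasCompactSupport G₁ := (isCompact_closedBall _ _).of_isClosed_subset
    (isClosed_tsupport _) hsupp
  have hG₁ : ContDiff ℝ ∞ G₁ := by
    rw [← contMDiff_iff_contDiff]
    refine contMDiff_of_tsupport fun y hy ↦ contMDiffAt_iff_contDiffAt.2 ?_
    have hyU : y ∈ U := hδU (Metric.closedBall_subset_ball (by linarith) (hsupp hy))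
    exact ρ.contDiffAt.smul (hG.contDiffAt (hU.mem_nhds hyU))
  obtain ⟨K, hK⟩ := hG₁.lipschitzWith_of_hasCompactSupport hcs (by simp)
  obtain ⟨C, hC⟩ := hcs.exists_bound_of_continuous hG₁.continuous
  have hC0 : 0 ≤ C := (norm_nonneg _).trans (hC y₁)
  obtain ⟨ε₀, hε₀, Φ, hΦ, hΦ0, hΦd⟩ := exists_flow_of_lipschitzWith hG₁ hK
  -- A start within `δ / 6` and a drift of at most `δ / 6` keep the trajectory within `δ / 3`, the
  -- inner radius of the bump. The `C + 1` in the witness allows `C = 0`.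
  obtain ⟨ε, hε, hεε, hεC⟩ : ∃ ε : ℝ, 0 < ε ∧ ε ≤ ε₀ ∧ C * ε ≤ δ / 6 := by
    refine ⟨min ε₀ (δ / (6 * (C + 1))), by positivity, min_le_left _ _, ?_⟩
    calc C * min ε₀ (δ / (6 * (C + 1))) ≤ (C + 1) * (δ / (6 * (C + 1))) :=
          mul_le_mul (by linarith) (min_le_right _ _) (by positivity) (by positivity)
      _ = δ / 6 := by field_simp
  refine ⟨ε, hε, Metric.ball y₁ (δ / 6), Metric.ball_mem_nhds _ (by positivity), Φ, hΦ, hΦ0,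
    fun y hy τ hτ ↦ ?_⟩
  have hsub : ∀ s ∈ Ioo (-ε) ε, s ∈ Ioo (-ε₀) ε₀ := fun s hs ↦
    ⟨by linarith [hs.1], by linarith [hs.2]⟩
  have h1 := (convex_Ioo (-ε) ε).norm_image_sub_le_of_norm_hasDerivWithin_le
    (f := fun s ↦ Φ s y) (f' := fun s ↦ G₁ (Φ s y)) (C := C)
    (fun s hs ↦ (hΦd y s (hsub s hs)).hasDerivWithinAt) (fun s _ ↦ hC _)
    (show (0 : ℝ) ∈ Ioo (-ε) ε by constructor <;> linarith) hτ
  rw [hΦ0, sub_zero] at h1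
  have h2 : ‖τ‖ ≤ ε := abs_le.2 ⟨hτ.1.le, hτ.2.le⟩
  have h3 : Φ τ y ∈ Metric.ball y₁ (δ / 3) := by
    rw [mem_ball_iff_norm] at hy ⊢
    calc ‖Φ τ y - y₁‖ = ‖(Φ τ y - y) + (y - y₁)‖ := by congr 1; abel
      _ ≤ ‖Φ τ y - y‖ + ‖y - y₁‖ := norm_add_le _ _
      _ < δ / 6 + δ / 6 := by
        have := h1.trans ((mul_le_mul_of_nonneg_left h2 hC0).trans hεC)
        linarith
      _ = δ / 3 := by ring
  refine ⟨hδU (Metric.ball_subset_ball (by linarith) h3), ?_⟩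
  have h4 := hΦd y τ (hsub τ hτ)
  have h5 : G₁ (Φ τ y) = G (Φ τ y) := by
    simp only [G₁]
    rw [ρ.one_of_mem_closedBall (Metric.ball_subset_closedBall h3), one_smul]
  rwa [h5] at h4

/-- Linear differential equations are solvable on short intervals, whose length does not depend on
the initial value. -/
theorem exists_linear_ode_solution {A : ℝ → E →L[ℝ] E} {a b : ℝ} {K : ℝ}
    (hA : ContinuousOn A (Icc a b)) (hAK : ∀ t ∈ Icc a b, ‖A t‖ ≤ K) (hab : 4 * K * (b - a) ≤ 1)
    {t₀ : ℝ} (ht₀ : t₀ ∈ Icc a b) (w : E) :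
    ∃ y : ℝ → E, y t₀ = w ∧ ∀ t ∈ Ioo a b, HasDerivAt y (A t (y t)) t := by
  have hK : 0 ≤ K := (norm_nonneg _).trans (hAK t₀ ht₀)
  -- On the ball of radius `‖w‖ + 1` about `w` the speed is at most `K * (2 * ‖w‖ + 1)`. Ball and
  -- speed both scale with `w`, so the admissible time depends on `K` only.
  have hPL : IsPicardLindelof (fun t y ↦ A t y) (tmin := a) (tmax := b) ⟨t₀, ht₀⟩ w
      (‖w‖₊ + 1) 0 (K.toNNReal * (2 * ‖w‖₊ + 1)) K.toNNReal := by
    refine ⟨fun t ht ↦ ?_, fun y _ ↦ hA.clm_apply continuousOn_const, fun t ht y hy ↦ ?_, ?_⟩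
    · exact ((A t).lipschitz.weaken (show ‖A t‖₊ ≤ K.toNNReal from NNReal.coe_le_coe.1 (by
        rw [Real.coe_toNNReal _ hK]; exact hAK t ht))).lipschitzOnWith
    · have h1 : ‖y‖ ≤ 2 * ‖w‖ + 1 := by
        rw [mem_closedBall_iff_norm] at hy
        have h2 : ‖y‖ ≤ ‖w‖ + ‖y - w‖ := by
          simpa using norm_add_le w (y - w)
        have h3 : ((‖w‖₊ + 1 : ℝ≥0) : ℝ) = ‖w‖ + 1 := by simp
        rw [h3] at hy
        linarith
      calc ‖A t y‖ ≤ K * (2 * ‖w‖ + 1) := (A t).le_of_opNorm_le_of_le (hAK t ht) h1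
        _ = _ := by simp [hK]
    · have h1 : max (b - t₀) (t₀ - a) ≤ b - a :=
        max_le (by linarith [ht₀.1]) (by linarith [ht₀.2])
      have h2 : K * (2 * ‖w‖ + 1) * max (b - t₀) (t₀ - a) ≤ ‖w‖ + 1 := by
        calc K * (2 * ‖w‖ + 1) * max (b - t₀) (t₀ - a)
            ≤ K * (2 * ‖w‖ + 1) * (b - a) := by gcongr
          _ = (4 * K * (b - a)) * ((2 * ‖w‖ + 1) / 4) := by ring
          _ ≤ 1 * ((2 * ‖w‖ + 1) / 4) := by gcongr
          _ ≤ ‖w‖ + 1 := by linarith [norm_nonneg w]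
      simpa [hK] using h2
  obtain ⟨y, hy0, hy⟩ := hPL.exists_eq_forall_mem_Icc_hasDerivWithinAt₀
  exact ⟨y, hy0, fun t ht ↦ (hy t (Ioo_subset_Icc_self ht)).hasDerivAt (Icc_mem_nhds ht.1 ht.2)⟩

end Flow

/-! ### Derivatives of charts -/

section Charts

variable {E : Type*} [NormedAddCommGroup E] [NormedSpace ℝ E]
  {M : Type*} [TopologicalSpace M] [ChartedSpace E M]

/-- The derivative at `q` of the chart around `p`. -/
def chartDeriv (p q : M) : E →L[ℝ] E := mfderiv 𝓘(ℝ, E) 𝓘(ℝ, E) (extChartAt 𝓘(ℝ, E) p) q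

/-- The derivative of the inverse of the chart around `p`. -/
def chartDerivSymm (p : M) (u : E) : E →L[ℝ] E :=
  mfderiv 𝓘(ℝ, E) 𝓘(ℝ, E) (extChartAt 𝓘(ℝ, E) p).symm u

theorem mem_chartAt_source_iff {p q : M} :
    q ∈ (chartAt E p).source ↔ q ∈ (extChartAt 𝓘(ℝ, E) p).source := by
  rw [extChartAt_source]

theorem isOpen_chart_target (p : M) : IsOpen (extChartAt 𝓘(ℝ, E) p).target :=
  isOpen_extChartAt_target p

variable [IsManifold 𝓘(ℝ, E) ∞ M]

theorem chartDeriv_chartDerivSymm {p : M} {u : E} (hu : u ∈ (extChartAt 𝓘(ℝ, E) p).target)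
    (a : E) : chartDeriv p ((extChartAt 𝓘(ℝ, E) p).symm u) (chartDerivSymm p u a) = a := by
  have h := mfderiv_extChartAt_comp_mfderivWithin_extChartAt_symm (I := 𝓘(ℝ, E)) hu
  rw [modelWithCornersSelf_coe, range_id, mfderivWithin_univ] at h
  exact congrArg (fun f : E →L[ℝ] E ↦ f a) h

theorem chartDerivSymm_chartDeriv {p q : M} (hq : q ∈ (extChartAt 𝓘(ℝ, E) p).source)
    (a : E) : chartDerivSymm p (extChartAt 𝓘(ℝ, E) p q) (chartDeriv p q a) = a := by
  have h := mfderivWithin_extChartAt_symm_comp_mfderiv_extChartAt' (I := 𝓘(ℝ, E)) hq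
  rw [modelWithCornersSelf_coe, range_id, mfderivWithin_univ] at h
  exact congrArg (fun f : E →L[ℝ] E ↦ f a) h

theorem chartDeriv_chartDerivSymm' {p q : M} (hq : q ∈ (extChartAt 𝓘(ℝ, E) p).source)
    (a : E) : chartDeriv p q (chartDerivSymm p (extChartAt 𝓘(ℝ, E) p q) a) = a := by
  have h := chartDeriv_chartDerivSymm ((extChartAt 𝓘(ℝ, E) p).map_source hq) a
  rwa [(extChartAt 𝓘(ℝ, E) p).left_inv hq] at h

theorem chartDeriv_injective {p q : M} (hq : q ∈ (extChartAt 𝓘(ℝ, E) p).source) :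
    Function.Injective (chartDeriv (E := E) p q) :=
  Function.LeftInverse.injective (g := chartDerivSymm p (extChartAt 𝓘(ℝ, E) p q))
    (chartDerivSymm_chartDeriv hq)

theorem chartDeriv_self (p : M) : chartDeriv (E := E) p p = ContinuousLinearMap.id ℝ E :=
  mfderiv_extChartAt_self

theorem hasMFDerivAt_chart {p q : M} (hq : q ∈ (extChartAt 𝓘(ℝ, E) p).source) :
    HasMFDerivAt 𝓘(ℝ, E) 𝓘(ℝ, E) (extChartAt 𝓘(ℝ, E) p) q (chartDeriv (E := E) p q) :=
  (mdifferentiableAt_extChartAt (mem_chartAt_source_iff.2 hq)).hasMFDerivAt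

theorem contMDiffAt_chart {p q : M} (hq : q ∈ (extChartAt 𝓘(ℝ, E) p).source) :
    ContMDiffAt 𝓘(ℝ, E) 𝓘(ℝ, E) ∞ (extChartAt 𝓘(ℝ, E) p) q :=
  contMDiffAt_extChartAt' (mem_chartAt_source_iff.2 hq)

theorem contMDiffAt_chart_symm {p : M} {u : E} (hu : u ∈ (extChartAt 𝓘(ℝ, E) p).target) :
    ContMDiffAt 𝓘(ℝ, E) 𝓘(ℝ, E) ∞ (extChartAt 𝓘(ℝ, E) p).symm u :=
  (contMDiffOn_extChartAt_symm p).contMDiffAt ((isOpen_chart_target p).mem_nhds hu)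

theorem hasMFDerivAt_chart_symm {p : M} {u : E} (hu : u ∈ (extChartAt 𝓘(ℝ, E) p).target) :
    HasMFDerivAt 𝓘(ℝ, E) 𝓘(ℝ, E) (extChartAt 𝓘(ℝ, E) p).symm u
      (chartDerivSymm (E := E) p u) :=
  ((contMDiffAt_chart_symm hu).mdifferentiableAt (by simp)).hasMFDerivAt

/-- The fibre coordinate of the trivialization of the tangent bundle around `p`. -/
theorem trivializationAt_tangent_snd {p q : M} (hq : q ∈ (extChartAt 𝓘(ℝ, E) p).source) (a : E) :
    (trivializationAt E (TangentSpace 𝓘(ℝ, E)) p (⟨q, a⟩ : TangentBundle 𝓘(ℝ, E) M)).2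
      = chartDeriv p q a := by
  have h := TangentBundle.continuousLinearMapAt_trivializationAt (I := 𝓘(ℝ, E))
    (mem_chartAt_source_iff.2 hq)
  have h2 := congrArg (fun f : E →L[ℝ] E ↦ f a) h
  refine Eq.trans ?_ h2
  have hb : q ∈ (trivializationAt E (TangentSpace 𝓘(ℝ, E)) p).baseSet := by
    rw [TangentBundle.trivializationAt_baseSet]; exact mem_chartAt_source_iff.2 hq
  exact (congrFun (Trivialization.coe_linearMapAt_of_mem (R := ℝ)
    (trivializationAt E (TangentSpace 𝓘(ℝ, E)) p) hb) a).symm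

variable {P : Type*} [NormedAddCommGroup P] [NormedSpace ℝ P]

/-- The family of tangent vectors `V z ∈ T_{q z} M` depends smoothly on the parameter near `z₀`. -/
def SmoothFamilyAt (q : P → M) (V : P → E) (z₀ : P) : Prop :=
  ContMDiffAt 𝓘(ℝ, P) 𝓘(ℝ, E) ∞ q z₀ ∧
    ContDiffAt ℝ ∞ (fun z ↦ chartDeriv (q z₀) (q z) (V z)) z₀

theorem smoothFamilyAt_iff_tangentBundle {q : P → M} {V : P → E} {z₀ : P} {p : M}
    (hp : q z₀ ∈ (extChartAt 𝓘(ℝ, E) p).source) :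
    ContMDiffAt 𝓘(ℝ, P) 𝓘(ℝ, E).tangent ∞ (fun z ↦ (⟨q z, V z⟩ : TangentBundle 𝓘(ℝ, E) M)) z₀ ↔
    ContMDiffAt 𝓘(ℝ, P) 𝓘(ℝ, E) ∞ q z₀ ∧ ContDiffAt ℝ ∞ (fun z ↦ chartDeriv p (q z) (V z)) z₀ := by
  have he : (⟨q z₀, V z₀⟩ : TangentBundle 𝓘(ℝ, E) M) ∈
      (trivializationAt E (TangentSpace 𝓘(ℝ, E)) p).source := by
    rw [TangentBundle.trivializationAt_source]; exact mem_chartAt_source_iff.2 hp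
  refine (Trivialization.contMDiffAt_iff (IM := 𝓘(ℝ, P)) (IB := 𝓘(ℝ, E)) (n := ∞)
    (f := fun z ↦ (⟨q z, V z⟩ : TangentBundle 𝓘(ℝ, E) M)) he).trans ?_
  refine and_congr_right fun hq ↦ ?_
  rw [contMDiffAt_iff_contDiffAt]
  have heq : (fun z ↦ (trivializationAt E (TangentSpace 𝓘(ℝ, E)) p
      (⟨q z, V z⟩ : TangentBundle 𝓘(ℝ, E) M)).2) =ᶠ[𝓝 z₀] fun z ↦ chartDeriv p (q z) (V z) := by
    filter_upwards [hq.continuousAt.preimage_mem_nhds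
      ((isOpen_extChartAt_source (I := 𝓘(ℝ, E)) p).mem_nhds hp)] with z hz
    exact trivializationAt_tangent_snd hz (V z)
  exact ⟨fun h ↦ h.congr_of_eventuallyEq heq.symm, fun h ↦ h.congr_of_eventuallyEq heq⟩

/-- Smoothness as a map into the tangent bundle does not depend on a chart, so any chart around `q
z₀` can serve as a test. -/
theorem smoothFamilyAt_iff {q : P → M} {V : P → E} {z₀ : P} {p : M}
    (hp : q z₀ ∈ (extChartAt 𝓘(ℝ, E) p).source) :
    SmoothFamilyAt q V z₀ ↔
    ContMDiffAt 𝓘(ℝ, P) 𝓘(ℝ, E) ∞ q z₀ ∧ ContDiffAt ℝ ∞ (fun z ↦ chartDeriv p (q z) (V z)) z₀ :=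
  (smoothFamilyAt_iff_tangentBundle (mem_extChartAt_source (I := 𝓘(ℝ, E)) (q z₀))).symm.trans
    (smoothFamilyAt_iff_tangentBundle hp)

theorem smoothFamilyAt_chart_symm_const {p : M} {u : E} (hu : u ∈ (extChartAt 𝓘(ℝ, E) p).target)
    (a : E) : SmoothFamilyAt (extChartAt 𝓘(ℝ, E) p).symm (fun y ↦ chartDerivSymm p y a) u := by
  rw [smoothFamilyAt_iff ((extChartAt 𝓘(ℝ, E) p).map_target hu)]
  refine ⟨contMDiffAt_chart_symm hu, contDiffAt_const.congr_of_eventuallyEq (f := fun _ ↦ a) ?_⟩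
  filter_upwards [(isOpen_chart_target p).mem_nhds hu] with y hy
  exact chartDeriv_chartDerivSymm hy a

end Charts

/-! ### The metric in charts -/

section Metric

variable {E : Type*} [NormedAddCommGroup E] [NormedSpace ℝ E]
  {M : Type*} [TopologicalSpace M] [ChartedSpace E M] [IsManifold 𝓘(ℝ, E) ∞ M]
  (g : SmoothMetric E M)

theorem metricInner_comm (p : M) (a b : E) : metricInner g p a b = metricInner g p b a :=
  g.symm p a b

theorem metricInner_pos (p : M) {a : E} (ha : a ≠ 0) : 0 < metricInner g p a a := g.pos p a ha

/-- The metric at a point as a continuous bilinear form. -/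
def metricForm (p : M) : E →L[ℝ] E →L[ℝ] ℝ := g.inner p

theorem metricForm_apply (p : M) (a b : E) : metricForm g p a b = metricInner g p a b := rfl

theorem chartMetric_apply (p : M) (u a b : E) :
    chartMetric g p u a b = metricInner g ((extChartAt 𝓘(ℝ, E) p).symm u)
      (chartDerivSymm p u a) (chartDerivSymm p u b) := rfl

theorem metricInner_eq_chartMetric {p q : M} (hq : q ∈ (extChartAt 𝓘(ℝ, E) p).source) (a b : E) :
    metricInner g q a b =
      chartMetric g p (extChartAt 𝓘(ℝ, E) p q) (chartDeriv p q a) (chartDeriv p q b) := by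
  rw [chartMetric_apply, chartDerivSymm_chartDeriv hq, chartDerivSymm_chartDeriv hq,
    (extChartAt 𝓘(ℝ, E) p).left_inv hq]

theorem chartMetric_comm (p : M) (u a b : E) : chartMetric g p u a b = chartMetric g p u b a := by
  rw [chartMetric_apply, chartMetric_apply, metricInner_comm]

theorem chartMetric_pos {p : M} {u : E} (hu : u ∈ (extChartAt 𝓘(ℝ, E) p).target) {a : E}
    (ha : a ≠ 0) : 0 < chartMetric g p u a a := by
  rw [chartMetric_apply]
  refine metricInner_pos g _ fun h ↦ ha ?_
  rw [← chartDeriv_chartDerivSymm hu a, h, map_zero]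

variable {P : Type*} [NormedAddCommGroup P] [NormedSpace ℝ P]

theorem SmoothFamilyAt.metricInner {q : P → M} {V W : P → E} {z₀ : P} (hV : SmoothFamilyAt q V z₀)
    (hW : SmoothFamilyAt q W z₀) :
    ContDiffAt ℝ ∞ (fun z ↦ metricInner g (q z) (V z) (W z)) z₀ := by
  have hs := mem_extChartAt_source (I := 𝓘(ℝ, E)) (q z₀)
  have h1 := (smoothFamilyAt_iff_tangentBundle hs).2 ((smoothFamilyAt_iff hs).1 hV)
  have h2 := (smoothFamilyAt_iff_tangentBundle hs).2 ((smoothFamilyAt_iff hs).1 hW)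
  have h3 := g.contMDiff.contMDiffAt.comp z₀ hV.1
  have h4 := ContMDiffAt.clm_bundle_apply₂ (F₁ := E) (F₂ := E) (F₃ := ℝ)
    (E₁ := fun p : M ↦ TangentSpace 𝓘(ℝ, E) p) (E₂ := fun p : M ↦ TangentSpace 𝓘(ℝ, E) p)
    (E₃ := Bundle.Trivial M ℝ) (b := q) (ψ := fun z ↦ g.inner (q z))
    (v := V) (w := W) h3 h1 h2
  rw [← contMDiffAt_iff_contDiffAt]
  exact (contMDiffAt_totalSpace.1 h4).2

variable [FiniteDimensional ℝ E]

theorem contDiffOn_chartMetric (p : M) :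
    ContDiffOn ℝ ∞ (chartMetric g p) (extChartAt 𝓘(ℝ, E) p).target := by
  rw [contDiffOn_clm_apply]
  intro a
  rw [contDiffOn_clm_apply]
  intro b u hu
  exact ((smoothFamilyAt_chart_symm_const hu a).metricInner g
    (smoothFamilyAt_chart_symm_const hu b)).contDiffWithinAt

end Metric

/-! ### Christoffel symbols -/

section Christoffel

variable {E : Type*} [NormedAddCommGroup E] [NormedSpace ℝ E]
  {M : Type*} [TopologicalSpace M] [ChartedSpace E M] [IsManifold 𝓘(ℝ, E) ∞ M]
  (g : SmoothMetric E M)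

/-- The Christoffel symbols of the first kind as a continuous bilinear map. -/
def christoffelLowerBilin (p : M) (u : E) : E →L[ℝ] E →L[ℝ] E →L[ℝ] ℝ :=
  (1 / 2 : ℝ) • (fderiv ℝ (chartMetric g p) u + (fderiv ℝ (chartMetric g p) u).flip
    - (ContinuousLinearMap.flipₗᵢ ℝ E E ℝ : (E →L[ℝ] E →L[ℝ] ℝ) →L[ℝ] (E →L[ℝ] E →L[ℝ] ℝ)).comp
        (fderiv ℝ (chartMetric g p) u).flip)

/-- The Christoffel symbols as a continuous bilinear map. -/
def christoffelBilin (p : M) (u : E) : E →L[ℝ] E →L[ℝ] E :=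
  (ContinuousLinearMap.compL ℝ E (E →L[ℝ] ℝ) E (chartMetric g p u).inverse).comp
    (christoffelLowerBilin g p u)

theorem christoffelBilin_apply (p : M) (u a b : E) :
    christoffelBilin g p u a b = christoffel g p u a b := rfl

theorem christoffelLower_apply (p : M) (u a b c : E) :
    christoffelLower g p u a b c = (1 / 2 : ℝ) * (fderiv ℝ (chartMetric g p) u a b c
      + fderiv ℝ (chartMetric g p) u b a c - fderiv ℝ (chartMetric g p) u c a b) := rfl

variable [FiniteDimensional ℝ E] {p : M} {u : E}

theorem isInvertible_chartMetric (hu : u ∈ (extChartAt 𝓘(ℝ, E) p).target) :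
    (chartMetric g p u).IsInvertible := by
  have hinj : Function.Injective (chartMetric g p u : E →ₗ[ℝ] E →L[ℝ] ℝ) := by
    rw [← LinearMap.ker_eq_bot, LinearMap.ker_eq_bot']
    intro a ha
    by_contra h
    have h1 : chartMetric g p u a a = 0 := congrArg (fun f : E →L[ℝ] ℝ ↦ f a) ha
    exact (chartMetric_pos g hu h).ne' h1
  have hrank : Module.finrank ℝ E = Module.finrank ℝ (E →L[ℝ] ℝ) := by
    rw [← LinearMap.toContinuousLinearMap.finrank_eq]
    exact (Subspace.dual_finrank_eq (K := ℝ) (V := E)).symm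
  exact ⟨(LinearEquiv.ofInjectiveOfFinrankEq (chartMetric g p u : E →ₗ[ℝ] E →L[ℝ] ℝ) hinj
    hrank).toContinuousLinearEquiv, by ext; rfl⟩

theorem differentiableAt_chartMetric (hu : u ∈ (extChartAt 𝓘(ℝ, E) p).target) :
    DifferentiableAt ℝ (chartMetric g p) u :=
  ((contDiffOn_chartMetric g p).contDiffAt ((isOpen_chart_target p).mem_nhds hu)).differentiableAt
    (by simp)

set_option synthInstance.maxHeartbeats 200000 in
theorem contDiffOn_christoffelBilin (p : M) :
    ContDiffOn ℝ ∞ (christoffelBilin g p) (extChartAt 𝓘(ℝ, E) p).target := by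
  have hg := contDiffOn_chartMetric g p
  have hd : ContDiffOn ℝ ∞ (fderiv ℝ (chartMetric g p)) (extChartAt 𝓘(ℝ, E) p).target :=
    hg.fderiv_of_isOpen (isOpen_chart_target p) (by simp)
  have hf : ContDiffOn ℝ ∞ (fun u ↦ (fderiv ℝ (chartMetric g p) u).flip)
      (extChartAt 𝓘(ℝ, E) p).target :=
    (ContinuousLinearMap.flipₗᵢ ℝ E E (E →L[ℝ] ℝ)).contDiff.comp_contDiffOn hd
  have hl : ContDiffOn ℝ ∞ (christoffelLowerBilin g p) (extChartAt 𝓘(ℝ, E) p).target :=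
    ((hd.add hf).sub (contDiffOn_const.clm_comp hf)).const_smul _
  have hi : ContDiffOn ℝ ∞ (fun u ↦ (chartMetric g p u).inverse)
      (extChartAt 𝓘(ℝ, E) p).target := by
    intro u hu
    obtain ⟨e, he⟩ := isInvertible_chartMetric g hu
    have h1 : ContDiffAt ℝ ∞ ContinuousLinearMap.inverse (chartMetric g p u) :=
      he ▸ contDiffAt_map_inverse e
    exact h1.comp_contDiffWithinAt u (hg u hu)
  exact ((ContinuousLinearMap.compL ℝ E (E →L[ℝ] ℝ) E).contDiff.comp_contDiffOn hi).clm_comp hl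

theorem chartMetric_christoffel (hu : u ∈ (extChartAt 𝓘(ℝ, E) p).target) (a b c : E) :
    chartMetric g p u (christoffel g p u a b) c = (1 / 2 : ℝ) * (fderiv ℝ (chartMetric g p) u a b c
      + fderiv ℝ (chartMetric g p) u b a c - fderiv ℝ (chartMetric g p) u c a b) := by
  rw [← christoffelLower_apply]
  have h := (isInvertible_chartMetric g hu).inverse_apply_eq
    (x := christoffel g p u a b) (y := christoffelLower g p u a b)
  rw [← h.1 rfl]

omit [FiniteDimensional ℝ E] in
theorem eq_of_chartMetric_eq (hu : u ∈ (extChartAt 𝓘(ℝ, E) p).target) {a b : E}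
    (h : ∀ c, chartMetric g p u a c = chartMetric g p u b c) : a = b := by
  by_contra hab
  have h1 := chartMetric_pos g hu (sub_ne_zero.2 hab)
  rw [(chartMetric g p u).map_sub, sub_apply, h, sub_self] at h1
  exact lt_irrefl _ h1

theorem fderiv_chartMetric_comm (hu : u ∈ (extChartAt 𝓘(ℝ, E) p).target) (e a b : E) :
    fderiv ℝ (chartMetric g p) u e a b = fderiv ℝ (chartMetric g p) u e b a := by
  have hd := (differentiableAt_chartMetric g hu).hasFDerivAt
  have h1 := (hd.clm_apply (hasFDerivAt_const a u)).clm_apply (hasFDerivAt_const b u)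
  have h2 := (hd.clm_apply (hasFDerivAt_const b u)).clm_apply (hasFDerivAt_const a u)
  have h3 : (fun y ↦ chartMetric g p y a b) = fun y ↦ chartMetric g p y b a :=
    funext fun y ↦ chartMetric_comm g p y a b
  rw [h3] at h1
  simpa using congrArg (fun f : E →L[ℝ] ℝ ↦ f e) (h1.unique h2)

theorem christoffel_comm (hu : u ∈ (extChartAt 𝓘(ℝ, E) p).target) (a b : E) :
    christoffel g p u a b = christoffel g p u b a := by
  refine eq_of_chartMetric_eq g hu fun c ↦ ?_
  rw [chartMetric_christoffel g hu, chartMetric_christoffel g hu,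
    fderiv_chartMetric_comm g hu c a b]
  ring

/-- Metric compatibility of the Levi-Civita connection: adding the two Koszul formulas cancels all
derivatives of the metric except the one in direction `e`. -/
theorem fderiv_chartMetric_eq (hu : u ∈ (extChartAt 𝓘(ℝ, E) p).target) (e a b : E) :
    fderiv ℝ (chartMetric g p) u e a b = chartMetric g p u (christoffel g p u e a) b
      + chartMetric g p u a (christoffel g p u e b) := by
  rw [chartMetric_comm g p u a, chartMetric_christoffel g hu, chartMetric_christoffel g hu,
    fderiv_chartMetric_comm g hu b e a, fderiv_chartMetric_comm g hu a e b,
    fderiv_chartMetric_comm g hu e b a]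
  ring

/-! ### Changes of coordinates and the transformation of Christoffel symbols -/

/-- The change of coordinates from the chart around `p` to the chart around `p'`. -/
def chartTransition (p p' : M) (u : E) : E :=
  extChartAt 𝓘(ℝ, E) p' ((extChartAt 𝓘(ℝ, E) p).symm u)

omit [FiniteDimensional ℝ E] in
theorem contDiffAt_chartTransition {p' : M} (hu : u ∈ (extChartAt 𝓘(ℝ, E) p).target)
    (hu' : (extChartAt 𝓘(ℝ, E) p).symm u ∈ (extChartAt 𝓘(ℝ, E) p').source) :
    ContDiffAt ℝ ∞ (chartTransition p p') u := by
  rw [← contMDiffAt_iff_contDiffAt]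
  exact (contMDiffAt_chart hu').comp u (contMDiffAt_chart_symm hu)

omit [FiniteDimensional ℝ E] in
theorem hasFDerivAt_chartTransition {p' : M} (hu : u ∈ (extChartAt 𝓘(ℝ, E) p).target)
    (hu' : (extChartAt 𝓘(ℝ, E) p).symm u ∈ (extChartAt 𝓘(ℝ, E) p').source) :
    HasFDerivAt (chartTransition (E := E) p p')
      ((chartDeriv p' ((extChartAt 𝓘(ℝ, E) p).symm u)).comp (chartDerivSymm p u)) u := by
  exact HasMFDerivAt.hasFDerivAt ((hasMFDerivAt_chart hu').comp u (hasMFDerivAt_chart_symm hu))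

omit [FiniteDimensional ℝ E] in
theorem eventually_mem_transition_domain {p' : M} (hu : u ∈ (extChartAt 𝓘(ℝ, E) p).target)
    (hu' : (extChartAt 𝓘(ℝ, E) p).symm u ∈ (extChartAt 𝓘(ℝ, E) p').source) :
    ∀ᶠ y in 𝓝 u, y ∈ (extChartAt 𝓘(ℝ, E) p).target ∧
      (extChartAt 𝓘(ℝ, E) p).symm y ∈ (extChartAt 𝓘(ℝ, E) p').source :=
  ((isOpen_chart_target p).eventually_mem hu).and
    ((contMDiffAt_chart_symm hu).continuousAt.eventually
      ((isOpen_extChartAt_source (I := 𝓘(ℝ, E)) p').eventually_mem hu'))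

omit [FiniteDimensional ℝ E] in
theorem chartMetric_eq_chartTransition {p' : M} (hu : u ∈ (extChartAt 𝓘(ℝ, E) p).target)
    (hu' : (extChartAt 𝓘(ℝ, E) p).symm u ∈ (extChartAt 𝓘(ℝ, E) p').source) (a b : E) :
    chartMetric g p u a b = chartMetric g p' (chartTransition p p' u)
      (fderiv ℝ (chartTransition p p') u a) (fderiv ℝ (chartTransition p p') u b) := by
  rw [(hasFDerivAt_chartTransition hu hu').fderiv, chartMetric_apply,
    metricInner_eq_chartMetric g hu']
  rfl

/-- The transformation law of the Christoffel symbols. -/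
theorem christoffel_transformation {p' : M} (hu : u ∈ (extChartAt 𝓘(ℝ, E) p).target)
    (hu' : (extChartAt 𝓘(ℝ, E) p).symm u ∈ (extChartAt 𝓘(ℝ, E) p').source) (a b : E) :
    fderiv ℝ (chartTransition p p') u (christoffel g p u a b) =
      christoffel g p' (chartTransition p p' u) (fderiv ℝ (chartTransition p p') u a)
        (fderiv ℝ (chartTransition p p') u b)
      + fderiv ℝ (fderiv ℝ (chartTransition p p')) u a b := by
  set ψ : E → E := chartTransition p p' with hψ
  have hψu : ψ u ∈ (extChartAt 𝓘(ℝ, E) p').target := (extChartAt 𝓘(ℝ, E) p').map_source hu'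
  have hs := contDiffAt_chartTransition hu hu'
  have hd1 : HasFDerivAt ψ (fderiv ℝ ψ u) u := (hs.differentiableAt (by simp)).hasFDerivAt
  have hd2 : HasFDerivAt (fderiv ℝ ψ) (fderiv ℝ (fderiv ℝ ψ) u) u :=
    ((hs.fderiv_right (m := ∞) (by simp)).differentiableAt (by simp)).hasFDerivAt
  have hsymm : ∀ a b, fderiv ℝ (fderiv ℝ ψ) u a b = fderiv ℝ (fderiv ℝ ψ) u b a :=
    (hs.isSymmSndFDerivAt (by
      rw [minSmoothness_of_isRCLikeNormedField]; exact WithTop.coe_le_coe.2 le_top)).eq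
  -- The derivative of the identity saying that the metric in the first chart is the pullback of the
  -- metric in the second.
  have key : ∀ e a b, fderiv ℝ (chartMetric g p) u e a b =
      fderiv ℝ (chartMetric g p') (ψ u) (fderiv ℝ ψ u e) (fderiv ℝ ψ u a) (fderiv ℝ ψ u b)
      + chartMetric g p' (ψ u) (fderiv ℝ (fderiv ℝ ψ) u e a) (fderiv ℝ ψ u b)
      + chartMetric g p' (ψ u) (fderiv ℝ ψ u a) (fderiv ℝ (fderiv ℝ ψ) u e b) := by
    intro e a b
    have hl := (((differentiableAt_chartMetric g hu).hasFDerivAt).clm_apply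
      (hasFDerivAt_const a u)).clm_apply (hasFDerivAt_const b u)
    have hr := ((((differentiableAt_chartMetric g hψu).hasFDerivAt).comp u hd1).clm_apply
      (hd2.clm_apply (hasFDerivAt_const a u))).clm_apply (hd2.clm_apply (hasFDerivAt_const b u))
    have hr' := hr.congr_of_eventuallyEq (f₁ := fun y ↦ chartMetric g p y a b) (by
      filter_upwards [eventually_mem_transition_domain hu hu'] with y hy
      exact chartMetric_eq_chartTransition g hy.1 hy.2 a b)
    have h := congrArg (fun f : E →L[ℝ] ℝ ↦ f e) (hl.unique hr')
    simp at h
    rw [h]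
    ring
  have hsurj : ∀ c', ∃ c, fderiv ℝ ψ u c = c' := by
    intro c'
    rw [hψ, (hasFDerivAt_chartTransition hu hu').fderiv]
    refine ⟨chartDeriv p ((extChartAt 𝓘(ℝ, E) p).symm u)
      (chartDerivSymm p' (extChartAt 𝓘(ℝ, E) p' ((extChartAt 𝓘(ℝ, E) p).symm u)) c'), ?_⟩
    have h1 := chartDerivSymm_chartDeriv ((extChartAt 𝓘(ℝ, E) p).map_target hu)
      (chartDerivSymm p' (extChartAt 𝓘(ℝ, E) p' ((extChartAt 𝓘(ℝ, E) p).symm u)) c')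
    rw [(extChartAt 𝓘(ℝ, E) p).right_inv hu] at h1
    rw [ContinuousLinearMap.comp_apply, h1, chartDeriv_chartDerivSymm' hu']
  -- Nondegeneracy reduces the law to inner products with vectors `Dψ c`. In the Koszul combination
  -- of `key` the second derivatives of `ψ` cancel, except for the pairing of `D²ψ(a, b)` with `Dψ
  -- c`.
  refine eq_of_chartMetric_eq g hψu fun c' ↦ ?_
  obtain ⟨c, rfl⟩ := hsurj c'
  rw [map_add, add_apply, chartMetric_christoffel g hψu,
    ← chartMetric_eq_chartTransition g hu hu', chartMetric_christoffel g hu, key, key, key,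
    hsymm b a, hsymm c a, hsymm c b, chartMetric_comm g p' (ψ u) (fderiv ℝ ψ u b)]
  rw [chartMetric_comm g p' (ψ u) (fderiv ℝ ψ u a)]
  ring

end Christoffel

/-! ### Parallel transport -/

section Parallel

variable {E : Type*} [NormedAddCommGroup E] [NormedSpace ℝ E]
  {M : Type*} [TopologicalSpace M] [ChartedSpace E M] [IsManifold 𝓘(ℝ, E) ∞ M]
  (g : SmoothMetric E M) {γ : ℝ → M} {p : M} {t : ℝ}

theorem ContDiffAt.deriv_infty {F : Type*} [NormedAddCommGroup F] [NormedSpace ℝ F] {f : ℝ → F}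
    {t : ℝ} (hf : ContDiffAt ℝ ∞ f t) : ContDiffAt ℝ ∞ (deriv f) t :=
  (hf.fderiv_right (m := ∞) (by simp)).clm_apply contDiffAt_const

omit [IsManifold 𝓘(ℝ, E) ∞ M] in
theorem chartField_apply (p : M) (γ : ℝ → M) (W : ℝ → E) (t : ℝ) :
    chartField p γ W t = chartDeriv p (γ t) (W t) := rfl

omit [IsManifold 𝓘(ℝ, E) ∞ M] in
theorem eventually_mem_chart_source (hγ : ContMDiffAt 𝓘(ℝ, ℝ) 𝓘(ℝ, E) ∞ γ t)
    (hp : γ t ∈ (extChartAt 𝓘(ℝ, E) p).source) :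
    ∀ᶠ s in 𝓝 t, γ s ∈ (extChartAt 𝓘(ℝ, E) p).source :=
  hγ.continuousAt.eventually ((isOpen_extChartAt_source (I := 𝓘(ℝ, E)) p).eventually_mem hp)

theorem hasDerivAt_chartCurve (hγ : ContMDiffAt 𝓘(ℝ, ℝ) 𝓘(ℝ, E) ∞ γ t)
    (hp : γ t ∈ (extChartAt 𝓘(ℝ, E) p).source) :
    HasDerivAt (chartCurve p γ) (chartDeriv p (γ t) (velocity (E := E) γ t)) t := by
  have h := (hasMFDerivAt_chart hp).comp t (hγ.mdifferentiableAt (by simp)).hasMFDerivAt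
  let L : ℝ →L[ℝ] E := mfderiv 𝓘(ℝ, ℝ) 𝓘(ℝ, E) γ t
  have h' : HasFDerivAt (chartCurve p γ) ((chartDeriv (E := E) p (γ t)).comp L) t :=
    HasMFDerivAt.hasFDerivAt h
  exact h'.hasDerivAt

theorem contDiffAt_chartCurve (hγ : ContMDiffAt 𝓘(ℝ, ℝ) 𝓘(ℝ, E) ∞ γ t)
    (hp : γ t ∈ (extChartAt 𝓘(ℝ, E) p).source) : ContDiffAt ℝ ∞ (chartCurve (E := E) p γ) t :=
  contMDiffAt_iff_contDiffAt.1 ((contMDiffAt_chart hp).comp t hγ)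

theorem deriv_chartCurve (hγ : ContMDiffAt 𝓘(ℝ, ℝ) 𝓘(ℝ, E) ∞ γ t)
    (hp : γ t ∈ (extChartAt 𝓘(ℝ, E) p).source) :
    deriv (chartCurve p γ) t = chartField (E := E) p γ (velocity γ) t :=
  (hasDerivAt_chartCurve hγ hp).deriv

/-- The vector field `W` along `γ` satisfies `∇_{γ'} W = 0` at time `t`. -/
def IsParallelAt (γ : ℝ → M) (W : ℝ → E) (t : ℝ) : Prop :=
  ∀ p : M, γ t ∈ (extChartAt 𝓘(ℝ, E) p).source →
    HasDerivAt (chartField p γ W)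
      (- christoffel g p (chartCurve p γ t) (deriv (chartCurve p γ) t) (chartField p γ W t)) t

theorem isParallelAlong_iff {W : ℝ → E} :
    IsParallelAlong g γ W ↔ ∀ t, IsParallelAt g γ W t := forall_comm

theorem IsParallelAt.congr {W W' : ℝ → E} (hW : IsParallelAt g γ W t) (h : W' =ᶠ[𝓝 t] W) :
    IsParallelAt g γ W' t := by
  intro p hp
  have h1 : chartField p γ W' =ᶠ[𝓝 t] chartField p γ W := by
    filter_upwards [h] with s hs
    rw [chartField_apply, chartField_apply, hs]
  have h2 := (hW p hp).congr_of_eventuallyEq h1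
  rwa [← h1.self_of_nhds] at h2

theorem IsParallelAt.add {V W : ℝ → E} (hV : IsParallelAt g γ V t) (hW : IsParallelAt g γ W t) :
    IsParallelAt g γ (fun s ↦ V s + W s) t := by
  intro p hp
  have h := (hV p hp).add (hW p hp)
  have he : chartField p γ (fun s ↦ V s + W s) = chartField p γ V + chartField p γ W := by
    ext s; simp [chartField_apply]
  rw [he]
  convert! h using 1
  rw [← christoffelBilin_apply, ← christoffelBilin_apply, ← christoffelBilin_apply, Pi.add_apply,
    map_add, neg_add]

theorem IsParallelAt.const_smul {W : ℝ → E} (c : ℝ) (hW : IsParallelAt g γ W t) :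
    IsParallelAt g γ (fun s ↦ c • W s) t := by
  intro p hp
  have h := (hW p hp).const_smul c
  have he : chartField p γ (fun s ↦ c • W s) = c • chartField p γ W := by
    ext s; simp [chartField_apply]
  rw [he]
  convert! h using 1
  rw [← christoffelBilin_apply, ← christoffelBilin_apply, Pi.smul_apply, map_smul, smul_neg]

theorem isParallelAt_velocity (hγ : IsGeodesic g γ) (t : ℝ) :
    IsParallelAt g γ (velocity γ) t := by
  intro p hp
  have h1 : deriv (chartCurve (E := E) p γ) =ᶠ[𝓝 t] chartField p γ (velocity γ) := by
    filter_upwards [eventually_mem_chart_source hγ.1.contMDiffAt hp] with s hs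
    exact deriv_chartCurve hγ.1.contMDiffAt hs
  have h2 := (contDiffAt_chartCurve hγ.1.contMDiffAt hp).deriv_infty
  have h3 := (h2.differentiableAt (by simp)).hasDerivAt
  rw [hγ.2 p t hp] at h3
  have h4 := h3.congr_of_eventuallyEq h1.symm
  rwa [h1.self_of_nhds] at h4 ⊢

variable [FiniteDimensional ℝ E]

theorem hasDerivAt_metricInner {V W : ℝ → E} (hγ : ContMDiffAt 𝓘(ℝ, ℝ) 𝓘(ℝ, E) ∞ γ t)
    (hV : IsParallelAt g γ V t) (hW : IsParallelAt g γ W t) :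
    HasDerivAt (fun s ↦ metricInner g (γ s) (V s) (W s)) 0 t := by
  have hp : γ t ∈ (extChartAt 𝓘(ℝ, E) (γ t)).source := mem_extChartAt_source _
  have hu : chartCurve (γ t) γ t ∈ (extChartAt 𝓘(ℝ, E) (γ t)).target :=
    (extChartAt 𝓘(ℝ, E) (γ t)).map_source hp
  have hc := (contDiffAt_chartCurve hγ hp).differentiableAt (by simp) |>.hasDerivAt
  have h1 := (((differentiableAt_chartMetric g hu).hasFDerivAt.comp_hasDerivAt t hc).clm_apply
    (hV _ hp)).clm_apply (hW _ hp)
  refine (h1.congr_of_eventuallyEq (f₁ := fun s ↦ metricInner g (γ s) (V s) (W s)) ?_).congr_deriv ?_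
  · filter_upwards [eventually_mem_chart_source hγ hp] with s hs
    exact metricInner_eq_chartMetric g hs _ _
  · simp only [add_apply, Function.comp_apply, fderiv_chartMetric_eq g hu, map_neg, neg_apply]
    ring

theorem metricInner_eq_of_isParallelAt {V W : ℝ → E} (hγ : ContMDiff 𝓘(ℝ, ℝ) 𝓘(ℝ, E) ∞ γ)
    {O : Set ℝ} (hO : IsOpen O) (hO' : IsPreconnected O) (hV : ∀ t ∈ O, IsParallelAt g γ V t)
    (hW : ∀ t ∈ O, IsParallelAt g γ W t) {s t : ℝ} (hs : s ∈ O) (ht : t ∈ O) :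
    metricInner g (γ s) (V s) (W s) = metricInner g (γ t) (V t) (W t) := by
  have hd : ∀ t ∈ O, HasDerivAt (fun s ↦ metricInner g (γ s) (V s) (W s)) 0 t := fun t ht ↦
    hasDerivAt_metricInner g hγ.contMDiffAt (hV t ht) (hW t ht)
  exact hO.is_const_of_deriv_eq_zero hO'
    (fun t ht ↦ (hd t ht).differentiableAt.differentiableWithinAt) (fun t ht ↦ (hd t ht).deriv)
    hs ht

/-- The difference of two parallel fields is parallel, so its length is constant. Uniqueness thus
follows from the metric alone. -/
theorem eq_of_isParallelAt {V W : ℝ → E} (hγ : ContMDiff 𝓘(ℝ, ℝ) 𝓘(ℝ, E) ∞ γ)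
    {O : Set ℝ} (hO : IsOpen O) (hO' : IsPreconnected O) (hV : ∀ t ∈ O, IsParallelAt g γ V t)
    (hW : ∀ t ∈ O, IsParallelAt g γ W t) {s t : ℝ} (hs : s ∈ O) (ht : t ∈ O) (h : V s = W s) :
    V t = W t := by
  have hD : ∀ t ∈ O, IsParallelAt g γ (fun s ↦ V s + (-1 : ℝ) • W s) t := fun t ht ↦
    (hV t ht).add g ((hW t ht).const_smul g _)
  have h1 := metricInner_eq_of_isParallelAt g hγ hO hO' hD hD hs ht
  by_contra hne
  have h2 : V t + (-1 : ℝ) • W t ≠ 0 := by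
    rw [neg_one_smul, ← sub_eq_add_neg]; exact sub_ne_zero.2 hne
  have h3 := metricInner_pos g (γ t) h2
  have h4 : V s + (-1 : ℝ) • W s = 0 := by rw [h]; simp
  rw [← h1] at h3
  simp only [h4] at h3
  rw [← metricForm_apply] at h3
  simp at h3

/-- Parallelism can be tested in one chart. -/
theorem isParallelAt_of_chart {W : ℝ → E} (hγ : ContMDiffAt 𝓘(ℝ, ℝ) 𝓘(ℝ, E) ∞ γ t)
    (hp : γ t ∈ (extChartAt 𝓘(ℝ, E) p).source)
    (h : HasDerivAt (chartField p γ W)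
      (- christoffel g p (chartCurve p γ t) (deriv (chartCurve p γ) t) (chartField p γ W t)) t) :
    IsParallelAt g γ W t := by
  intro p' hp'
  have hu : chartCurve p γ t ∈ (extChartAt 𝓘(ℝ, E) p).target :=
    (extChartAt 𝓘(ℝ, E) p).map_source hp
  have hsymm : ∀ {s : ℝ}, γ s ∈ (extChartAt 𝓘(ℝ, E) p).source →
      (extChartAt 𝓘(ℝ, E) p).symm (chartCurve p γ s) = γ s := fun hs ↦
    (extChartAt 𝓘(ℝ, E) p).left_inv hs
  have hu' : (extChartAt 𝓘(ℝ, E) p).symm (chartCurve p γ t) ∈ (extChartAt 𝓘(ℝ, E) p').source := by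
    rwa [hsymm hp]
  have hψ : ∀ {s : ℝ}, γ s ∈ (extChartAt 𝓘(ℝ, E) p).source → γ s ∈ (extChartAt 𝓘(ℝ, E) p').source →
      ∀ a : E, fderiv ℝ (chartTransition p p') (chartCurve p γ s) (chartDeriv (E := E) p (γ s) a)
        = chartDeriv p' (γ s) a := by
    intro s hs hs' a
    have h1 : chartCurve p γ s ∈ (extChartAt 𝓘(ℝ, E) p).target :=
      (extChartAt 𝓘(ℝ, E) p).map_source hs
    have h2 : (extChartAt 𝓘(ℝ, E) p).symm (chartCurve p γ s) ∈
        (extChartAt 𝓘(ℝ, E) p').source := by rwa [hsymm hs]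
    rw [(hasFDerivAt_chartTransition h1 h2).fderiv, ContinuousLinearMap.comp_apply, hsymm hs]
    exact congrArg _ (chartDerivSymm_chartDeriv hs a)
  have hs := contDiffAt_chartTransition hu hu'
  have hd2 : HasFDerivAt (fderiv ℝ (chartTransition (E := E) p p'))
      (fderiv ℝ (fderiv ℝ (chartTransition p p')) (chartCurve p γ t)) (chartCurve p γ t) :=
    ((hs.fderiv_right (m := ∞) (by simp)).differentiableAt (by simp)).hasFDerivAt
  have hc := (contDiffAt_chartCurve hγ hp).differentiableAt (by simp) |>.hasDerivAt
  have hd := (hd2.comp_hasDerivAt t hc).clm_apply h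
  have hev : chartField p' γ W =ᶠ[𝓝 t]
      fun s ↦ fderiv ℝ (chartTransition p p') (chartCurve p γ s) (chartField p γ W s) := by
    filter_upwards [eventually_mem_chart_source hγ hp, eventually_mem_chart_source hγ hp']
      with s h1 h2
    exact (hψ h1 h2 _).symm
  refine (hd.congr_of_eventuallyEq hev).congr_deriv ?_
  have ht : chartTransition p p' (chartCurve p γ t) = chartCurve (E := E) p' γ t := by
    unfold chartTransition; rw [hsymm hp]; rfl
  have hv : fderiv ℝ (chartTransition (E := E) p p') (chartCurve p γ t) (deriv (chartCurve p γ) t)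
      = deriv (chartCurve (E := E) p' γ) t := by
    rw [deriv_chartCurve hγ hp, deriv_chartCurve hγ hp']
    exact hψ hp hp' _
  have hw : fderiv ℝ (chartTransition p p') (chartCurve p γ t) (chartField p γ W t)
      = chartField p' γ W t := hψ hp hp' _
  -- The product rule has produced a term with the second derivative of the transition map, and the
  -- transformation law cancels it.
  rw [Function.comp_apply, map_neg, christoffel_transformation g hu hu', ht, hv, hw]
  abel

/-- The equation is linear in the chart, so `ε` can be chosen before the initial time `t` and the
initial vector `w`. This uniformity is what makes the solutions continuable. -/
theorem exists_isParallelAt_local (hγ : ContMDiff 𝓘(ℝ, ℝ) 𝓘(ℝ, E) ∞ γ) (t₁ : ℝ) :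
    ∃ ε > 0, ∀ t ∈ Ioo (t₁ - ε) (t₁ + ε), ∀ w : E,
      ∃ W : ℝ → E, W t = w ∧ ∀ s ∈ Ioo (t₁ - ε) (t₁ + ε), IsParallelAt g γ W s := by
  set p := γ t₁ with hpdef
  have hp : γ t₁ ∈ (extChartAt 𝓘(ℝ, E) p).source := mem_extChartAt_source _
  let A : ℝ → E →L[ℝ] E := fun s ↦
    -(christoffelBilin g p (chartCurve p γ s) (deriv (chartCurve p γ) s))
  have hA : ∀ s, γ s ∈ (extChartAt 𝓘(ℝ, E) p).source → ContinuousAt A s := by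
    intro s hs
    have hc := contDiffAt_chartCurve hγ.contMDiffAt hs
    have hc' := hc.deriv_infty.continuousAt
    have hΓ : ContinuousAt (christoffelBilin g p) (chartCurve p γ s) :=
      (contDiffOn_christoffelBilin g p).continuousOn.continuousAt
        ((isOpen_chart_target p).mem_nhds ((extChartAt 𝓘(ℝ, E) p).map_source hs))
    exact ((hΓ.comp hc.continuousAt).clm_apply hc').neg
  have hb : ∀ᶠ s in 𝓝 t₁, ‖A s‖ < ‖A t₁‖ + 1 :=
    (hA t₁ hp).norm.eventually (eventually_lt_nhds (lt_add_one _))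
  obtain ⟨δ, hδ, hδs⟩ := Metric.eventually_nhds_iff.1
    (hb.and (eventually_mem_chart_source (hγ.contMDiffAt (x := t₁)) hp))
  set K := ‖A t₁‖ + 1 with hK
  have hKpos : 0 < K := by positivity
  -- The interval has length `2 * ε`, whence `8` in place of the `4` of
  -- `exists_linear_ode_solution`.
  obtain ⟨ε, hε, hεδ, hεK⟩ : ∃ ε : ℝ, 0 < ε ∧ ε < δ ∧ 8 * K * ε ≤ 1 := by
    refine ⟨min (δ / 2) (1 / (8 * K)), by positivity, (min_le_left _ _).trans_lt (by linarith), ?_⟩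
    calc 8 * K * min (δ / 2) (1 / (8 * K)) ≤ 8 * K * (1 / (8 * K)) := by
          gcongr; exact min_le_right _ _
      _ = 1 := by field_simp
  have hin : ∀ s ∈ Icc (t₁ - ε) (t₁ + ε), dist s t₁ < δ := by
    intro s hs
    rw [Real.dist_eq]
    exact (abs_le.2 ⟨by linarith [hs.1], by linarith [hs.2]⟩).trans_lt hεδ
  refine ⟨ε, hε, fun t ht w ↦ ?_⟩
  obtain ⟨y, hy0, hy⟩ := exists_linear_ode_solution (A := A) (a := t₁ - ε) (b := t₁ + ε) (K := K)
    (fun s hs ↦ (hA s (hδs (hin s hs)).2).continuousWithinAt) (fun s hs ↦ (hδs (hin s hs)).1.le)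
    (by linarith) (Ioo_subset_Icc_self ht) (chartDeriv p (γ t) w)
  refine ⟨fun s ↦ chartDerivSymm p (chartCurve p γ s) (y s), ?_, fun s hs ↦ ?_⟩
  · simp only [hy0]
    exact chartDerivSymm_chartDeriv (hδs (hin t (Ioo_subset_Icc_self ht))).2 w
  · have hev : chartField p γ (fun s ↦ chartDerivSymm p (chartCurve p γ s) (y s)) =ᶠ[𝓝 s] y := by
      filter_upwards [isOpen_Ioo.mem_nhds hs] with s' hs'
      exact chartDeriv_chartDerivSymm' (hδs (hin s' (Ioo_subset_Icc_self hs'))).2 _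
    refine isParallelAt_of_chart g hγ.contMDiffAt (hδs (hin s (Ioo_subset_Icc_self hs))).2 ?_
    have h1 := (hy s hs).congr_of_eventuallyEq hev
    rw [hev.self_of_nhds]
    exact h1

/-- The set where `Q` holds is open and closed in the line. Letting both `t` and `s` range over the
same neighbourhood of `t₁` gives both properties at once. -/
theorem forall_of_locally_propagates {Q : ℝ → Prop} (h0 : Q 0)
    (h : ∀ t₁, ∃ ε > 0, ∀ t ∈ Ioo (t₁ - ε) (t₁ + ε), ∀ s ∈ Ioo (t₁ - ε) (t₁ + ε), Q t → Q s)
    (t : ℝ) : Q t := by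
  have hc : IsClopen {t | Q t} := by
    constructor
    · rw [← isOpen_compl_iff, isOpen_iff_mem_nhds]
      intro t ht
      obtain ⟨ε, hε, hQ⟩ := h t
      filter_upwards [Ioo_mem_nhds (show t - ε < t by linarith) (show t < t + ε by linarith)]
        with s hs hs'
      exact ht (hQ s hs t ⟨by linarith, by linarith⟩ hs')
    · rw [isOpen_iff_mem_nhds]
      intro t ht
      obtain ⟨ε, hε, hQ⟩ := h t
      filter_upwards [Ioo_mem_nhds (show t - ε < t by linarith) (show t < t + ε by linarith)]
        with s hs
      exact hQ t ⟨by linarith, by linarith⟩ s hs ht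
  exact (hc.eq_univ ⟨0, h0⟩).ge (mem_univ t)

theorem exists_isParallelAlong (hγ : ContMDiff 𝓘(ℝ, ℝ) 𝓘(ℝ, E) ∞ γ) (w : E) :
    ∃ W : ℝ → E, IsParallelAlong g γ W ∧ W 0 = w := by
  -- Order-connected domains have connected intersections, on which uniqueness forces two solutions
  -- to agree. This permits gluing.
  have key : ∀ t : ℝ, ∃ (O : Set ℝ) (W : ℝ → E), IsOpen O ∧ O.OrdConnected ∧ 0 ∈ O ∧ t ∈ O ∧
      W 0 = w ∧ ∀ s ∈ O, IsParallelAt g γ W s := by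
    refine forall_of_locally_propagates ?_ fun t₁ ↦ ?_
    · obtain ⟨ε, hε, h⟩ := exists_isParallelAt_local g hγ 0
      have h0 : (0 : ℝ) ∈ Ioo (0 - ε) (0 + ε) := ⟨by linarith, by linarith⟩
      obtain ⟨W, hW0, hW⟩ := h 0 h0 w
      exact ⟨_, W, isOpen_Ioo, ordConnected_Ioo, h0, h0, hW0, hW⟩
    · obtain ⟨ε, hε, h⟩ := exists_isParallelAt_local g hγ t₁
      refine ⟨ε, hε, fun t ht s hs ⟨O, W, hO, hOc, h0, htO, hW0, hW⟩ ↦ ?_⟩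
      obtain ⟨V, hVt, hV⟩ := h t ht (W t)
      classical
      have hVW : ∀ s ∈ O ∩ Ioo (t₁ - ε) (t₁ + ε), W s = V s := fun s hs ↦
        eq_of_isParallelAt g hγ (hO.inter isOpen_Ioo) (hOc.inter ordConnected_Ioo).isPreconnected
          (fun t ht ↦ hW t ht.1) (fun t ht ↦ hV t ht.2) ⟨htO, ht⟩ hs hVt.symm
      refine ⟨O ∪ Ioo (t₁ - ε) (t₁ + ε), fun s ↦ if s ∈ O then W s else V s,
        hO.union isOpen_Ioo, ?_, Or.inl h0, Or.inr hs, by simp [h0, hW0], ?_⟩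
      · exact (hOc.isPreconnected.union t htO ht ordConnected_Ioo.isPreconnected).ordConnected
      · rintro s (hs | hs)
        · refine (hW s hs).congr g ?_
          filter_upwards [hO.mem_nhds hs] with s' hs'
          simp [hs']
        · refine (hV s hs).congr g ?_
          filter_upwards [isOpen_Ioo.mem_nhds hs] with s' hs'
          by_cases h' : s' ∈ O
          · simp [h', hVW s' ⟨h', hs'⟩]
          · simp [h']
  choose O W hO hOc h0 ht hW0 hW using key
  -- The diagonal field agrees near `t` with the single solution `W t`, because all solutions share
  -- the value `w` at `0`.
  refine ⟨fun t ↦ W t t, (isParallelAlong_iff g).2 fun t ↦ ?_, hW0 0⟩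
  refine (hW t t (ht t)).congr g ?_
  filter_upwards [(hO t).mem_nhds (ht t)] with s hs
  exact eq_of_isParallelAt g hγ ((hO s).inter (hO t)) ((hOc s).inter (hOc t)).isPreconnected
    (fun r hr ↦ hW s r hr.1) (fun r hr ↦ hW t r hr.2) ⟨h0 s, h0 t⟩ ⟨ht s, hs⟩
    ((hW0 s).trans (hW0 t).symm)

theorem parallelTransport_spec (hγ : ContMDiff 𝓘(ℝ, ℝ) 𝓘(ℝ, E) ∞ γ) (w : E) :
    IsParallelAlong g γ (parallelTransport g γ w) ∧ parallelTransport g γ w 0 = w := by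
  have h := exists_isParallelAlong g hγ w
  have he : parallelTransport g γ w = h.choose := by
    ext t; rw [parallelTransport, dif_pos h]
  rw [he]
  exact h.choose_spec

theorem eq_parallelTransport (hγ : ContMDiff 𝓘(ℝ, ℝ) 𝓘(ℝ, E) ∞ γ) {W : ℝ → E}
    (hW : IsParallelAlong g γ W) (t : ℝ) : W t = parallelTransport g γ (W 0) t :=
  eq_of_isParallelAt g hγ isOpen_univ isPreconnected_univ
    (fun t _ ↦ (isParallelAlong_iff g).1 hW t)
    (fun t _ ↦ (isParallelAlong_iff g).1 (parallelTransport_spec g hγ (W 0)).1 t)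
    (mem_univ 0) (mem_univ t) (parallelTransport_spec g hγ (W 0)).2.symm

theorem parallelTransport_add (hγ : ContMDiff 𝓘(ℝ, ℝ) 𝓘(ℝ, E) ∞ γ) (v w : E) (t : ℝ) :
    parallelTransport g γ (v + w) t = parallelTransport g γ v t + parallelTransport g γ w t := by
  obtain ⟨hv, hv0⟩ := parallelTransport_spec g hγ v
  obtain ⟨hw, hw0⟩ := parallelTransport_spec g hγ w
  have h := eq_parallelTransport g hγ ((isParallelAlong_iff g).2 fun t ↦
    ((isParallelAlong_iff g).1 hv t).add g ((isParallelAlong_iff g).1 hw t)) t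
  rw [h, hv0, hw0]

theorem parallelTransport_smul (hγ : ContMDiff 𝓘(ℝ, ℝ) 𝓘(ℝ, E) ∞ γ) (c : ℝ) (w : E) (t : ℝ) :
    parallelTransport g γ (c • w) t = c • parallelTransport g γ w t := by
  obtain ⟨hw, hw0⟩ := parallelTransport_spec g hγ w
  have h := eq_parallelTransport g hγ ((isParallelAlong_iff g).2 fun t ↦
    ((isParallelAlong_iff g).1 hw t).const_smul g c) t
  rw [h, hw0]

theorem metricInner_parallelTransport (hγ : ContMDiff 𝓘(ℝ, ℝ) 𝓘(ℝ, E) ∞ γ) (v w : E) (t : ℝ) :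
    metricInner g (γ t) (parallelTransport g γ v t) (parallelTransport g γ w t)
      = metricInner g (γ 0) v w := by
  obtain ⟨hv, hv0⟩ := parallelTransport_spec g hγ v
  obtain ⟨hw, hw0⟩ := parallelTransport_spec g hγ w
  have h := metricInner_eq_of_isParallelAt g hγ isOpen_univ isPreconnected_univ
    (fun t _ ↦ (isParallelAlong_iff g).1 hv t) (fun t _ ↦ (isParallelAlong_iff g).1 hw t)
    (mem_univ t) (mem_univ 0)
  rw [h, hv0, hw0]

theorem velocity_eq_parallelTransport (hγ : IsGeodesic g γ) (t : ℝ) :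
    velocity γ t = parallelTransport g γ (velocity γ 0) t :=
  eq_parallelTransport g hγ.1 ((isParallelAlong_iff g).2 (isParallelAt_velocity g hγ)) t

end Parallel

/-! ### The geodesic flow -/

section GeodesicFlow

variable {E : Type*} [NormedAddCommGroup E] [NormedSpace ℝ E]
  {M : Type*} [TopologicalSpace M] [ChartedSpace E M]

/-- The coordinates of a curve, its velocity and a vector field along it. -/
def chartState (p : M) (γ : ℝ → M) (W : ℝ → E) (t : ℝ) : E × E × E :=
  (chartCurve p γ t, chartField p γ (velocity γ) t, chartField p γ W t)

variable [IsManifold 𝓘(ℝ, E) ∞ M] (g : SmoothMetric E M)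

/-- The vector field of the differential equation for geodesics and parallel fields along them, in
the chart around `p`. -/
def geodesicField (p : M) (y : E × E × E) : E × E × E :=
  (y.2.1, -christoffelBilin g p y.1 y.2.1 y.2.1, -christoffelBilin g p y.1 y.2.1 y.2.2)

variable {γ η : ℝ → M} {p : M} {t : ℝ}

theorem hasDerivAt_chartState {W : ℝ → E} (hγ : IsGeodesic g γ) (hW : IsParallelAlong g γ W)
    (hp : γ t ∈ (extChartAt 𝓘(ℝ, E) p).source) :
    HasDerivAt (chartState p γ W) (geodesicField g p (chartState p γ W t)) t := by
  have h1 := hasDerivAt_chartCurve hγ.1.contMDiffAt hp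
  have h2 := isParallelAt_velocity g hγ t p hp
  have h3 := hW p t hp
  rw [deriv_chartCurve hγ.1.contMDiffAt hp] at h2 h3
  exact h1.prodMk (h2.prodMk h3)

variable [FiniteDimensional ℝ E]

theorem contDiffOn_geodesicField (p : M) :
    ContDiffOn ℝ ∞ (geodesicField g p) {y | y.1 ∈ (extChartAt 𝓘(ℝ, E) p).target} := by
  have hΓ : ContDiffOn ℝ ∞ (fun y : E × E × E ↦ christoffelBilin g p y.1)
      {y | y.1 ∈ (extChartAt 𝓘(ℝ, E) p).target} :=
    (contDiffOn_christoffelBilin g p).comp contDiffOn_fst fun y hy ↦ hy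
  have h1 : ContDiffOn ℝ ∞ (fun y : E × E × E ↦ y.2.1)
      {y | y.1 ∈ (extChartAt 𝓘(ℝ, E) p).target} := (contDiff_fst.comp contDiff_snd).contDiffOn
  have h2 : ContDiffOn ℝ ∞ (fun y : E × E × E ↦ y.2.2)
      {y | y.1 ∈ (extChartAt 𝓘(ℝ, E) p).target} := (contDiff_snd.comp contDiff_snd).contDiffOn
  exact h1.prodMk (((hΓ.clm_apply h1).clm_apply h1).neg.prodMk ((hΓ.clm_apply h1).clm_apply h2).neg)

omit [IsManifold 𝓘(ℝ, E) ∞ M] [FiniteDimensional ℝ E] in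
theorem isOpen_geodesicField_domain (p : M) :
    IsOpen {y : E × E × E | y.1 ∈ (extChartAt 𝓘(ℝ, E) p).target} :=
  (isOpen_chart_target p).preimage continuous_fst

variable [T2Space M]

/-- Near a given initial state, all geodesics and all parallel fields along them are described by
one smooth local flow in the chart. -/
theorem exists_chart_flow (p : M) {y₁ : E × E × E} (hy₁ : y₁.1 ∈ (extChartAt 𝓘(ℝ, E) p).target) :
    ∃ ε > 0, ∃ B ∈ 𝓝 y₁, ∃ Φ : ℝ → E × E × E → E × E × E, (∀ τ, ContDiff ℝ ∞ (Φ τ)) ∧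
      ∀ (γ : ℝ → M) (W : ℝ → E) (t : ℝ), IsGeodesic g γ → IsParallelAlong g γ W →
        γ t ∈ (extChartAt 𝓘(ℝ, E) p).source → chartState p γ W t ∈ B →
        ∀ τ ∈ Ioo (-ε) ε, γ (t + τ) ∈ (extChartAt 𝓘(ℝ, E) p).source ∧
          chartState p γ W (t + τ) = Φ τ (chartState p γ W t) := by
  obtain ⟨ε, hε, B, hB, Φ, hΦ, hΦ0, hΦd⟩ := exists_local_flow (isOpen_geodesicField_domain p)
    (contDiffOn_geodesicField g p) hy₁
  refine ⟨ε, hε, B, hB, Φ, hΦ, fun γ W t hγ hW ht hy ↦ ?_⟩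
  set y := chartState p γ W t with hydef
  have hst : ∀ τ, γ (t + τ) ∈ (extChartAt 𝓘(ℝ, E) p).source →
      HasDerivAt (fun τ ↦ chartState p γ W (t + τ))
        (geodesicField g p (chartState p γ W (t + τ))) τ := fun τ hτ ↦
    (hasDerivAt_chartState g hγ hW hτ).comp_const_add t τ
  have hγc : ∀ τ, ContinuousAt (fun τ ↦ γ (t + τ)) τ := fun τ ↦
    (hγ.1.continuous.comp (continuous_const.add continuous_id)).continuousAt
  -- A connectedness argument: `u` is open by local uniqueness for Lipschitz equations and
  -- relatively closed in the interval, so it is the whole interval.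
  let u : Set ℝ := {τ | τ ∈ Ioo (-ε) ε ∧ γ (t + τ) ∈ (extChartAt 𝓘(ℝ, E) p).source ∧
    chartState p γ W (t + τ) = Φ τ y}
  have hsrc : IsOpen (extChartAt 𝓘(ℝ, E) p).source := isOpen_extChartAt_source p
  have hu : IsOpen u := by
    rw [isOpen_iff_mem_nhds]
    rintro τ ⟨hτ, hτs, hτe⟩
    have hmem := (hΦd y hy τ hτ).1
    obtain ⟨K, s, hs, hK⟩ := (((contDiffOn_geodesicField g p).contDiffAt
      ((isOpen_geodesicField_domain p).mem_nhds hmem)).of_le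
        (show (1 : WithTop ℕ∞) ≤ ∞ from WithTop.coe_le_coe.2 le_top)).exists_lipschitzOnWith
    have hev1 : ∀ᶠ σ in 𝓝 τ, HasDerivAt (fun τ ↦ chartState p γ W (t + τ))
        (geodesicField g p (chartState p γ W (t + σ))) σ ∧ chartState p γ W (t + σ) ∈ s := by
      have h1 := (hst τ hτs).continuousAt.eventually_mem (show s ∈ 𝓝 _ by rw [hτe]; exact hs)
      filter_upwards [(hγc τ).eventually (hsrc.eventually_mem hτs), h1] with σ h2 h3
      exact ⟨hst σ h2, h3⟩
    have hev2 : ∀ᶠ σ in 𝓝 τ, HasDerivAt (fun τ ↦ Φ τ y)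
        (geodesicField g p (Φ σ y)) σ ∧ Φ σ y ∈ s := by
      filter_upwards [isOpen_Ioo.mem_nhds hτ,
        (hΦd y hy τ hτ).2.continuousAt.eventually_mem hs] with σ h2 h3
      exact ⟨(hΦd y hy σ h2).2, h3⟩
    have heq := ODE_solution_unique_of_eventually (v := fun _ ↦ geodesicField g p)
      (s := fun _ ↦ s) (Filter.Eventually.of_forall fun _ ↦ hK) hev1 hev2 hτe
    filter_upwards [isOpen_Ioo.mem_nhds hτ, (hγc τ).eventually (hsrc.eventually_mem hτs), heq]
      with σ h1 h2 h3
    exact ⟨h1, h2, h3⟩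
  have h0u : (0 : ℝ) ∈ u := by
    refine ⟨⟨by linarith, by linarith⟩, by rwa [add_zero], by rw [add_zero, hΦ0]⟩
  -- The geodesic cannot leave the chart early: at a limit time the flow is still in the chart's
  -- target, and in a Hausdorff space its preimage under the chart must be the limit of the
  -- geodesic.
  have hcl : closure u ∩ Ioo (-ε) ε ⊆ u := by
    rintro τ ⟨hτc, hτ⟩
    have : (𝓝[u] τ).NeBot := mem_closure_iff_nhdsWithin_neBot.1 hτc
    have hΦc := (hΦd y hy τ hτ).2.continuousAt
    have hmem : (Φ τ y).1 ∈ (extChartAt 𝓘(ℝ, E) p).target := (hΦd y hy τ hτ).1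
    have h1 : Filter.Tendsto (fun σ ↦ (extChartAt 𝓘(ℝ, E) p).symm (Φ σ y).1) (𝓝[u] τ)
        (𝓝 ((extChartAt 𝓘(ℝ, E) p).symm (Φ τ y).1)) :=
      Filter.Tendsto.mono_left ((contMDiffAt_chart_symm hmem).continuousAt.tendsto.comp
        (continuousAt_fst.comp (f := fun σ ↦ Φ σ y) hΦc)) nhdsWithin_le_nhds
    have h2 : (fun σ ↦ (extChartAt 𝓘(ℝ, E) p).symm (Φ σ y).1) =ᶠ[𝓝[u] τ] fun σ ↦ γ (t + σ) := by
      filter_upwards [self_mem_nhdsWithin] with σ hσ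
      rw [← hσ.2.2]
      exact (extChartAt 𝓘(ℝ, E) p).left_inv hσ.2.1
    have h3 := tendsto_nhds_unique (h1.congr' h2)
      ((hγc τ).tendsto.mono_left nhdsWithin_le_nhds)
    have h4 : γ (t + τ) ∈ (extChartAt 𝓘(ℝ, E) p).source :=
      h3 ▸ (extChartAt 𝓘(ℝ, E) p).map_target hmem
    refine ⟨hτ, h4, ?_⟩
    have h5 : (fun σ ↦ Φ σ y) =ᶠ[𝓝[u] τ] fun σ ↦ chartState p γ W (t + σ) := by
      filter_upwards [self_mem_nhdsWithin] with σ hσ using hσ.2.2.symm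
    exact (tendsto_nhds_unique ((hΦc.tendsto.mono_left nhdsWithin_le_nhds).congr' h5)
      ((hst τ h4).continuousAt.tendsto.mono_left nhdsWithin_le_nhds)).symm
  intro τ hτ
  exact (isPreconnected_Ioo.subset_of_closure_inter_subset hu
    ⟨0, ⟨by linarith, by linarith⟩, h0u⟩ hcl hτ).2

/-- Near any time both curves follow the same chart flow, so agreement of position and velocity
propagates. The velocity fills the slot of the parallel field in the state. -/
theorem IsGeodesic.eq_of_eq (hγ : IsGeodesic g γ) (hη : IsGeodesic g η) (h0 : γ 0 = η 0)
    (hv : velocity (E := E) γ 0 = velocity η 0) (t : ℝ) :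
    γ t = η t ∧ velocity (E := E) γ t = velocity η t := by
  refine forall_of_locally_propagates (Q := fun t ↦ γ t = η t ∧
    velocity (E := E) γ t = velocity η t) ⟨h0, hv⟩ (fun t₁ ↦ ?_) t
  set p := γ t₁
  have hp : γ t₁ ∈ (extChartAt 𝓘(ℝ, E) p).source := mem_extChartAt_source _
  have hpar : ∀ {γ : ℝ → M}, IsGeodesic g γ → IsParallelAlong g γ (velocity γ) := fun h ↦
    (isParallelAlong_iff g).2 (isParallelAt_velocity g h)
  obtain ⟨ε, hε, B, hB, Φ, -, hΦ⟩ := exists_chart_flow g p (y₁ := chartState p γ (velocity γ) t₁)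
    ((extChartAt 𝓘(ℝ, E) p).map_source hp)
  have hst := hasDerivAt_chartState g hγ (hpar hγ) hp
  obtain ⟨δ, hδ, hδs⟩ := Metric.eventually_nhds_iff.1 ((hst.continuousAt.eventually_mem hB).and
    (eventually_mem_chart_source (hγ.1.contMDiffAt (x := t₁)) hp))
  -- Two times within `ε / 2` of `t₁` differ by less than `ε`, the lifetime of the flow.
  refine ⟨min (ε / 2) δ, by positivity, fun t ht s hs ⟨h1, h2⟩ ↦ ?_⟩
  have htd : dist t t₁ < min (ε / 2) δ := by
    rw [Real.dist_eq, abs_lt]; exact ⟨by linarith [ht.1], by linarith [ht.2]⟩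
  have hsd : dist s t₁ < min (ε / 2) δ := by
    rw [Real.dist_eq, abs_lt]; exact ⟨by linarith [hs.1], by linarith [hs.2]⟩
  have hst' : s - t ∈ Ioo (-ε) ε := by
    have h3 : |s - t| < ε := by
      rw [← Real.dist_eq]
      have := dist_triangle_right s t t₁
      linarith [min_le_left (ε / 2) δ]
    exact abs_lt.1 h3
  obtain ⟨hB1, hs1⟩ := hδs (htd.trans_le (min_le_right _ _))
  have heq : chartState p η (velocity (E := E) η) t = chartState p γ (velocity γ) t := by
    simp only [chartState, chartCurve, chartField_apply, h1, h2]
  obtain ⟨ha, ha'⟩ := hΦ γ _ t hγ (hpar hγ) hs1 hB1 (s - t) hst'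
  obtain ⟨hb, hb'⟩ := hΦ η _ t hη (hpar hη) (h1 ▸ hs1) (heq ▸ hB1) (s - t) hst'
  rw [heq, ← ha'] at hb'
  rw [add_sub_cancel] at ha hb hb'
  have h3 : γ s = η s := (extChartAt 𝓘(ℝ, E) p).injOn ha hb (congrArg Prod.fst hb').symm
  refine ⟨h3, chartDeriv_injective ha ?_⟩
  have h4 : chartDeriv (E := E) p (η s) (velocity η s) = chartDeriv p (γ s) (velocity γ s) :=
    congrArg (fun y ↦ y.2.1) hb'
  rw [← h4, h3]

omit [FiniteDimensional ℝ E] [T2Space M] in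
theorem IsCompleteMetric.geodesic_spec (hc : IsCompleteMetric g) (p : M) (v : E) :
    IsGeodesicFrom g p v (geodesic g p v) := by
  rw [geodesic, dif_pos (hc p v)]
  exact (hc p v).choose_spec

theorem IsGeodesic.eq_geodesic (hc : IsCompleteMetric g) (hγ : IsGeodesic g γ) (t : ℝ) :
    γ t = geodesic g (γ 0) (velocity γ 0) t ∧
      velocity (E := E) γ t = velocity (geodesic g (γ 0) (velocity γ 0)) t := by
  obtain ⟨h1, h2, h3⟩ := hc.geodesic_spec g (γ 0) (velocity γ 0)
  exact hγ.eq_of_eq g h1 h2.symm h3.symm t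

omit [FiniteDimensional ℝ E] [T2Space M] in
theorem velocity_comp_mul_add (hγ : ContMDiff 𝓘(ℝ, ℝ) 𝓘(ℝ, E) ∞ γ) (c d t : ℝ) :
    velocity (E := E) (fun s ↦ γ (c * s + d)) t = c • velocity γ (c * t + d) := by
  have hp : γ (c * t + d) ∈ (extChartAt 𝓘(ℝ, E) (γ (c * t + d))).source :=
    mem_extChartAt_source _
  have haff : ContMDiff 𝓘(ℝ, ℝ) 𝓘(ℝ, ℝ) ∞ (fun s : ℝ ↦ c * s + d) :=
    ((contDiff_const.mul contDiff_id).add contDiff_const).contMDiff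
  refine chartDeriv_injective hp ?_
  have h1 := hasDerivAt_chartCurve (hγ.comp haff).contMDiffAt (t := t) hp
  have h2 := (hasDerivAt_chartCurve hγ.contMDiffAt hp).scomp t
    (((hasDerivAt_id t).const_mul c).add_const d)
  rw [map_smul]
  have h3 := h1.unique h2
  rw [mul_one] at h3
  exact h3

omit [FiniteDimensional ℝ E] [T2Space M] in
theorem IsGeodesic.comp_mul_add (hγ : IsGeodesic g γ) (c d : ℝ) :
    IsGeodesic g (fun s ↦ γ (c * s + d)) := by
  have haff : ContMDiff 𝓘(ℝ, ℝ) 𝓘(ℝ, ℝ) ∞ (fun s : ℝ ↦ c * s + d) :=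
    ((contDiff_const.mul contDiff_id).add contDiff_const).contMDiff
  refine ⟨hγ.1.comp haff, fun p t hp ↦ ?_⟩
  have hd : ∀ f : ℝ → E, deriv (fun s ↦ f (c * s + d)) = fun s ↦ c • deriv f (c * s + d) := by
    intro f
    ext s
    rw [deriv_comp_mul_left c (fun u ↦ f (u + d)) s, deriv_comp_add_const]
  have h1 : deriv (chartCurve (E := E) p (fun s ↦ γ (c * s + d)))
      = fun s ↦ c • deriv (chartCurve p γ) (c * s + d) := hd (chartCurve p γ)
  have h2 := hγ.2 p (c * t + d) hp
  rw [h1, deriv_fun_const_smul_field, hd (deriv (chartCurve p γ))]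
  change c • c • deriv (deriv (chartCurve p γ)) (c * t + d) =
    -christoffel g p (chartCurve p γ (c * t + d)) (c • deriv (chartCurve p γ) (c * t + d))
      (c • deriv (chartCurve p γ) (c * t + d))
  rw [h2, ← christoffelBilin_apply, ← christoffelBilin_apply, map_smul,
    map_smul (christoffelBilin g p (chartCurve p γ (c * t + d))), smul_apply, smul_neg, smul_neg]

theorem geodesic_mul (hc : IsCompleteMetric g) (p : M) (v : E) (c t : ℝ) :
    geodesic g p v (c * t) = geodesic g p (c • v) t ∧
      c • velocity (geodesic g p v) (c * t) = velocity (E := E) (geodesic g p (c • v)) t := by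
  obtain ⟨h1, h2, h3⟩ := hc.geodesic_spec g p v
  have h4 := (h1.comp_mul_add g c 0).eq_geodesic g hc t
  simp only [velocity_comp_mul_add h1.1] at h4
  simp only [mul_zero, add_zero, h2, h3] at h4
  exact h4

theorem geodesic_add (hc : IsCompleteMetric g) (p : M) (v : E) (s t : ℝ) :
    geodesic g p v (t + s) = geodesic g (geodesic g p v s) (velocity (geodesic g p v) s) t ∧
      velocity (E := E) (geodesic g p v) (t + s) =
        velocity (geodesic g (geodesic g p v s) (velocity (geodesic g p v) s)) t := by
  obtain ⟨h1, h2, h3⟩ := hc.geodesic_spec g p v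
  have h4 := (h1.comp_mul_add g 1 s).eq_geodesic g hc t
  simp only [velocity_comp_mul_add h1.1] at h4
  simp only [mul_zero, zero_add, one_mul, one_smul] at h4
  exact h4

variable {P : Type*} [NormedAddCommGroup P] [NormedSpace ℝ P]

/-- Geodesics and parallel transports along them depend smoothly on the initial values. -/
theorem SmoothFamilyAt.geodesic_parallelTransport (hc : IsCompleteMetric g) {q : P → M}
    {V W : P → E} {z₀ : P} (hV : SmoothFamilyAt q V z₀) (hW : SmoothFamilyAt q W z₀) (t : ℝ) :
    SmoothFamilyAt (fun z ↦ geodesic g (q z) (V z) t)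
        (fun z ↦ velocity (E := E) (geodesic g (q z) (V z)) t) z₀ ∧
      SmoothFamilyAt (fun z ↦ geodesic g (q z) (V z) t)
        (fun z ↦ parallelTransport g (geodesic g (q z) (V z)) (W z) t) z₀ := by
  set γ : P → ℝ → M := fun z ↦ geodesic g (q z) (V z) with hγdef
  set X : P → ℝ → E := fun z ↦ parallelTransport g (γ z) (W z) with hXdef
  have hγ : ∀ z, IsGeodesic g (γ z) := fun z ↦ (hc.geodesic_spec g (q z) (V z)).1
  have hX : ∀ z, IsParallelAlong g (γ z) (X z) := fun z ↦
    (parallelTransport_spec g (hγ z).1 (W z)).1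
  refine forall_of_locally_propagates (Q := fun t ↦
    SmoothFamilyAt (fun z ↦ γ z t) (fun z ↦ velocity (E := E) (γ z) t) z₀ ∧
    SmoothFamilyAt (fun z ↦ γ z t) (fun z ↦ X z t) z₀) ?_ (fun t₁ ↦ ?_) t
  · have h1 : (fun z ↦ γ z 0) = q := funext fun z ↦ (hc.geodesic_spec g (q z) (V z)).2.1
    have h2 : (fun z ↦ velocity (E := E) (γ z) 0) = V := funext fun z ↦ (hc.geodesic_spec g (q z) (V z)).2.2
    have h3 : (fun z ↦ X z 0) = W := funext fun z ↦ (parallelTransport_spec g (hγ z).1 (W z)).2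
    rw [h1, h2, h3]
    exact ⟨hV, hW⟩
  set p := γ z₀ t₁
  have hp : γ z₀ t₁ ∈ (extChartAt 𝓘(ℝ, E) p).source := mem_extChartAt_source _
  have hsrc : IsOpen (extChartAt 𝓘(ℝ, E) p).source := isOpen_extChartAt_source p
  obtain ⟨ε, hε, B, hB, Φ, hΦs, hΦ⟩ := exists_chart_flow g p
    (y₁ := chartState p (γ z₀) (X z₀) t₁) ((extChartAt 𝓘(ℝ, E) p).map_source hp)
  have hst := hasDerivAt_chartState g (hγ z₀) (hX z₀) hp
  obtain ⟨δ, hδ, hδs⟩ := Metric.eventually_nhds_iff.1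
    ((hst.continuousAt.eventually_mem (interior_mem_nhds.2 hB)).and
    (eventually_mem_chart_source ((hγ z₀).1.contMDiffAt (x := t₁)) hp))
  refine ⟨min (ε / 2) δ, by positivity, fun t ht s hs ⟨h1, h2⟩ ↦ ?_⟩
  have htd : dist t t₁ < min (ε / 2) δ := by
    rw [Real.dist_eq, abs_lt]; exact ⟨by linarith [ht.1], by linarith [ht.2]⟩
  have hsd : dist s t₁ < min (ε / 2) δ := by
    rw [Real.dist_eq, abs_lt]; exact ⟨by linarith [hs.1], by linarith [hs.2]⟩
  have hst' : s - t ∈ Ioo (-ε) ε := by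
    have h3 : |s - t| < ε := by
      rw [← Real.dist_eq]
      have := dist_triangle_right s t t₁
      linarith [min_le_left (ε / 2) δ]
    exact abs_lt.1 h3
  obtain ⟨hB1, hs1⟩ := hδs (htd.trans_le (min_le_right _ _))
  obtain ⟨-, hs2⟩ := hδs (hsd.trans_le (min_le_right _ _))
  obtain ⟨h3, h4⟩ := (smoothFamilyAt_iff (q := fun z ↦ γ z t) hs1).1 h1
  obtain ⟨-, h5⟩ := (smoothFamilyAt_iff (q := fun z ↦ γ z t) hs1).1 h2
  have hY : ContDiffAt ℝ ∞ (fun z ↦ chartState p (γ z) (X z) t) z₀ :=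
    (contMDiffAt_iff_contDiffAt.1 ((contMDiffAt_chart hs1).comp z₀ h3)).prodMk (h4.prodMk h5)
  -- For `z` near `z₀` the state at time `s` is the image of the state at time `t` under one smooth
  -- flow map, so smoothness passes from `t` to `s`.
  have hZ : ContDiffAt ℝ ∞ (fun z ↦ Φ (s - t) (chartState p (γ z) (X z) t)) z₀ :=
    (hΦs (s - t)).contDiffAt.comp z₀ hY
  have hev : ∀ᶠ z in 𝓝 z₀, γ z s ∈ (extChartAt 𝓘(ℝ, E) p).source ∧
      chartState p (γ z) (X z) s = Φ (s - t) (chartState p (γ z) (X z) t) := by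
    filter_upwards [h3.continuousAt.eventually (hsrc.eventually_mem hs1),
      hY.continuousAt.eventually (isOpen_interior.eventually_mem hB1)] with z hz1 hz2
    have := hΦ (γ z) (X z) t (hγ z) (hX z) hz1 (interior_subset hz2) (s - t) hst'
    rwa [add_sub_cancel] at this
  have hZ' : ContDiffAt ℝ ∞ (fun z ↦ chartState p (γ z) (X z) s) z₀ :=
    hZ.congr_of_eventuallyEq (hev.mono fun z hz ↦ hz.2)
  have hc1 : ContDiffAt ℝ ∞ (fun z ↦ chartCurve p (γ z) s) z₀ := contDiffAt_fst.comp z₀ hZ'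
  have hbase : ContMDiffAt 𝓘(ℝ, P) 𝓘(ℝ, E) ∞ (fun z ↦ γ z s) z₀ := by
    have h6 := (contMDiffAt_chart_symm ((extChartAt 𝓘(ℝ, E) p).map_source hs2)).comp
      z₀ hc1.contMDiffAt
    refine h6.congr_of_eventuallyEq (hev.mono fun z hz ↦ ?_)
    exact ((extChartAt 𝓘(ℝ, E) p).left_inv hz.1).symm
  exact ⟨(smoothFamilyAt_iff (q := fun z ↦ γ z s) hs2).2 ⟨hbase, contDiffAt_fst.comp z₀ (contDiffAt_snd.comp z₀ hZ')⟩,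
    (smoothFamilyAt_iff (q := fun z ↦ γ z s) hs2).2 ⟨hbase, contDiffAt_snd.comp z₀ (contDiffAt_snd.comp z₀ hZ')⟩⟩

end GeodesicFlow

/-! ### Curvature -/

section Curvature

variable {E : Type*} [NormedAddCommGroup E] [NormedSpace ℝ E] [FiniteDimensional ℝ E]
  {M : Type*} [TopologicalSpace M] [ChartedSpace E M] [IsManifold 𝓘(ℝ, E) ∞ M]
  (g : SmoothMetric E M) {p : M} {u : E}

theorem hasFDerivAt_christoffelBilin (hu : u ∈ (extChartAt 𝓘(ℝ, E) p).target) :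
    HasFDerivAt (christoffelBilin g p) (fderiv ℝ (christoffelBilin g p) u) u :=
  (((contDiffOn_christoffelBilin g p).contDiffAt
    ((isOpen_chart_target p).mem_nhds hu)).differentiableAt (by simp)).hasFDerivAt

theorem fderiv_christoffelBilin_comm (hu : u ∈ (extChartAt 𝓘(ℝ, E) p).target) (a b c : E) :
    fderiv ℝ (christoffelBilin g p) u a b c = fderiv ℝ (christoffelBilin g p) u a c b := by
  have h : ∀ b c, fderiv ℝ (fun y ↦ christoffelBilin g p y b c) u a
      = fderiv ℝ (christoffelBilin g p) u a b c := by
    intro b c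
    have h1 := ((hasFDerivAt_christoffelBilin g hu).clm_apply (hasFDerivAt_const b u)).clm_apply
      (hasFDerivAt_const c u)
    rw [h1.fderiv]
    simp
  rw [← h, ← h]
  refine congrArg (fun L : E →L[ℝ] E ↦ L a) (Filter.EventuallyEq.fderiv_eq ?_)
  filter_upwards [(isOpen_chart_target p).mem_nhds hu] with y hy
  exact christoffel_comm g hy b c

theorem riemannCurvature_eq (hu : u ∈ (extChartAt 𝓘(ℝ, E) p).target) (a b c : E) :
    riemannCurvature g p u a b c =
      fderiv ℝ (christoffelBilin g p) u a b c - fderiv ℝ (christoffelBilin g p) u b a c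
      + christoffelBilin g p u a (christoffelBilin g p u b c)
      - christoffelBilin g p u b (christoffelBilin g p u a c) := by
  have h : ∀ a b c, fderiv ℝ (fun y ↦ christoffel g p y b c) u a
      = fderiv ℝ (christoffelBilin g p) u a b c := by
    intro a b c
    have h1 := ((hasFDerivAt_christoffelBilin g hu).clm_apply (hasFDerivAt_const b u)).clm_apply
      (hasFDerivAt_const c u)
    have h2 : HasFDerivAt (fun y ↦ christoffel g p y b c) _ u := h1
    rw [h2.fderiv]
    simp
  rw [riemannCurvature, h, h]
  rfl

omit [FiniteDimensional ℝ E] in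
theorem chartMetric_gram_pos (hu : u ∈ (extChartAt 𝓘(ℝ, E) p).target) {a b : E}
    (hab : LinearIndependent ℝ ![a, b]) :
    0 < chartMetric g p u a a * chartMetric g p u b b - chartMetric g p u a b ^ 2 := by
  have hb : b ≠ 0 := by simpa using hab.ne_zero 1
  have hbb := chartMetric_pos g hu hb
  set k := chartMetric g p u a b / chartMetric g p u b b with hk
  have hne : a + (-k) • b ≠ 0 := fun h ↦ by
    have := LinearIndependent.pair_iff.1 hab 1 (-k) (by rwa [one_smul])
    exact one_ne_zero this.1
  have h1 := chartMetric_pos g hu hne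
  simp only [map_add, map_smul, add_apply, smul_apply, smul_eq_mul] at h1
  rw [chartMetric_comm g p u b a] at h1
  have h2 : chartMetric g p u a b = k * chartMetric g p u b b := by
    rw [hk]; field_simp
  rw [h2] at h1 ⊢
  have h3 : 0 < chartMetric g p u a a - k ^ 2 * chartMetric g p u b b := by linarith
  have h4 := mul_pos h3 hbb
  linarith

/-- The hypothesis concerns only independent pairs. For dependent pairs the curvature term vanishes
by antisymmetry, a case that occurs where a Jacobi field is tangent to its geodesic. -/
theorem chartMetric_riemannCurvature_nonpos (hcurv : NonposCurvature g)
    (hu : u ∈ (extChartAt 𝓘(ℝ, E) p).target) (a b : E) :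
    chartMetric g p u (riemannCurvature g p u a b b) a ≤ 0 := by
  by_cases hab : LinearIndependent ℝ ![a, b]
  · have h1 := hcurv p u hu a b hab
    rw [sectionalCurvature] at h1
    by_contra! h2
    exact absurd (div_pos h2 (chartMetric_gram_pos g hu hab)) (not_lt.2 h1)
  · have h0 : riemannCurvature g p u a b b = 0 := by
      rw [riemannCurvature_eq g hu]
      rcases eq_or_ne b 0 with rfl | hb
      · simp
      · rw [LinearIndependent.pair_iff] at hab
        push Not at hab
        obtain ⟨s, t, hst, hne⟩ := hab
        have hs : s ≠ 0 := fun hs ↦ by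
          rw [hs, zero_smul, zero_add, smul_eq_zero] at hst
          exact hne hs (hst.resolve_right hb)
        have ha : a = (-(s⁻¹ * t)) • b := by
          rw [neg_smul, mul_smul, ← smul_neg, ← eq_neg_of_add_eq_zero_left hst, smul_smul,
            inv_mul_cancel₀ hs, one_smul]
        rw [ha]
        simp only [map_smul, smul_apply]
        abel
    rw [h0]
    simp

/-- Metric compatibility of the covariant derivative along a curve, in a chart. -/
theorem hasDerivAt_chartMetric {c A B : ℝ → E} {c' A' B' : E} {t : ℝ}
    (hu : c t ∈ (extChartAt 𝓘(ℝ, E) p).target) (hc : HasDerivAt c c' t) (hA : HasDerivAt A A' t)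
    (hB : HasDerivAt B B' t) :
    HasDerivAt (fun τ ↦ chartMetric g p (c τ) (A τ) (B τ))
      (chartMetric g p (c t) (A' + christoffelBilin g p (c t) c' (A t)) (B t)
        + chartMetric g p (c t) (A t) (B' + christoffelBilin g p (c t) c' (B t))) t := by
  have h := (((differentiableAt_chartMetric g hu).hasFDerivAt.comp_hasDerivAt t hc).clm_apply
    hA).clm_apply hB
  refine h.congr_deriv ?_
  simp only [Function.comp_apply, add_apply, fderiv_chartMetric_eq g hu, map_add,
    christoffelBilin_apply]
  ring

end Curvature

/-! ### Families of geodesics in a chart -/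

section Variation

variable {E : Type*} [NormedAddCommGroup E] [NormedSpace ℝ E]

theorem hasDerivAt_line_fst {F : ℝ × ℝ → E} {z : ℝ × ℝ} (hF : DifferentiableAt ℝ F z) :
    HasDerivAt (fun τ ↦ F (τ, z.2)) (fderiv ℝ F z (1, 0)) z.1 :=
  HasFDerivAt.comp_hasDerivAt (f := fun τ : ℝ ↦ (τ, z.2)) z.1 hF.hasFDerivAt
    ((hasDerivAt_id z.1).prodMk (hasDerivAt_const z.1 z.2))

theorem hasDerivAt_line_snd {F : ℝ × ℝ → E} {z : ℝ × ℝ} (hF : DifferentiableAt ℝ F z) :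
    HasDerivAt (fun s ↦ F (z.1, s)) (fderiv ℝ F z (0, 1)) z.2 :=
  HasFDerivAt.comp_hasDerivAt (f := fun s : ℝ ↦ (z.1, s)) z.2 hF.hasFDerivAt
    ((hasDerivAt_const z.2 z.1).prodMk (hasDerivAt_id z.2))

theorem ContDiffAt.fderiv_apply_const {P : Type*} [NormedAddCommGroup P] [NormedSpace ℝ P]
    {F : P → E} {z : P} (hF : ContDiffAt ℝ ∞ F z) (e : P) :
    ContDiffAt ℝ ∞ (fun y ↦ fderiv ℝ F y e) z :=
  (hF.fderiv_right (m := ∞) (by simp)).clm_apply contDiffAt_const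

theorem ContDiffAt.fderiv_fderiv_comm {P : Type*} [NormedAddCommGroup P] [NormedSpace ℝ P]
    {F : P → E} {z : P} (hF : ContDiffAt ℝ ∞ F z) (a b : P) :
    fderiv ℝ (fun y ↦ fderiv ℝ F y a) z b = fderiv ℝ (fun y ↦ fderiv ℝ F y b) z a := by
  have hd : HasFDerivAt (fderiv ℝ F) (fderiv ℝ (fderiv ℝ F) z) z :=
    ((hF.fderiv_right (m := ∞) (by simp)).differentiableAt (by simp)).hasFDerivAt
  have h : ∀ a b, fderiv ℝ (fun y ↦ fderiv ℝ F y a) z b = fderiv ℝ (fderiv ℝ F) z b a := by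
    intro a b
    rw [(hd.clm_apply (hasFDerivAt_const a z)).fderiv]
    simp
  rw [h, h]
  exact (hF.isSymmSndFDerivAt (by
    rw [minSmoothness_of_isRCLikeNormedField]; exact WithTop.coe_le_coe.2 le_top)).eq b a

variable [FiniteDimensional ℝ E]
  {M : Type*} [TopologicalSpace M] [ChartedSpace E M] [IsManifold 𝓘(ℝ, E) ∞ M]
  (g : SmoothMetric E M) {p : M}

/-- `c (t, s)` is a smooth family, parametrized by `s`, of geodesics in the chart around `p`. -/
structure IsChartVariation (p : M) (c : ℝ × ℝ → E) (O : Set (ℝ × ℝ)) : Prop where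
  isOpen : IsOpen O
  contDiffAt : ∀ z ∈ O, ContDiffAt ℝ ∞ c z
  mem_target : ∀ z ∈ O, c z ∈ (extChartAt 𝓘(ℝ, E) p).target
  geodesic : ∀ z ∈ O, fderiv ℝ (fun y ↦ fderiv ℝ c y (1, 0)) z (1, 0) =
    - christoffelBilin g p (c z) (fderiv ℝ c z (1, 0)) (fderiv ℝ c z (1, 0))

namespace IsChartVariation

variable {g} {c : ℝ × ℝ → E} {O : Set (ℝ × ℝ)}

/-- The first variation formula. -/
theorem hasDerivAt_inner_velocity (h : IsChartVariation g p c O) {t s : ℝ} (hz : (t, s) ∈ O)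
    {D : ℝ} (hD : HasDerivAt (fun σ ↦ chartMetric g p (c (t, σ)) (fderiv ℝ c (t, σ) (1, 0))
      (fderiv ℝ c (t, σ) (1, 0))) D s) :
    HasDerivAt (fun τ ↦ chartMetric g p (c (τ, s)) (fderiv ℝ c (τ, s) (0, 1))
      (fderiv ℝ c (τ, s) (1, 0))) (D / 2) t := by
  have hcz := h.contDiffAt _ hz
  have hu := h.mem_target _ hz
  have hT := (hcz.fderiv_apply_const ((1 : ℝ), (0 : ℝ))).differentiableAt (by simp)
  have hS := (hcz.fderiv_apply_const ((0 : ℝ), (1 : ℝ))).differentiableAt (by simp)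
  have hc := hcz.differentiableAt (by simp)
  have h1 := hasDerivAt_chartMetric g (p := p) (c := fun τ ↦ c (τ, s)) hu
    (hasDerivAt_line_fst hc) (hasDerivAt_line_fst hS) (hasDerivAt_line_fst hT)
  have h2 := hasDerivAt_chartMetric g (p := p) (c := fun σ ↦ c (t, σ)) hu
    (hasDerivAt_line_snd hc) (hasDerivAt_line_snd hT) (hasDerivAt_line_snd hT)
  refine h1.congr_deriv ?_
  -- With T the velocity and S the variation field, ∇_t T = 0 and ∇_t S = ∇_s T, so the derivative
  -- of ⟨S, T⟩ is ⟨∇_s T, T⟩, half the `s`-derivative of |T|².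
  rw [hD.unique h2, h.geodesic _ hz, neg_add_cancel, map_zero,
    hcz.fderiv_fderiv_comm ((0 : ℝ), (1 : ℝ)) ((1 : ℝ), (0 : ℝ)),
    christoffelBilin_apply, christoffelBilin_apply,
    christoffel_comm g hu (fderiv ℝ c (t, s) (1, 0)) (fderiv ℝ c (t, s) (0, 1)),
    chartMetric_comm g p _ (fderiv ℝ c (t, s) (1, 0))]
  ring

/-- The covariant derivative of the variation field. -/
def covDeriv (g : SmoothMetric E M) (p : M) (c : ℝ × ℝ → E) (z : ℝ × ℝ) : E :=
  fderiv ℝ (fun y ↦ fderiv ℝ c y (0, 1)) z (1, 0)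
    + christoffelBilin g p (c z) (fderiv ℝ c z (1, 0)) (fderiv ℝ c z (0, 1))

/-- The Jacobi equation. -/
theorem hasDerivAt_covDeriv (h : IsChartVariation g p c O) {t s : ℝ} (hz : (t, s) ∈ O) :
    HasDerivAt (fun τ ↦ covDeriv g p c (τ, s))
      (-riemannCurvature g p (c (t, s)) (fderiv ℝ c (t, s) (0, 1)) (fderiv ℝ c (t, s) (1, 0))
          (fderiv ℝ c (t, s) (1, 0))
        - christoffelBilin g p (c (t, s)) (fderiv ℝ c (t, s) (1, 0)) (covDeriv g p c (t, s))) t := by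
  have hcz := h.contDiffAt _ hz
  have hu := h.mem_target _ hz
  have hTs := hcz.fderiv_apply_const ((1 : ℝ), (0 : ℝ))
  have hT := hTs.differentiableAt (by simp)
  have hSs := hcz.fderiv_apply_const ((0 : ℝ), (1 : ℝ))
  have hS := hSs.differentiableAt (by simp)
  have hc := hcz.differentiableAt (by simp)
  have hΓ := hasFDerivAt_christoffelBilin g hu
  have h1 := hasDerivAt_line_fst
    ((hSs.fderiv_apply_const ((1 : ℝ), (0 : ℝ))).differentiableAt (by simp))
  have h2 := ((HasFDerivAt.comp_hasDerivAt (f := fun τ ↦ c (τ, s)) t hΓ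
    (hasDerivAt_line_fst hc)).clm_apply (hasDerivAt_line_fst hT)).clm_apply (hasDerivAt_line_fst hS)
  have h3 := ((HasFDerivAt.comp_hasDerivAt (f := fun σ ↦ c (t, σ)) s hΓ
    (hasDerivAt_line_snd hc)).clm_apply (hasDerivAt_line_snd hT)).clm_apply (hasDerivAt_line_snd hT)
  have hcomm : ∀ y ∈ O, fderiv ℝ (fun y ↦ fderiv ℝ c y (0, 1)) y ((1 : ℝ), (0 : ℝ))
      = fderiv ℝ (fun y ↦ fderiv ℝ c y (1, 0)) y ((0 : ℝ), (1 : ℝ)) := fun y hy ↦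
    (h.contDiffAt _ hy).fderiv_fderiv_comm _ _
  have hO : ∀ᶠ y in 𝓝 (t, s), y ∈ O := h.isOpen.mem_nhds hz
  have h4 : fderiv ℝ (fun y ↦ fderiv ℝ (fun y ↦ fderiv ℝ c y (0, 1)) y (1, 0)) (t, s)
      ((1 : ℝ), (0 : ℝ)) = fderiv ℝ (fun y ↦ fderiv ℝ (fun y ↦ fderiv ℝ c y (1, 0)) y (1, 0)) (t, s)
        ((0 : ℝ), (1 : ℝ)) := by
    rw [Filter.EventuallyEq.fderiv_eq (hO.mono fun y hy ↦ hcomm y hy)]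
    exact hTs.fderiv_fderiv_comm _ _
  have hev : (fun σ ↦ fderiv ℝ (fun y ↦ fderiv ℝ c y (1, 0)) (t, σ) (1, 0)) =ᶠ[𝓝 s]
      fun σ ↦ -christoffelBilin g p (c (t, σ)) (fderiv ℝ c (t, σ) (1, 0))
        (fderiv ℝ c (t, σ) (1, 0)) := by
    have hcont : Continuous fun σ : ℝ ↦ (t, σ) := by fun_prop
    filter_upwards [hcont.continuousAt.eventually hO] with σ hσ
    exact h.geodesic _ hσ
  have h6 := hasDerivAt_line_snd
    ((hTs.fderiv_apply_const ((1 : ℝ), (0 : ℝ))).differentiableAt (by simp))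
  -- This differentiates the geodesic equation across the family. By `h4` its left side is also the
  -- second time derivative of the variation field.
  have h5 := (h6.congr_of_eventuallyEq (f₁ := fun σ ↦ -christoffelBilin g p (c (t, σ))
    (fderiv ℝ c (t, σ) (1, 0)) (fderiv ℝ c (t, σ) (1, 0))) hev.symm).unique h3.neg
  refine (h1.add h2).congr_deriv ?_
  rw [h4, h5, riemannCurvature_eq g hu, h.geodesic _ hz, covDeriv, hcomm _ hz]
  simp only [Function.comp_apply, add_apply, map_add, neg_apply, map_neg]
  simp only [christoffelBilin_apply]
  rw [christoffel_comm g hu (fderiv ℝ (fun y ↦ fderiv ℝ c y (1, 0)) (t, s) (0, 1)),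
    christoffel_comm g hu (christoffel g p (c (t, s)) _ _) (fderiv ℝ c (t, s) (0, 1)),
    christoffel_comm g hu (fderiv ℝ c (t, s) (0, 1)) (fderiv ℝ c (t, s) (1, 0)),
    fderiv_christoffelBilin_comm g hu _ (fderiv ℝ c (t, s) (1, 0)) (fderiv ℝ c (t, s) (0, 1))]
  abel

theorem hasDerivAt_normSq (h : IsChartVariation g p c O) {t s : ℝ} (hz : (t, s) ∈ O) :
    HasDerivAt (fun τ ↦ chartMetric g p (c (τ, s)) (fderiv ℝ c (τ, s) (0, 1))
      (fderiv ℝ c (τ, s) (0, 1)))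
      (2 * chartMetric g p (c (t, s)) (covDeriv g p c (t, s)) (fderiv ℝ c (t, s) (0, 1))) t := by
  have hcz := h.contDiffAt _ hz
  have hS := (hcz.fderiv_apply_const ((0 : ℝ), (1 : ℝ))).differentiableAt (by simp)
  have h1 := hasDerivAt_chartMetric g (p := p) (c := fun τ ↦ c (τ, s)) (h.mem_target _ hz)
    (hasDerivAt_line_fst (hcz.differentiableAt (by simp))) (hasDerivAt_line_fst hS)
    (hasDerivAt_line_fst hS)
  refine h1.congr_deriv ?_
  rw [chartMetric_comm g p _ (fderiv ℝ c (t, s) (0, 1)), ← two_mul]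
  rfl

/-- Metric compatibility absorbs the Christoffel term of the Jacobi equation, so only the squared
covariant derivative and the curvature term survive. -/
theorem hasDerivAt_deriv_normSq (h : IsChartVariation g p c O) {t s : ℝ} (hz : (t, s) ∈ O) :
    HasDerivAt (fun τ ↦ 2 * chartMetric g p (c (τ, s)) (covDeriv g p c (τ, s))
        (fderiv ℝ c (τ, s) (0, 1)))
      (2 * (chartMetric g p (c (t, s)) (covDeriv g p c (t, s)) (covDeriv g p c (t, s))
        - chartMetric g p (c (t, s)) (riemannCurvature g p (c (t, s)) (fderiv ℝ c (t, s) (0, 1))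
          (fderiv ℝ c (t, s) (1, 0)) (fderiv ℝ c (t, s) (1, 0))) (fderiv ℝ c (t, s) (0, 1)))) t := by
  have hcz := h.contDiffAt _ hz
  have hS := (hcz.fderiv_apply_const ((0 : ℝ), (1 : ℝ))).differentiableAt (by simp)
  have h1 := hasDerivAt_chartMetric g (p := p) (c := fun τ ↦ c (τ, s)) (h.mem_target _ hz)
    (hasDerivAt_line_fst (hcz.differentiableAt (by simp))) (h.hasDerivAt_covDeriv hz)
    (hasDerivAt_line_fst hS)
  refine (h1.const_mul 2).congr_deriv ?_
  rw [sub_add_cancel, map_neg, neg_apply]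
  change 2 * (_ + chartMetric g p (c (t, s)) (covDeriv g p c (t, s)) (covDeriv g p c (t, s))) = _
  ring

end IsChartVariation

end Variation

/-! ### Families of geodesics -/

section SmoothFamily

variable {E : Type*} [NormedAddCommGroup E] [NormedSpace ℝ E]
  {M : Type*} [TopologicalSpace M] [ChartedSpace E M] [IsManifold 𝓘(ℝ, E) ∞ M]
  {P : Type*} [NormedAddCommGroup P] [NormedSpace ℝ P]
  {P' : Type*} [NormedAddCommGroup P'] [NormedSpace ℝ P']

omit [IsManifold 𝓘(ℝ, E) ∞ M] in
theorem SmoothFamilyAt.comp {q : P → M} {V : P → E} {f : P' → P} {z₀ : P'}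
    (h : SmoothFamilyAt q V (f z₀)) (hf : ContDiffAt ℝ ∞ f z₀) :
    SmoothFamilyAt (fun z ↦ q (f z)) (fun z ↦ V (f z)) z₀ :=
  ⟨h.1.comp z₀ hf.contMDiffAt, h.2.comp z₀ hf⟩

omit [IsManifold 𝓘(ℝ, E) ∞ M] in
theorem SmoothFamilyAt.smul {q : P → M} {V : P → E} {c : P → ℝ} {z₀ : P}
    (h : SmoothFamilyAt q V z₀) (hc : ContDiffAt ℝ ∞ c z₀) :
    SmoothFamilyAt q (fun z ↦ c z • V z) z₀ := by
  refine ⟨h.1, (hc.smul h.2).congr_of_eventuallyEq (.of_forall fun z ↦ ?_)⟩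
  exact map_smul _ _ _

omit [IsManifold 𝓘(ℝ, E) ∞ M] in
theorem smoothFamilyAt_const (p : M) {V : P → E} {z₀ : P} (hV : ContDiffAt ℝ ∞ V z₀) :
    SmoothFamilyAt (fun _ ↦ p) V z₀ :=
  ⟨contMDiffAt_const, (chartDeriv (E := E) p p).contDiff.contDiffAt.comp z₀ hV⟩

end SmoothFamily

/-! ### Jacobi fields on the manifold and the absence of conjugate points -/

section GeodesicFamily

variable {E : Type*} [NormedAddCommGroup E] [NormedSpace ℝ E] [FiniteDimensional ℝ E]
  {M : Type*} [TopologicalSpace M] [ChartedSpace E M] [IsManifold 𝓘(ℝ, E) ∞ M]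
  (g : SmoothMetric E M) {α : ℝ × ℝ → M} {p : M} {t s : ℝ}

/-- Smooth dependence is available at a fixed time only. Homogeneity, exp(t V) being the time-one
point for the initial velocity t V, moves time into the initial data. -/
theorem contMDiff_geodesic_family [T2Space M] (hc : IsCompleteMetric g) {q : ℝ → M} {V : ℝ → E}
    (h : ∀ s, SmoothFamilyAt q V s) :
    ContMDiff 𝓘(ℝ, ℝ × ℝ) 𝓘(ℝ, E) ∞ fun z : ℝ × ℝ ↦ geodesic g (q z.2) (V z.2) z.1 := by
  intro z
  have he : (fun z : ℝ × ℝ ↦ geodesic g (q z.2) (V z.2) z.1)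
      = fun z : ℝ × ℝ ↦ geodesic g (q z.2) (z.1 • V z.2) 1 := by
    ext z
    rw [← (geodesic_mul g hc _ _ z.1 1).1, mul_one]
  have h1 : SmoothFamilyAt (fun z : ℝ × ℝ ↦ q z.2) (fun z : ℝ × ℝ ↦ z.1 • V z.2) z :=
    ((h z.2).comp (f := Prod.snd) contDiffAt_snd).smul contDiffAt_fst
  rw [he]
  exact (h1.geodesic_parallelTransport g hc h1 1).1.1

section

variable (hα : ContMDiff 𝓘(ℝ, ℝ × ℝ) 𝓘(ℝ, E) ∞ α)
include hα

omit [FiniteDimensional ℝ E] [IsManifold 𝓘(ℝ, E) ∞ M] in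
theorem contMDiff_line_fst (s : ℝ) : ContMDiff 𝓘(ℝ, ℝ) 𝓘(ℝ, E) ∞ fun t ↦ α (t, s) :=
  hα.comp (contDiff_id.prodMk contDiff_const).contMDiff

omit [FiniteDimensional ℝ E] [IsManifold 𝓘(ℝ, E) ∞ M] in
theorem contMDiff_line_snd (t : ℝ) : ContMDiff 𝓘(ℝ, ℝ) 𝓘(ℝ, E) ∞ fun s ↦ α (t, s) :=
  hα.comp (contDiff_const.prodMk contDiff_id).contMDiff

omit [FiniteDimensional ℝ E] in
theorem contDiffAt_chart_comp (hp : α (t, s) ∈ (extChartAt 𝓘(ℝ, E) p).source) :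
    ContDiffAt ℝ ∞ (fun z ↦ extChartAt 𝓘(ℝ, E) p (α z)) (t, s) :=
  contMDiffAt_iff_contDiffAt.1 ((contMDiffAt_chart hp).comp (t, s) hα.contMDiffAt)

omit [FiniteDimensional ℝ E] in
theorem fderiv_chart_comp_fst (hp : α (t, s) ∈ (extChartAt 𝓘(ℝ, E) p).source) :
    fderiv ℝ (fun z ↦ extChartAt 𝓘(ℝ, E) p (α z)) (t, s) (1, 0) =
      chartDeriv p (α (t, s)) (velocity (E := E) (fun τ ↦ α (τ, s)) t) :=
  (hasDerivAt_line_fst ((contDiffAt_chart_comp hα hp).differentiableAt (by simp))).unique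
    (hasDerivAt_chartCurve (γ := fun τ ↦ α (τ, s)) (contMDiff_line_fst hα s).contMDiffAt hp)

omit [FiniteDimensional ℝ E] in
theorem fderiv_chart_comp_snd (hp : α (t, s) ∈ (extChartAt 𝓘(ℝ, E) p).source) :
    fderiv ℝ (fun z ↦ extChartAt 𝓘(ℝ, E) p (α z)) (t, s) (0, 1) =
      chartDeriv p (α (t, s)) (velocity (E := E) (fun σ ↦ α (t, σ)) s) :=
  (hasDerivAt_line_snd ((contDiffAt_chart_comp hα hp).differentiableAt (by simp))).unique
    (hasDerivAt_chartCurve (γ := fun σ ↦ α (t, σ)) (contMDiff_line_snd hα t).contMDiffAt hp)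

variable (hg : ∀ s, IsGeodesic g fun t ↦ α (t, s))
include hg

omit [FiniteDimensional ℝ E] in
theorem isChartVariation_of_isGeodesic (p : M) :
    IsChartVariation g p (fun z ↦ extChartAt 𝓘(ℝ, E) p (α z))
      (α ⁻¹' (extChartAt 𝓘(ℝ, E) p).source) where
  isOpen := (isOpen_extChartAt_source (I := 𝓘(ℝ, E)) p).preimage hα.continuous
  contDiffAt := fun _ hz ↦ contDiffAt_chart_comp hα hz
  mem_target := fun _ hz ↦ (extChartAt 𝓘(ℝ, E) p).map_source hz
  geodesic := by
    rintro ⟨t, s⟩ hz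
    have h1 := (hg s).2 p t hz
    have hγ := (contMDiff_line_fst hα s).contMDiffAt (x := t)
    have h2 := hasDerivAt_line_fst (((contDiffAt_chart_comp hα hz).fderiv_apply_const
      ((1 : ℝ), (0 : ℝ))).differentiableAt (by simp))
    have h3 : ∀ τ, α (τ, s) ∈ (extChartAt 𝓘(ℝ, E) p).source →
        deriv (chartCurve p fun t ↦ α (t, s)) τ
          = fderiv ℝ (fun z ↦ extChartAt 𝓘(ℝ, E) p (α z)) (τ, s) (1, 0) := fun τ hτ ↦
      (deriv_chartCurve (γ := fun t ↦ α (t, s)) (contMDiff_line_fst hα s).contMDiffAt hτ).trans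
        (fderiv_chart_comp_fst hα hτ).symm
    have h4 : deriv (chartCurve (E := E) p fun t ↦ α (t, s)) =ᶠ[𝓝 t]
        fun τ ↦ fderiv ℝ (fun z ↦ extChartAt 𝓘(ℝ, E) p (α z)) (τ, s) (1, 0) :=
      (eventually_mem_chart_source hγ hz).mono h3
    rw [h4.deriv_eq, h3 t hz] at h1
    exact h2.deriv.symm.trans h1

/-- The first variation formula. -/
theorem hasDerivAt_metricInner_velocity {D : ℝ}
    (hD : HasDerivAt (fun σ ↦ metricInner g (α (0, σ)) (velocity (fun τ ↦ α (τ, σ)) 0)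
      (velocity (fun τ ↦ α (τ, σ)) 0)) D s) (t : ℝ) :
    HasDerivAt (fun τ ↦ metricInner g (α (τ, s)) (velocity (fun σ ↦ α (τ, σ)) s)
      (velocity (fun τ ↦ α (τ, s)) τ)) (D / 2) t := by
  set p := α (t, s) with hpdef
  have hp : α (t, s) ∈ (extChartAt 𝓘(ℝ, E) p).source := mem_extChartAt_source _
  -- Geodesics have constant speed, so the derivative of the squared speed across the family is the
  -- same at time `t` as at time `0`.
  have hspeed : ∀ σ, metricInner g (α (t, σ)) (velocity (fun τ ↦ α (τ, σ)) t)
      (velocity (fun τ ↦ α (τ, σ)) t) = metricInner g (α (0, σ)) (velocity (fun τ ↦ α (τ, σ)) 0)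
      (velocity (fun τ ↦ α (τ, σ)) 0) := fun σ ↦
    metricInner_eq_of_isParallelAt g (hg σ).1 isOpen_univ isPreconnected_univ
      (fun t _ ↦ isParallelAt_velocity g (hg σ) t) (fun t _ ↦ isParallelAt_velocity g (hg σ) t)
      (mem_univ t) (mem_univ 0)
  have hvar := isChartVariation_of_isGeodesic g hα hg p
  refine HasDerivAt.congr_of_eventuallyEq (hvar.hasDerivAt_inner_velocity (t := t) (s := s)
    hp (D := D) ?_) ?_
  · refine hD.congr_of_eventuallyEq ?_
    filter_upwards [eventually_mem_chart_source (contMDiff_line_snd hα t).contMDiffAt hp]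
      with σ hσ
    rw [← hspeed σ, metricInner_eq_chartMetric g hσ, fderiv_chart_comp_fst hα hσ]
  · filter_upwards [eventually_mem_chart_source (contMDiff_line_fst hα s).contMDiffAt hp]
      with τ hτ
    rw [metricInner_eq_chartMetric g hτ, fderiv_chart_comp_fst hα hτ, fderiv_chart_comp_snd hα hτ]

theorem metricInner_velocity_eq
    (hD : HasDerivAt (fun σ ↦ metricInner g (α (0, σ)) (velocity (fun τ ↦ α (τ, σ)) 0)
      (velocity (fun τ ↦ α (τ, σ)) 0)) 0 s) (t : ℝ) :
    metricInner g (α (t, s)) (velocity (fun σ ↦ α (t, σ)) s) (velocity (fun τ ↦ α (τ, s)) t) =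
      metricInner g (α (0, s)) (velocity (fun σ ↦ α (0, σ)) s)
        (velocity (fun τ ↦ α (τ, s)) 0) := by
  have h := fun t ↦ hasDerivAt_metricInner_velocity g hα hg hD t
  exact is_const_of_deriv_eq_zero (fun t ↦ (h t).differentiableAt)
    (fun t ↦ (h t).deriv.trans (zero_div 2)) t 0

/-- In non-positive curvature the squared length of a Jacobi field is convex. -/
theorem convexOn_normSq_variation (hcurv : NonposCurvature g) (s : ℝ) :
    ConvexOn ℝ univ fun t ↦ metricInner g (α (t, s)) (velocity (fun σ ↦ α (t, σ)) s)
      (velocity (fun σ ↦ α (t, σ)) s) := by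
  set f : ℝ → ℝ := fun t ↦ metricInner g (α (t, s)) (velocity (fun σ ↦ α (t, σ)) s)
      (velocity (fun σ ↦ α (t, σ)) s) with hf
  have key : ∀ t, DifferentiableAt ℝ f t ∧ ∃ d, 0 ≤ d ∧ HasDerivAt (deriv f) d t := by
    intro t
    set p := α (t, s) with hpdef
    have hp : α (t, s) ∈ (extChartAt 𝓘(ℝ, E) p).source := mem_extChartAt_source _
    have hvar := isChartVariation_of_isGeodesic g hα hg p
    have hev := eventually_mem_chart_source (contMDiff_line_fst hα s).contMDiffAt hp
    set c : ℝ × ℝ → E := fun z ↦ extChartAt 𝓘(ℝ, E) p (α z) with hc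
    have hd : ∀ᶠ τ in 𝓝 t, HasDerivAt f (2 * chartMetric g p (c (τ, s))
        (IsChartVariation.covDeriv g p c (τ, s)) (fderiv ℝ c (τ, s) (0, 1))) τ := by
      filter_upwards [hev.eventually_nhds] with τ hτ
      refine (hvar.hasDerivAt_normSq (t := τ) (s := s) hτ.self_of_nhds).congr_of_eventuallyEq ?_
      filter_upwards [hτ] with τ' hτ'
      rw [hf]
      simp only []
      rw [metricInner_eq_chartMetric g hτ', hc, fderiv_chart_comp_snd hα hτ']
    have h2 := hvar.hasDerivAt_deriv_normSq (t := t) (s := s) hp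
    have hu := hvar.mem_target _ hp
    refine ⟨hd.self_of_nhds.differentiableAt, _, ?_,
      h2.congr_of_eventuallyEq (f₁ := deriv f) (hd.mono fun τ hτ ↦ hτ.deriv)⟩
    have h3 := chartMetric_riemannCurvature_nonpos g hcurv hu (fderiv ℝ c (t, s) (0, 1))
      (fderiv ℝ c (t, s) (1, 0))
    have h4 : 0 ≤ chartMetric g p (c (t, s)) (IsChartVariation.covDeriv g p c (t, s))
        (IsChartVariation.covDeriv g p c (t, s)) := by
      rcases eq_or_ne (IsChartVariation.covDeriv g p c (t, s)) 0 with h0 | h0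
      · rw [h0]; simp
      · exact (chartMetric_pos g hu h0).le
    linarith
  refine convexOn_univ_of_deriv2_nonneg (fun t ↦ (key t).1)
    (fun t ↦ (key t).2.choose_spec.2.differentiableAt) fun t ↦ ?_
  obtain ⟨d, hd, hd'⟩ := (key t).2
  change 0 ≤ deriv (deriv f) t
  rwa [hd'.deriv]

/-- The squared length is convex and non-negative, so zeros at both ends force it to vanish between
them. Parametrizing by `θ * t` covers both signs of `t`. -/
theorem velocity_variation_eq_zero (hcurv : NonposCurvature g) {t : ℝ}
    (h0 : velocity (E := E) (fun σ ↦ α (0, σ)) s = 0)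
    (ht : velocity (E := E) (fun σ ↦ α (t, σ)) s = 0) {θ : ℝ} (hθ : θ ∈ Icc (0 : ℝ) 1) :
    velocity (E := E) (fun σ ↦ α (θ * t, σ)) s = 0 := by
  by_contra hne
  have h := (convexOn_normSq_variation g hα hg hcurv s).2 (mem_univ 0) (mem_univ t)
    (sub_nonneg.2 hθ.2) hθ.1 (sub_add_cancel 1 θ)
  simp only [smul_eq_mul, mul_zero, zero_add, h0, ht] at h
  have h1 := metricInner_pos g (α (θ * t, s)) hne
  have h2 : ∀ q : M, metricInner g q 0 0 = 0 := fun q ↦ by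
    rw [← metricForm_apply, map_zero]
  rw [h2, h2] at h
  simp only [mul_zero, add_zero] at h
  exact absurd h1 (not_lt.2 h)

end

/-- There are no conjugate points in non-positive curvature. -/
theorem eq_zero_of_velocity_geodesic_eq_zero [T2Space M] (hc : IsCompleteMetric g)
    (hcurv : NonposCurvature g) (p : M) (w b : E) (ht : t ≠ 0)
    (h : velocity (E := E) (fun s : ℝ ↦ geodesic g p (w + s • b) t) 0 = 0) : b = 0 := by
  set α : ℝ × ℝ → M := fun z ↦ geodesic g p (w + z.2 • b) z.1 with hαdef
  have hα : ContMDiff 𝓘(ℝ, ℝ × ℝ) 𝓘(ℝ, E) ∞ α :=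
    contMDiff_geodesic_family g hc (q := fun _ ↦ p) (V := fun s : ℝ ↦ w + s • b) fun s ↦
      smoothFamilyAt_const p (by fun_prop)
  have hg : ∀ s, IsGeodesic g fun t ↦ α (t, s) := fun s ↦ (hc.geodesic_spec g p (w + s • b)).1
  have hα0 : ∀ s, α (0, s) = p := fun s ↦ (hc.geodesic_spec g p (w + s • b)).2.1
  have hv0 : ∀ s, velocity (fun t ↦ α (t, s)) 0 = w + s • b := fun s ↦
    (hc.geodesic_spec g p (w + s • b)).2.2
  have h0 : velocity (E := E) (fun s ↦ α (0, s)) 0 = 0 := by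
    simp only [hα0]
    rw [velocity, mfderiv_const]
    rfl
  have hp : ∀ s, α (0, s) ∈ (extChartAt 𝓘(ℝ, E) p).source := fun s ↦ by
    rw [hα0]; exact mem_extChartAt_source _
  set c : ℝ × ℝ → E := fun z ↦ extChartAt 𝓘(ℝ, E) p (α z) with hcdef
  have hcz : ContDiffAt ℝ ∞ c (0, 0) := contDiffAt_chart_comp hα (hp 0)
  have h1 : HasDerivAt (fun s ↦ fderiv ℝ c (0, s) (1, 0))
      (fderiv ℝ (fun y ↦ fderiv ℝ c y (1, 0)) (0, 0) (0, 1)) 0 :=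
    hasDerivAt_line_snd ((hcz.fderiv_apply_const ((1 : ℝ), (0 : ℝ))).differentiableAt (by simp))
  have h2 : (fun s : ℝ ↦ fderiv ℝ c (0, s) (1, 0)) = fun s ↦ w + s • b := by
    ext s
    rw [hcdef, fderiv_chart_comp_fst hα (hp s), hv0, hα0, chartDeriv_self]
    rfl
  have h3 : HasDerivAt (fun s : ℝ ↦ w + s • b) b 0 := by
    simpa using ((hasDerivAt_id (0 : ℝ)).smul_const b).const_add w
  rw [h2] at h1
  have h4 : HasDerivAt (fun τ ↦ fderiv ℝ c (τ, 0) (0, 1))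
      (fderiv ℝ (fun y ↦ fderiv ℝ c y (0, 1)) (0, 0) (1, 0)) 0 :=
    hasDerivAt_line_fst ((hcz.fderiv_apply_const ((0 : ℝ), (1 : ℝ))).differentiableAt (by simp))
  -- Exchanging the mixed partials shows that the Jacobi field has derivative `b` at time `0`.
  rw [hcz.fderiv_fderiv_comm, h1.unique h3] at h4
  have h5 : HasDerivAt (fun θ : ℝ ↦ θ * t) t 0 := by
    simpa using (hasDerivAt_id (0 : ℝ)).mul_const t
  have h6 : HasDerivAt (fun θ : ℝ ↦ fderiv ℝ c (θ * t, 0) (0, 1)) (t • b) 0 :=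
    HasDerivAt.scomp (g₁ := fun τ : ℝ ↦ fderiv ℝ c (τ, 0) ((0 : ℝ), (1 : ℝ)))
      (h := fun θ : ℝ ↦ θ * t) 0 (by rwa [zero_mul]) h5
  have h7 : ∀ᶠ θ in 𝓝[Icc (0 : ℝ) 1] 0, fderiv ℝ c (θ * t, 0) ((0 : ℝ), (1 : ℝ)) = 0 := by
    have h8 : ∀ᶠ θ : ℝ in 𝓝 0, α (θ * t, 0) ∈ (extChartAt 𝓘(ℝ, E) p).source := by
      have hcont : ContinuousAt (fun θ : ℝ ↦ α (θ * t, 0)) 0 := by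
        have := hα.continuous
        fun_prop
      refine hcont.eventually ((isOpen_extChartAt_source (I := 𝓘(ℝ, E)) p).eventually_mem ?_)
      change α (0 * t, 0) ∈ _
      rw [zero_mul]
      exact hp 0
    filter_upwards [nhdsWithin_le_nhds h8, self_mem_nhdsWithin] with θ hθ hθ'
    rw [hcdef, fderiv_chart_comp_snd hα hθ,
      velocity_variation_eq_zero g hα hg hcurv h0 h hθ', map_zero]
  -- The field vanishes on one side of time `0` only, hence one-sided derivatives: comparing the two
  -- values gives `t • b = 0`.
  have h0mem : (0 : ℝ) ∈ Icc (0 : ℝ) 1 := ⟨le_rfl, zero_le_one⟩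
  have h9 : HasDerivWithinAt (fun θ : ℝ ↦ fderiv ℝ c (θ * t, 0) ((0 : ℝ), (1 : ℝ))) 0
      (Icc 0 1) 0 :=
    (hasDerivWithinAt_const (0 : ℝ) (Icc (0 : ℝ) 1) (0 : E)).congr_of_eventuallyEq h7
      (h7.self_of_nhdsWithin h0mem)
  have h10 := (uniqueDiffOn_Icc zero_lt_one 0 h0mem).eq_deriv _ h6.hasDerivWithinAt h9
  exact (smul_eq_zero.1 h10).resolve_left ht

end GeodesicFamily

/-! ### Broken geodesics -/

section Sunada

variable {E : Type*} [NormedAddCommGroup E] [NormedSpace ℝ E]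
  {M : Type*} [TopologicalSpace M] [ChartedSpace E M] [IsManifold 𝓘(ℝ, E) ∞ M]
  (g : SmoothMetric E M) (x : M) (r : ℝ) {n : ℕ} {k : ℕ}

theorem brokenGeodesic_succ (hk : k < n) (v : Fin n → E) :
    brokenGeodesic g x r v (k + 1) =
      (geodesic g (brokenGeodesic g x r v k).1 ((brokenGeodesic g x r v k).2 ⟨k, hk⟩) r,
        fun i ↦ parallelTransport g (geodesic g (brokenGeodesic g x r v k).1
          ((brokenGeodesic g x r v k).2 ⟨k, hk⟩)) ((brokenGeodesic g x r v k).2 i) r) := by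
  rw [brokenGeodesic, dif_pos hk]

theorem brokenGeodesic_succ_of_le (hk : n ≤ k) (v : Fin n → E) :
    brokenGeodesic g x r v (k + 1) = brokenGeodesic g x r v k := by
  rw [brokenGeodesic, dif_neg (not_lt.2 hk)]

variable [FiniteDimensional ℝ E] [T2Space M] (hc : IsCompleteMetric g)
include hc

theorem smoothFamilyAt_brokenGeodesic (k : ℕ) (v : Fin n → E) (i : Fin n) :
    SmoothFamilyAt (fun v ↦ (brokenGeodesic g x r v k).1)
      (fun v ↦ (brokenGeodesic g x r v k).2 i) v := by
  induction k generalizing i with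
  | zero =>
    exact smoothFamilyAt_const (V := fun v : Fin n → E ↦ v i) x
      (ContinuousLinearMap.proj (R := ℝ) (φ := fun _ : Fin n ↦ E) i).contDiff.contDiffAt
  | succ k ih =>
    rcases lt_or_ge k n with hk | hk
    · simp only [brokenGeodesic_succ g x r hk]
      exact ((ih ⟨k, hk⟩).geodesic_parallelTransport g hc (ih i) r).2
    · simp only [brokenGeodesic_succ_of_le g x r hk]
      exact ih i

theorem contMDiff_brokenGeodesic (hn : 0 < n) (k : ℕ) :
    ContMDiff 𝓘(ℝ, Fin n → E) 𝓘(ℝ, E) ∞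
      fun v : Fin n → E ↦ (brokenGeodesic g x r v k).1 := fun v ↦
  (smoothFamilyAt_brokenGeodesic g x r hc k v ⟨0, hn⟩).1

omit [T2Space M] in
/-- The parallel transport along a broken geodesic to its corner number `k`. -/
theorem exists_brokenGeodesic_transport (v : Fin n → E) (k : ℕ) :
    ∃ L : E →ₗ[ℝ] E,
      (∀ a b, metricInner g (brokenGeodesic g x r v k).1 (L a) (L b) = metricInner g x a b) ∧
      ∀ v' : Fin n → E, (∀ i : Fin n, i < k → v' i = v i) →
        brokenGeodesic g x r v' k = ((brokenGeodesic g x r v k).1, fun i ↦ L (v' i)) := by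
  induction k with
  | zero => exact ⟨LinearMap.id, fun a b ↦ rfl, fun v' _ ↦ rfl⟩
  | succ k ih =>
    obtain ⟨L, hL, hL'⟩ := ih
    rcases lt_or_ge k n with hk | hk
    · have hv := hL' v fun _ _ ↦ rfl
      set γ := geodesic g (brokenGeodesic g x r v k).1 (L (v ⟨k, hk⟩)) with hγdef
      have hγ := hc.geodesic_spec g (brokenGeodesic g x r v k).1 (L (v ⟨k, hk⟩))
      let T : E →ₗ[ℝ] E :=
        { toFun := fun a ↦ parallelTransport g γ a r
          map_add' := fun a b ↦ parallelTransport_add g hγ.1.1 a b r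
          map_smul' := fun c a ↦ parallelTransport_smul g hγ.1.1 c a r }
      have h1 : (brokenGeodesic g x r v (k + 1)).1 = γ r := by
        rw [brokenGeodesic_succ g x r hk, hv]
      refine ⟨T ∘ₗ L, fun a b ↦ ?_, fun v' hv' ↦ ?_⟩
      · rw [h1, ← hL]
        refine (metricInner_parallelTransport g hγ.1.1 (L a) (L b) r).trans ?_
        rw [hγ.2.1]
      · rw [h1, brokenGeodesic_succ g x r hk,
          hL' v' fun i hi ↦ hv' i (hi.trans (Nat.lt_succ_self k))]
        simp only [hv' ⟨k, hk⟩ (Nat.lt_succ_self k)]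
        rfl
    · refine ⟨L, ?_, fun v' hv' ↦ ?_⟩
      · rwa [brokenGeodesic_succ_of_le g x r hk]
      · rw [brokenGeodesic_succ_of_le g x r hk, brokenGeodesic_succ_of_le g x r hk]
        exact hL' v' fun i hi ↦ hv' i (hi.trans (Nat.lt_succ_self k))

omit [T2Space M] in
theorem metricInner_brokenGeodesic (v : Fin n → E) (k : ℕ) (i j : Fin n) :
    metricInner g (brokenGeodesic g x r v k).1 ((brokenGeodesic g x r v k).2 i)
      ((brokenGeodesic g x r v k).2 j) = metricInner g x (v i) (v j) := by
  obtain ⟨L, hL, hL'⟩ := exists_brokenGeodesic_transport g x r hc v k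
  rw [hL' v fun _ _ ↦ rfl]
  exact hL _ _

/-! ### Tangent maps at the corners -/

omit hc [FiniteDimensional ℝ E] [T2Space M] [IsManifold 𝓘(ℝ, E) ∞ M] in
theorem velocity_comp_line {f : (Fin n → E) → M}
    (hf : ContMDiff 𝓘(ℝ, Fin n → E) 𝓘(ℝ, E) ∞ f) (v a : Fin n → E) :
    velocity (fun s : ℝ ↦ f (v + s • a)) 0 = ambientTangentMap f v a := by
  have h1 : HasDerivAt (fun s : ℝ ↦ v + s • a) a 0 := by
    simpa using ((hasDerivAt_id (0 : ℝ)).smul_const a).const_add v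
  have h2 : HasMFDerivAt 𝓘(ℝ, Fin n → E) 𝓘(ℝ, E) f (v + (0 : ℝ) • a)
      (mfderiv 𝓘(ℝ, Fin n → E) 𝓘(ℝ, E) f (v + (0 : ℝ) • a)) :=
    (hf.mdifferentiable (by simp) _).hasMFDerivAt
  have h3 := (h2.comp (0 : ℝ) h1.hasFDerivAt.hasMFDerivAt).mfderiv
  rw [velocity]
  let L : ℝ →L[ℝ] E := mfderiv 𝓘(ℝ, ℝ) 𝓘(ℝ, E) (fun s : ℝ ↦ f (v + s • a)) 0
  let A : (Fin n → E) →L[ℝ] E := mfderiv 𝓘(ℝ, Fin n → E) 𝓘(ℝ, E) f (v + (0 : ℝ) • a)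
  have h4 : L = A.comp ((1 : ℝ →L[ℝ] ℝ).smulRight a) := h3
  have h5 : L 1 = A a := by rw [h4]; simp
  refine h5.trans ?_
  change ambientTangentMap f (v + (0 : ℝ) • a) a = _
  rw [zero_smul, add_zero]

omit hc [FiniteDimensional ℝ E] [T2Space M] in
theorem hasDerivAt_metricInner_line (v a : E) (h : metricInner g x v a = 0) :
    HasDerivAt (fun s : ℝ ↦ metricInner g x (v + s • a) (v + s • a)) 0 0 := by
  have h1 : HasDerivAt (fun s : ℝ ↦ v + s • a) a 0 := by
    simpa using ((hasDerivAt_id (0 : ℝ)).smul_const a).const_add v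
  have h2 := ((metricForm g x).hasFDerivAt.comp_hasDerivAt (0 : ℝ) h1).clm_apply h1
  refine h2.congr_deriv ?_
  simp only [Function.comp_apply, zero_smul, add_zero, metricForm_apply]
  rw [metricInner_comm g x a, h, add_zero]

/-- The tangent map of the `k`-th corner of the broken geodesic. -/
def cornerTangentMap (v : Fin n → E) (k : ℕ) : (Fin n → E) →ₗ[ℝ] E :=
  ambientTangentMap (fun v ↦ (brokenGeodesic g x r v k).1) v

theorem velocity_corner (hn : 0 < n) (v a : Fin n → E) (k : ℕ) :
    velocity (fun s : ℝ ↦ (brokenGeodesic g x r (v + s • a) k).1) 0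
      = cornerTangentMap g x r v k a :=
  velocity_comp_line (contMDiff_brokenGeodesic g x r hc hn k) v a

/-- The first variation formula on one segment: orthogonality makes its squared speed stationary, so
the inner product of the variation field with the velocity is the same at both ends. The final
velocity is the transported direction itself. -/
theorem metricInner_cornerTangentMap_succ (hk : k < n) {v a : Fin n → E}
    (ha : metricInner g x (v ⟨k, hk⟩) (a ⟨k, hk⟩) = 0) :
    metricInner g (brokenGeodesic g x r v (k + 1)).1 (cornerTangentMap g x r v (k + 1) a)
        ((brokenGeodesic g x r v (k + 1)).2 ⟨k, hk⟩) =
      metricInner g (brokenGeodesic g x r v k).1 (cornerTangentMap g x r v k a)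
        ((brokenGeodesic g x r v k).2 ⟨k, hk⟩) := by
  have hn : 0 < n := hk.pos
  set q : ℝ → M := fun s ↦ (brokenGeodesic g x r (v + s • a) k).1 with hq
  set V : ℝ → E := fun s ↦ (brokenGeodesic g x r (v + s • a) k).2 ⟨k, hk⟩ with hV
  have hqV : ∀ s, SmoothFamilyAt q V s := fun s ↦
    (smoothFamilyAt_brokenGeodesic g x r hc k (v + s • a) ⟨k, hk⟩).comp
      (f := fun s : ℝ ↦ v + s • a) (by fun_prop)
  set α : ℝ × ℝ → M := fun z ↦ geodesic g (q z.2) (V z.2) z.1 with hαdef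
  have hα := contMDiff_geodesic_family g hc hqV
  have hspec := fun s ↦ hc.geodesic_spec g (q s) (V s)
  have hD : HasDerivAt (fun σ ↦ metricInner g (α (0, σ)) (velocity (fun τ ↦ α (τ, σ)) 0)
      (velocity (fun τ ↦ α (τ, σ)) 0)) 0 0 := by
    refine (hasDerivAt_metricInner_line g x _ _ ha).congr_of_eventuallyEq
      (.of_forall fun σ ↦ ?_)
    have h1 : velocity (fun τ ↦ α (τ, σ)) 0 = V σ := (hspec σ).2.2
    have h2 : α (0, σ) = q σ := (hspec σ).2.1
    simp only [h1, h2]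
    exact metricInner_brokenGeodesic g x r hc (v + σ • a) k ⟨k, hk⟩ ⟨k, hk⟩
  have h := metricInner_velocity_eq g hα (fun s ↦ (hspec s).1) hD r
  have hv : v + (0 : ℝ) • a = v := by rw [zero_smul, add_zero]
  have h1 : (fun σ ↦ geodesic g (q σ) (V σ) r)
      = fun s : ℝ ↦ (brokenGeodesic g x r (v + s • a) (k + 1)).1 := by
    ext s; rw [brokenGeodesic_succ g x r hk]
  have h2 : (fun σ ↦ geodesic g (q σ) (V σ) 0)
      = fun s : ℝ ↦ (brokenGeodesic g x r (v + s • a) k).1 := by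
    ext s; exact (hspec s).2.1
  have h3 : velocity (geodesic g (q 0) (V 0)) r = (brokenGeodesic g x r v (k + 1)).2 ⟨k, hk⟩ := by
    rw [velocity_eq_parallelTransport g (hspec 0).1, (hspec 0).2.2, brokenGeodesic_succ g x r hk]
    simp only [hq, hV, hv]
  simp only [] at h
  rw [h1, h2, velocity_corner g x r hc hn, velocity_corner g x r hc hn] at h
  have h4 : geodesic g (q 0) (V 0) r = (brokenGeodesic g x r v (k + 1)).1 := by
    rw [congrFun h1 0, hv]
  have h5 : geodesic g (q 0) (V 0) 0 = (brokenGeodesic g x r v k).1 := by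
    rw [congrFun h2 0, hv]
  have h6 : velocity (geodesic g (q 0) (V 0)) 0 = (brokenGeodesic g x r v k).2 ⟨k, hk⟩ := by
    rw [(hspec 0).2.2]
    simp only [hV, hv]
  rw [h4, h5] at h
  refine Eq.trans ?_ (h.trans ?_)
  · exact congrArg _ h3.symm
  · exact congrArg _ h6

/-- Corner `k` is determined by the entries with index less than `k`. -/
theorem cornerTangentMap_single (hk : k < n) (v : Fin n → E) (b : E) :
    cornerTangentMap g x r v k (Pi.single ⟨k, hk⟩ b) = 0 := by
  obtain ⟨L, hL, hL'⟩ := exists_brokenGeodesic_transport g x r hc v k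
  rw [← velocity_corner g x r hc hk.pos]
  have h : (fun s : ℝ ↦ (brokenGeodesic g x r (v + s • (Pi.single ⟨k, hk⟩ b : Fin n → E)) k).1)
      = fun _ ↦ (brokenGeodesic g x r v k).1 := by
    ext s
    rw [hL']
    intro i hi
    have hne : i ≠ ⟨k, hk⟩ := fun h ↦ by rw [h] at hi; exact lt_irrefl _ hi
    simp [hne]
  rw [h, velocity, mfderiv_const]
  rfl

/-- With corner `k` fixed, the next corner moves as the exponential map based there. The absence of
conjugate points kills the transported vector, and the transport is isometric. -/
theorem eq_zero_of_cornerTangentMap_single (hcurv : NonposCurvature g) (hr : r ≠ 0) (hk : k < n)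
    (v : Fin n → E) (b : E)
    (hb : cornerTangentMap g x r v (k + 1) (Pi.single ⟨k, hk⟩ b) = 0) : b = 0 := by
  obtain ⟨L, hL, hL'⟩ := exists_brokenGeodesic_transport g x r hc v k
  rw [← velocity_corner g x r hc hk.pos] at hb
  have h : (fun s : ℝ ↦ (brokenGeodesic g x r (v + s • (Pi.single ⟨k, hk⟩ b : Fin n → E)) (k + 1)).1)
      = fun s : ℝ ↦ geodesic g (brokenGeodesic g x r v k).1 (L (v ⟨k, hk⟩) + s • L b) r := by
    ext s
    rw [brokenGeodesic_succ g x r hk, hL']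
    · simp
    · intro i hi
      have hne : i ≠ ⟨k, hk⟩ := fun h ↦ by rw [h] at hi; exact lt_irrefl _ hi
      simp [hne]
  rw [h] at hb
  have h1 := eq_zero_of_velocity_geodesic_eq_zero g hc hcurv _ _ _ hr hb
  by_contra hne
  have h2 := metricInner_pos g x hne
  rw [← hL, h1, ← metricForm_apply, map_zero] at h2
  exact lt_irrefl _ h2

omit hc [T2Space M] in
theorem finrank_ker_metricForm (p : M) {u : E} (hu : u ≠ 0) :
    Module.finrank ℝ (LinearMap.ker (metricForm g p u : E →ₗ[ℝ] ℝ)) + 1 = Module.finrank ℝ E := by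
  refine Module.Dual.finrank_ker_add_one_of_ne_zero (f := (metricForm g p u : E →ₗ[ℝ] ℝ)) ?_
  intro h
  exact (metricInner_pos g p hu).ne' (LinearMap.congr_fun h u)

omit hc [FiniteDimensional ℝ E] [T2Space M] in
theorem ne_zero_of_metricInner_self {p : M} {u : E} (hu : metricInner g p u u = 1) : u ≠ 0 := by
  rintro rfl
  rw [← metricForm_apply, map_zero] at hu
  exact zero_ne_one hu

/-- The image of the tangent map of a corner contains the normal space of the arriving segment. -/
theorem exists_cornerTangentMap_eq (hcurv : NonposCurvature g) (hr : r ≠ 0) (hk : k < n)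
    {v : Fin n → E} (hv : v ∈ unitTuples g x n) {y : E}
    (hy : metricInner g (brokenGeodesic g x r v (k + 1)).1 y
      ((brokenGeodesic g x r v (k + 1)).2 ⟨k, hk⟩) = 0) :
    ∃ a ∈ unitTuplesTangent g x v, cornerTangentMap g x r v (k + 1) a = y := by
  set p := (brokenGeodesic g x r v (k + 1)).1 with hp
  set w := (brokenGeodesic g x r v (k + 1)).2 ⟨k, hk⟩ with hw
  have hw1 : metricInner g p w w = 1 :=
    (metricInner_brokenGeodesic g x r hc v (k + 1) _ _).trans (hv _)
  set A : E →ₗ[ℝ] E := cornerTangentMap g x r v (k + 1) ∘ₗ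
    LinearMap.single ℝ (fun _ : Fin n ↦ E) ⟨k, hk⟩ with hA
  have hAinj : Function.Injective A := by
    rw [injective_iff_map_eq_zero]
    exact fun b hb ↦ eq_zero_of_cornerTangentMap_single g x r hc hcurv hr hk v b hb
  set N := LinearMap.ker (metricForm g x (v ⟨k, hk⟩) : E →ₗ[ℝ] ℝ) with hN
  set N' := LinearMap.ker (metricForm g p w : E →ₗ[ℝ] ℝ) with hN'
  have hle : N.map A ≤ N' := by
    rintro _ ⟨b, hb, rfl⟩
    have hb' : metricInner g x (v ⟨k, hk⟩) b = 0 := hb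
    have h1 := metricInner_cornerTangentMap_succ g x r hc hk (v := v) (a := Pi.single ⟨k, hk⟩ b)
      (by rwa [Pi.single_eq_same])
    rw [cornerTangentMap_single g x r hc hk, ← metricForm_apply _ _ 0, map_zero] at h1
    exact (metricInner_comm g p _ _).trans h1
  -- `A` sends the orthogonal complement of `v_k` injectively into that of the arriving direction
  -- `w`. Both are hyperplanes, so the inclusion `hle` is an equality.
  have hfin : Module.finrank ℝ (N.map A) = Module.finrank ℝ N' := by
    rw [← (Submodule.equivMapOfInjective A hAinj N).finrank_eq]
    have h1 := finrank_ker_metricForm g x (ne_zero_of_metricInner_self g (hv ⟨k, hk⟩))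
    have h2 := finrank_ker_metricForm g p (ne_zero_of_metricInner_self g hw1)
    exact Nat.add_right_cancel (h1.trans h2.symm)
  have hy' : y ∈ N.map A := by
    rw [Submodule.eq_of_le_of_finrank_eq hle hfin]
    exact (metricInner_comm g p _ _).trans hy
  obtain ⟨b, hb, hby⟩ := hy'
  refine ⟨Pi.single ⟨k, hk⟩ b, fun i ↦ ?_, hby⟩
  rcases eq_or_ne i ⟨k, hk⟩ with rfl | hi
  · rw [Pi.single_eq_same]; exact hb
  · rw [Pi.single_eq_of_ne hi, ← metricForm_apply, map_zero]

end Sunada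

/-! ### The singular set of Sunada's mapping -/

section Singular

variable {E : Type*} [NormedAddCommGroup E] [NormedSpace ℝ E]
  {M : Type*} [TopologicalSpace M] [ChartedSpace E M] [IsManifold 𝓘(ℝ, E) ∞ M]
  (g : SmoothMetric E M) (x : M) (r : ℝ) {n : ℕ} {k : ℕ}

/-- The equality case of Cauchy–Schwarz: with c = ⟨u, v⟩, the vector u - c v has squared length 1 -
c². -/
theorem eq_smul_of_metricInner_sq_eq_one {p : M} {u v : E} (hu : metricInner g p u u = 1)
    (hv : metricInner g p v v = 1) (h : metricInner g p u v ^ 2 = 1) :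
    u = metricInner g p u v • v := by
  by_contra hne
  have h1 := metricInner_pos g p (sub_ne_zero.2 hne)
  have h2 : metricInner g p v u = metricInner g p u v := metricInner_comm g p v u
  simp only [← metricForm_apply] at *
  set c := metricForm g p u v
  simp only [map_sub, map_smul, sub_apply, smul_apply, smul_eq_mul, hu, hv, h2] at h1
  have h3 : metricForm g p u v = c := rfl
  rw [h3] at h1
  linarith

theorem eq_or_eq_neg_of_metricInner_sq_eq_one {p : M} {u v : E} (hu : metricInner g p u u = 1)
    (hv : metricInner g p v v = 1) (h : metricInner g p u v ^ 2 = 1) : u = v ∨ u = -v := by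
  have h1 := eq_smul_of_metricInner_sq_eq_one g hu hv h
  rcases mul_self_eq_one_iff.1 ((sq _).symm.trans h) with h2 | h2 <;> rw [h2] at h1
  · exact Or.inl (by rwa [one_smul] at h1)
  · exact Or.inr (by rwa [neg_one_smul] at h1)

theorem metricInner_eq_zero_of_eq_or_eq_neg {p : M} {y u v : E} (h : u = v ∨ u = -v)
    (hy : metricInner g p y v = 0) : metricInner g p y u = 0 := by
  rcases h with rfl | rfl
  · exact hy
  · rw [← metricForm_apply] at *; rw [map_neg, hy, neg_zero]

/-- A subspace that contains a hyperplane and a vector outside it is everything; the coefficient `c`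
projects `y` onto the hyperplane along `D a₀`. -/
theorem exists_eq_of_hyperplane {V : Type*} [AddCommGroup V] [Module ℝ V] {T : Submodule ℝ V}
    {D : V →ₗ[ℝ] E} {p : M} {w : E}
    (h : ∀ y, metricInner g p y w = 0 → ∃ a ∈ T, D a = y) {a₀ : V} (ha₀ : a₀ ∈ T)
    (h₀ : metricInner g p (D a₀) w ≠ 0) (y : E) : ∃ a ∈ T, D a = y := by
  set c := metricInner g p y w / metricInner g p (D a₀) w with hc
  obtain ⟨a, ha, hay⟩ := h (y - c • D a₀) (by
    rw [← metricForm_apply, map_sub, map_smul, sub_apply, smul_apply, smul_eq_mul, hc,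
      metricForm_apply, metricForm_apply, div_mul_cancel₀ _ h₀, sub_self])
  exact ⟨a + c • a₀, T.add_mem ha (T.smul_mem c ha₀), by
    rw [map_add, map_smul, hay, sub_add_cancel]⟩

variable [FiniteDimensional ℝ E]

theorem brokenGeodesic_eq_or_eq_neg (hc : IsCompleteMetric g) {v : Fin n → E} {i j : Fin n}
    (h : v i = v j ∨ v i = -v j) (k : ℕ) :
    (brokenGeodesic g x r v k).2 i = (brokenGeodesic g x r v k).2 j ∨
      (brokenGeodesic g x r v k).2 i = -(brokenGeodesic g x r v k).2 j := by
  obtain ⟨L, -, hL⟩ := exists_brokenGeodesic_transport g x r hc v k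
  rw [hL v fun _ _ ↦ rfl]
  rcases h with h | h
  · exact Or.inl (by simp only [h])
  · exact Or.inr (by simp only [h, map_neg])

variable [T2Space M] (hc : IsCompleteMetric g) (hn : 0 < n)
include hc

/-- The initial point does not move, and the first variation formula carries orthogonality across
each segment. The directions differ by signs only, so orthogonality to one of them is orthogonality
to all. -/
theorem metricInner_cornerTangentMap_of_collinear {v : Fin n → E} (hk : k ≤ n)
    (h : ∀ i : Fin n, i < k → v i = v ⟨0, hn⟩ ∨ v i = -v ⟨0, hn⟩) {a : Fin n → E}
    (ha : a ∈ unitTuplesTangent g x v) (i : Fin n) (hi : v i = v ⟨0, hn⟩ ∨ v i = -v ⟨0, hn⟩) :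
    metricInner g (brokenGeodesic g x r v k).1 (cornerTangentMap g x r v k a)
      ((brokenGeodesic g x r v k).2 i) = 0 := by
  refine metricInner_eq_zero_of_eq_or_eq_neg g (brokenGeodesic_eq_or_eq_neg g x r hc hi k) ?_
  clear hi i
  induction k with
  | zero =>
    have h0 : cornerTangentMap g x r v 0 a = 0 := by
      rw [← velocity_corner g x r hc hn]
      change velocity (fun _ : ℝ ↦ x) 0 = 0
      rw [velocity, mfderiv_const]
      rfl
    rw [h0, ← metricForm_apply, map_zero]
    rfl
  | succ k ih =>
    have hk' : v ⟨0, hn⟩ = v ⟨k, hk⟩ ∨ v ⟨0, hn⟩ = -v ⟨k, hk⟩ := by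
      rcases h ⟨k, hk⟩ (Nat.lt_succ_self k) with h | h
      · exact Or.inl h.symm
      · exact Or.inr (by rw [h, neg_neg])
    refine metricInner_eq_zero_of_eq_or_eq_neg g
      (brokenGeodesic_eq_or_eq_neg g x r hc hk' (k + 1)) ?_
    rw [metricInner_cornerTangentMap_succ g x r hc hk (ha ⟨k, hk⟩)]
    refine metricInner_eq_zero_of_eq_or_eq_neg g
      (brokenGeodesic_eq_or_eq_neg g x r hc (h ⟨k, hk⟩ (Nat.lt_succ_self k)) k) ?_
    exact ih (Nat.le_of_succ_le hk) fun i hi ↦ h i (hi.trans (Nat.lt_succ_self k))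

variable (hcurv : NonposCurvature g) (hr : r ≠ 0)
include hcurv hr

/-- The hyperplane orthogonal to the arriving direction is always in the image, so it suffices to
move corner `k` with a component along the next direction. Either the previous map is already onto,
or `k` is the first index off the common line. -/
theorem exists_cornerTangentMap_eq_of_not_collinear {v : Fin n → E} (hv : v ∈ unitTuples g x n)
    (hk : k ≤ n) (h : ¬ ∀ i : Fin n, i < k → v i = v ⟨0, hn⟩ ∨ v i = -v ⟨0, hn⟩) (y : E) :
    ∃ a ∈ unitTuplesTangent g x v, cornerTangentMap g x r v k a = y := by
  induction k generalizing y with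
  | zero => exact absurd (fun i hi ↦ absurd hi (Nat.not_lt_zero _)) h
  | succ k ih =>
    have hw := metricInner_brokenGeodesic g x r hc v k
    set w := (brokenGeodesic g x r v k).2 with hwdef
    obtain ⟨a₀, ha₀, h₀⟩ : ∃ a₀ ∈ unitTuplesTangent g x v,
        metricInner g (brokenGeodesic g x r v k).1 (cornerTangentMap g x r v k a₀)
          (w ⟨k, hk⟩) ≠ 0 := by
      by_cases hcol : ∀ i : Fin n, i < k → v i = v ⟨0, hn⟩ ∨ v i = -v ⟨0, hn⟩
      · have hvk : ¬ (v ⟨k, hk⟩ = v ⟨0, hn⟩ ∨ v ⟨k, hk⟩ = -v ⟨0, hn⟩) := fun hvk ↦ h fun i hi ↦ by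
          rcases Nat.lt_succ_iff_lt_or_eq.1 hi with hi | hi
          · exact hcol i hi
          · have : i = ⟨k, hk⟩ := Fin.ext hi
            rwa [this]
        -- The entry of index `0` is collinear with itself, so a preceding segment exists.
        obtain ⟨j, rfl⟩ : ∃ j, k = j + 1 := by
          refine Nat.exists_eq_succ_of_ne_zero ?_
          rintro rfl
          exact hvk (Or.inl rfl)
        have hj : j < n := Nat.lt_of_succ_lt hk
        have hvj := hcol ⟨j, hj⟩ (Nat.lt_succ_self j)
        set c := metricInner g x (v ⟨j + 1, hk⟩) (v ⟨j, hj⟩) with hcdef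
        have hc1 : c ^ 2 ≠ 1 := fun h1 ↦ hvk <| by
          rcases eq_or_eq_neg_of_metricInner_sq_eq_one g (hv _) (hv _) h1 with h2 | h2 <;>
            rcases hvj with h3 | h3 <;> simp [h2, h3]
        have hp1 : metricForm g (brokenGeodesic g x r v (j + 1)).1 (w ⟨j + 1, hk⟩) (w ⟨j, hj⟩) = c :=
          hw _ _
        have hp2 : metricForm g (brokenGeodesic g x r v (j + 1)).1 (w ⟨j, hj⟩) (w ⟨j, hj⟩) = 1 :=
          (hw _ _).trans (hv _)
        have hp3 : metricForm g (brokenGeodesic g x r v (j + 1)).1 (w ⟨j, hj⟩) (w ⟨j + 1, hk⟩) = c :=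
          (hw _ _).trans (metricInner_comm g x _ _)
        have hp4 : metricForm g (brokenGeodesic g x r v (j + 1)).1 (w ⟨j + 1, hk⟩)
            (w ⟨j + 1, hk⟩) = 1 := (hw _ _).trans (hv _)
        -- The part of the new direction orthogonal to the arriving one is attained at the corner,
        -- and its inner product with the new direction is 1 - c², which is nonzero by `hc1`.
        obtain ⟨a, ha, hay⟩ := exists_cornerTangentMap_eq g x r hc hcurv hr hj hv
          (y := w ⟨j + 1, hk⟩ - c • w ⟨j, hj⟩) (by
            rw [← metricForm_apply, map_sub, map_smul, sub_apply, smul_apply, hp1, hp2,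
              smul_eq_mul, mul_one, sub_self])
        refine ⟨a, ha, ?_⟩
        rw [hay, ← metricForm_apply, map_sub, map_smul, sub_apply, smul_apply, hp3, hp4,
          smul_eq_mul]
        intro h1
        exact hc1 (by linarith)
      · obtain ⟨a, ha, hay⟩ := ih (Nat.le_of_succ_le hk) hcol (w ⟨k, hk⟩)
        refine ⟨a, ha, ?_⟩
        rw [hay, hw, hv]
        exact one_ne_zero
    refine exists_eq_of_hyperplane g (p := (brokenGeodesic g x r v (k + 1)).1)
      (w := (brokenGeodesic g x r v (k + 1)).2 ⟨k, hk⟩)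
      (fun y hy ↦ exists_cornerTangentMap_eq g x r hc hcurv hr hk hv hy) ha₀ ?_ y
    rwa [metricInner_cornerTangentMap_succ g x r hc hk (ha₀ _)]

theorem range_sunadaTangentMap_of_collinear {v : Fin n → E} (hv : v ∈ unitTuples g x n)
    (h : ∀ i, v i = v ⟨0, hn⟩ ∨ v i = -v ⟨0, hn⟩) :
    LinearMap.range (sunadaTangentMap g x r n v) =
      LinearMap.ker (metricForm g (sunadaMap g x r n v)
        ((brokenGeodesic g x r v n).2 ⟨0, hn⟩) : E →ₗ[ℝ] ℝ) := by
  ext y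
  constructor
  · rintro ⟨a, rfl⟩
    exact (metricInner_comm g _ _ _).trans
      (metricInner_cornerTangentMap_of_collinear g x r hc hn le_rfl (fun i _ ↦ h i) a.2 _
        (Or.inl rfl))
  · intro hy
    -- The last segment has index `m`, and its direction is that of index `0` up to sign, so the two
    -- hyperplanes coincide.
    obtain ⟨m, rfl⟩ := Nat.exists_eq_succ_of_ne_zero hn.ne'
    have hy' : metricInner g (brokenGeodesic g x r v (m + 1)).1 y
        ((brokenGeodesic g x r v (m + 1)).2 ⟨0, hn⟩) = 0 := (metricInner_comm g _ _ _).trans hy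
    obtain ⟨a, ha, hay⟩ := exists_cornerTangentMap_eq g x r hc hcurv hr (Nat.lt_succ_self m) hv
      (metricInner_eq_zero_of_eq_or_eq_neg g (brokenGeodesic_eq_or_eq_neg g x r hc (h _) _) hy')
    exact ⟨⟨a, ha⟩, hay⟩

theorem finrank_quotient_range_sunadaTangentMap {v : Fin n → E} (hv : v ∈ unitTuples g x n)
    (h : ∀ i, v i = v ⟨0, hn⟩ ∨ v i = -v ⟨0, hn⟩) :
    Module.finrank ℝ (E ⧸ LinearMap.range (sunadaTangentMap g x r n v)) = 1 := by
  rw [range_sunadaTangentMap_of_collinear g x r hc hn hcurv hr hv h]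
  have hw := (metricInner_brokenGeodesic g x r hc v n ⟨0, hn⟩ ⟨0, hn⟩).trans (hv _)
  have h1 := finrank_ker_metricForm g (brokenGeodesic g x r v n).1 (ne_zero_of_metricInner_self g hw)
  have h2 := Submodule.finrank_quotient_add_finrank (LinearMap.ker
    (metricForm g (sunadaMap g x r n v) ((brokenGeodesic g x r v n).2 ⟨0, hn⟩) : E →ₗ[ℝ] ℝ))
  have h3 := h2.trans h1.symm
  rw [add_comm] at h3
  exact Nat.add_left_cancel h3

omit hc hcurv hr [FiniteDimensional ℝ E] [T2Space M] in
theorem corankSet_one_subset_singularSet : corankSet g x r n 1 ⊆ singularSet g x r n := by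
  rintro v ⟨hv, h⟩
  refine ⟨hv, fun hs ↦ ?_⟩
  rw [LinearMap.range_eq_top.2 hs, Module.finrank_zero_of_subsingleton] at h
  exact zero_ne_one h

theorem singularSet_eq : singularSet g x r n =
    {v ∈ unitTuples g x n | ∀ i, v i = v ⟨0, hn⟩ ∨ v i = - v ⟨0, hn⟩} := by
  ext v
  refine ⟨fun ⟨hv, hs⟩ ↦ ⟨hv, ?_⟩, fun ⟨hv, h⟩ ↦ corankSet_one_subset_singularSet g x r
    ⟨hv, finrank_quotient_range_sunadaTangentMap g x r hc hn hcurv hr hv h⟩⟩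
  by_contra hcol
  refine hs fun y ↦ ?_
  obtain ⟨a, ha, hay⟩ := exists_cornerTangentMap_eq_of_not_collinear g x r hc hn hcurv hr hv
    (k := n) le_rfl (fun h ↦ hcol fun i ↦ h i i.2) y
  exact ⟨⟨a, ha⟩, hay⟩

include hn in
theorem singularSet_eq_corankSet : singularSet g x r n = corankSet g x r n 1 := by
  refine Subset.antisymm (fun v hv ↦ ?_) (corankSet_one_subset_singularSet g x r)
  rw [singularSet_eq g x r hc hn hcurv hr] at hv
  exact ⟨hv.1, finrank_quotient_range_sunadaTangentMap g x r hc hn hcurv hr hv.1 hv.2⟩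

end Singular

/-! ### Collinear tuples -/

/-- Rescaled differences stay in the subspace, which is closed in finite dimension. An upper bound
on the tangent cone is all that injectivity requires. -/
theorem tangentConeAt_subset_of_subset_submodule {V : Type*} [NormedAddCommGroup V]
    [NormedSpace ℝ V] [FiniteDimensional ℝ V] {W : Submodule ℝ V} {C : Set V} (hC : C ⊆ W) {w : V}
    (hw : w ∈ W) : tangentConeAt ℝ C w ⊆ W := by
  intro y hy
  obtain ⟨ι, l, hl, c, d, -, hds, hcd⟩ := exists_fun_of_mem_tangentConeAt hy
  refine W.closed_of_finiteDimensional.mem_of_tendsto hcd (hds.mono fun i hi ↦ ?_)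
  have h1 := W.sub_mem (hC hi) hw
  rw [add_sub_cancel_left] at h1
  exact W.smul_mem _ h1

section Collinear

variable {E : Type*} [NormedAddCommGroup E] [NormedSpace ℝ E] [FiniteDimensional ℝ E]
  {M : Type*} [TopologicalSpace M] [T2Space M] [ChartedSpace E M] [IsManifold 𝓘(ℝ, E) ∞ M]
  (g : SmoothMetric E M) (x : M) (r : ℝ) {n : ℕ} (hc : IsCompleteMetric g)
include hc

/-- Starting along a multiple of the velocity retraces the same geodesic at speed `e`, backwards if
`e < 0`. Its velocity is parallel and is `e` times the old one, so dividing by `e` gives the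
transport. -/
theorem parallelTransport_geodesic_smul_velocity (p : M) (u : E) {e : ℝ} (he : e ≠ 0) (t r : ℝ) :
    geodesic g (geodesic g p u t) (e • velocity (geodesic g p u) t) r
        = geodesic g p u (e * r + t) ∧
      parallelTransport g (geodesic g (geodesic g p u t) (e • velocity (geodesic g p u) t))
        (velocity (geodesic g p u) t) r = velocity (E := E) (geodesic g p u) (e * r + t) := by
  obtain ⟨h1, h2⟩ := geodesic_add g hc p u t (e * r)
  obtain ⟨h3, h4⟩ := geodesic_mul g hc (geodesic g p u t) (velocity (geodesic g p u) t) e r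
  obtain ⟨h5, -, h6⟩ := hc.geodesic_spec g (geodesic g p u t) (e • velocity (geodesic g p u) t)
  refine ⟨h3.symm.trans h1.symm, ?_⟩
  have h7 := velocity_eq_parallelTransport g h5 r
  rw [h6, parallelTransport_smul g h5.1, ← h4, ← h2] at h7
  exact (smul_right_injective E he h7).symm

/-- All segments fold onto the geodesic with initial velocity `u`, each advancing its parameter by
`e i * r`. -/
theorem brokenGeodesic_collinear {v : Fin n → E} {u : E} {e : ℕ → ℝ} (he : ∀ i, i < n → e i ≠ 0)
    (hv : ∀ i : Fin n, v i = e i • u) {k : ℕ} (hk : k ≤ n) :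
    brokenGeodesic g x r v k = (geodesic g x u (r * ∑ i ∈ Finset.range k, e i),
      fun i : Fin n ↦ e i • velocity (geodesic g x u) (r * ∑ i ∈ Finset.range k, e i)) := by
  induction k with
  | zero =>
    obtain ⟨-, h1, h2⟩ := hc.geodesic_spec g x u
    rw [Finset.sum_range_zero, mul_zero, h1, h2, brokenGeodesic]
    exact congrArg _ (funext hv)
  | succ k ih =>
    have hs : r * ∑ i ∈ Finset.range (k + 1), e i = e k * r + r * ∑ i ∈ Finset.range k, e i := by
      rw [Finset.sum_range_succ]; ring
    obtain ⟨h1, h2⟩ := parallelTransport_geodesic_smul_velocity g hc x u (he k hk)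
      (r * ∑ i ∈ Finset.range k, e i) r
    rw [brokenGeodesic_succ g x r hk, ih (Nat.le_of_succ_le hk), hs]
    refine Prod.ext h1 (funext fun i ↦ ?_)
    simp only []
    rw [parallelTransport_smul g (hc.geodesic_spec g _ _).1.1, h2]

theorem sunadaMap_collinear {v : Fin n → E} {u : E} {e : Fin n → ℝ} (he : ∀ i, e i ≠ 0)
    (hv : ∀ i, v i = e i • u) : sunadaMap g x r n v = geodesic g x u (r * ∑ i, e i) := by
  set e' : ℕ → ℝ := fun i ↦ if h : i < n then e ⟨i, h⟩ else 0 with he'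
  have h1 : ∀ i : Fin n, e' i = e i := fun i ↦ dif_pos i.2
  have h2 := brokenGeodesic_collinear g x r hc (v := v) (u := u) (e := e')
    (fun i hi ↦ by rw [h1 ⟨i, hi⟩]; exact he _) (fun i ↦ by rw [h1, hv]) le_rfl
  rw [sunadaMap, h2, Finset.sum_range]
  simp only [h1]

omit hc [FiniteDimensional ℝ E] [T2Space M] in
theorem continuous_metricInner_apply (i j : Fin n) :
    Continuous fun v : Fin n → E ↦ metricInner g x (v i) (v j) := by
  simp only [← metricForm_apply]
  fun_prop

/-- The component lies in a linear subspace on which the mapping is the exponential map after a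
nonzero scaling, so injectivity is the absence of conjugate points. -/
theorem isImmersionOnSubset_sunadaMap (hcurv : NonposCurvature g) (hr : r ≠ 0) (hn : 0 < n)
    {v : Fin n → E} (hv : v ∈ singularSet g x r n) (hsum : ∑ i, v i ≠ 0) :
    IsImmersionOnSubset (sunadaMap g x r n) (connectedComponentIn (singularSet g x r n) v) := by
  set S := singularSet g x r n with hS
  have hSeq : S = _ := singularSet_eq g x r hc hn hcurv hr
  set C := connectedComponentIn S v with hC
  have hCS : C ⊆ S := connectedComponentIn_subset S v
  have hvC : v ∈ C := mem_connectedComponentIn hv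
  set e : Fin n → ℝ := fun i ↦ metricInner g x (v i) (v ⟨0, hn⟩) with hedef
  have hsq : ∀ y ∈ S, ∀ i, metricInner g x (y i) (y ⟨0, hn⟩) ∈ ({1, -1} : Set ℝ) := by
    intro y hy i
    rw [hSeq] at hy
    have h1 := hy.1 ⟨0, hn⟩
    rcases hy.2 i with h | h
    · exact Or.inl (by rw [h, h1])
    · refine Or.inr ?_
      rw [← metricForm_apply] at *
      rw [h, map_neg, neg_apply, h1]
      rfl
  have hsq' : ∀ y ∈ S, ∀ i, metricInner g x (y i) (y ⟨0, hn⟩) ^ 2 = 1 := fun y hy i ↦ by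
    rcases hsq y hy i with h | h <;> rw [h] <;> norm_num
  -- A continuous function with values in the discrete set {1, -1} is constant on a connected set.
  have hconst : ∀ y ∈ C, ∀ i, metricInner g x (y i) (y ⟨0, hn⟩) = e i := fun y hy i ↦
    (isPreconnected_connectedComponentIn (F := S) (x := v)).constant_of_mapsTo
      (Set.toFinite ({1, -1} : Set ℝ)).isDiscrete
      (continuous_metricInner_apply g x i ⟨0, hn⟩).continuousOn (fun y hy ↦ hsq y (hCS hy) i) hy hvC
  let W : Submodule ℝ (Fin n → E) :=
    { carrier := {y | ∀ i, y i = e i • y ⟨0, hn⟩}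
      zero_mem' := fun i ↦ (smul_zero _).symm
      add_mem' := fun {a b} ha hb i ↦ by
        rw [Pi.add_apply, Pi.add_apply, ha i, hb i, smul_add]
      smul_mem' := fun c a ha i ↦ by
        rw [Pi.smul_apply, Pi.smul_apply, ha i, smul_comm] }
  have hCW : C ⊆ W := fun y hy i ↦ by
    have hy' : y ∈ unitTuples g x n := (hCS hy).1
    rw [← hconst y hy i]
    exact eq_smul_of_metricInner_sq_eq_one g (hy' _) (hy' _) (hsq' y (hCS hy) i)
  have he : ∀ i, e i ≠ 0 := fun i h0 ↦ by
    have h1 := hsq' v hv i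
    rw [show metricInner g x (v i) (v ⟨0, hn⟩) = 0 from h0] at h1
    norm_num at h1
  -- The sum of the `v i` is `∑ e i` times the entry of index `0`. The resulting time may be
  -- negative, which the conjugate point lemma permits.
  have hT : r * ∑ i, e i ≠ 0 := by
    refine mul_ne_zero hr fun h0 ↦ hsum ?_
    rw [Finset.sum_congr rfl fun i _ ↦ hCW hvC i, ← Finset.sum_smul, h0, zero_smul]
  have hφ : ContMDiff 𝓘(ℝ, Fin n → E) 𝓘(ℝ, E) ∞ (sunadaMap g x r n) :=
    contMDiff_brokenGeodesic g x r hc hn n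
  intro w hw
  have hspan : Submodule.span ℝ (tangentConeAt ℝ C w) ≤ W :=
    Submodule.span_le.2 (tangentConeAt_subset_of_subset_submodule hCW (hCW hw))
  intro a ha b hb hab
  have hd : a - b ∈ W := W.sub_mem (hspan ha) (hspan hb)
  rw [← sub_eq_zero, ← map_sub, ← velocity_comp_line hφ] at hab
  -- The line leaves the unit tuples but stays in `W`, and the folding formula needs no
  -- normalization.
  have hline : (fun s : ℝ ↦ sunadaMap g x r n (w + s • (a - b)))
      = fun s : ℝ ↦ geodesic g x (w ⟨0, hn⟩ + s • (a - b) ⟨0, hn⟩) (r * ∑ i, e i) := by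
    ext s
    exact sunadaMap_collinear g x r hc he (W.add_mem (hCW hw) (W.smul_mem s hd))
  rw [hline] at hab
  have h0 := eq_zero_of_velocity_geodesic_eq_zero g hc hcurv _ _ _ hT hab
  rw [← sub_eq_zero]
  ext i
  rw [hd i, h0, smul_zero, Pi.zero_apply]

end Collinear

end

theorem mainTheorem4
    {E : Type*} [NormedAddCommGroup E] [NormedSpace ℝ E] [FiniteDimensional ℝ E]
    {M : Type*} [TopologicalSpace M] [T2Space M] [SecondCountableTopology M]
    [ChartedSpace E M] [IsManifold 𝓘(ℝ, E) ∞ M]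
    (g : SmoothMetric E M) (hcomplete : IsCompleteMetric g) (hcurv : NonposCurvature g)
    (x : M) (r : ℝ) (hr : 0 < r) (n : ℕ) (hn : 0 < n) :
    ContMDiff 𝓘(ℝ, Fin n → E) 𝓘(ℝ, E) ∞ (sunadaMap g x r n) ∧
    singularSet g x r n = corankSet g x r n 1 ∧
    singularSet g x r n =
      {v ∈ unitTuples g x n | ∀ i, v i = v ⟨0, hn⟩ ∨ v i = - v ⟨0, hn⟩} ∧
    ∀ v ∈ singularSet g x r n, ∑ i, v i ≠ 0 →
      IsImmersionOnSubset (sunadaMap g x r n) (connectedComponentIn (singularSet g x r n) v) :=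
  ⟨contMDiff_brokenGeodesic g x r hcomplete hn n,
    singularSet_eq_corankSet g x r hcomplete hn hcurv hr.ne',
    singularSet_eq g x r hcomplete hn hcurv hr.ne',
    fun _ hv hsum ↦ isImmersionOnSubset_sunadaMap g x r hcomplete hcurv hr.ne' hn hv hsum⟩
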